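/- **Notation.** For $n\ge 0$ let $\mathcal J_b=\sum_{a<b}(a\,b)\in\mathbf C[S_n]$ $(1\le b\le n)$ be the Jucys–Murphy elements, $C_\mu$ the sum of all permutations of cycle type $\mu\vdash n$, and $$H(z,\mathcal J)=\prod_{b=1}^n\frac1{1-z\mathcal J_b},\qquad E(w,\mathcal J)=\prod_{b=1}^n(1+w\mathcal J_b),$$ formal power series in $z,w$ over $\mathbf C[S_n]$. Let $q\in\mathbf C$; the element $q^{P_0}$ acts on $\mathbf C[S_n]$ as the scalar $q^n$. Let $\Lambda=\mathbf C[P_1,P_2,\dots]$ be the ring of symmetric functions with power sums $P_k$, $P_\mu=\prod_iP_{\mu_i}$, Schur functions $S_\lambda=\det(h_{\lambda_i-i+j})_{1\le i,j\le\ell(\lambda)}$, where $h_k=\sum_{\mu\vdash k}P_\mu/Z_\mu$ ($h_k=0$ for $k<0$) and $Z_\mu=\prod_i m_i!\,i^{m_i}$ with $m_i$ the multiplicity of $i$ in $\mu$. Let $\mathrm{ch}:\mathbf C[S_n]\to\Lambda$ be the linear map $g\mapsto P_{\mathrm{cyc}(g)}/n!$, and for $\lambda\vdash n$ put $$r_\lambda(z,w)=\prod_{(i,j)\in\lambda}\frac{1+(j-i)w}{1-(j-i)z}.$$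 A *mixed $(k,l)$-walk* in $S_n$ is a sequence $g_0,\dots,g_{k+l}$ with $g_i=(a_i\,b_i)g_{i-1}$, $a_i<b_i$, such that $b_1\le\dots\le b_k$ (weakly monotone) and $b_{k+1}<\dots<b_{k+l}$ (strictly monotone). Let $E_{k,l}(\lambda,\mu)$ be the number of mixed $(k,l)$-walks that start at some permutation of cycle type $\lambda$ and end at some permutation of cycle type $\mu$, divided by the number of permutations of cycle type $\mu$. **Theorem.** (1) For every $h\in S_n$ of cycle type $\mu$, $E_{k,l}(\lambda,\mu)$ is the number of mixed $(k,l)$-walks that start at some permutation of cycle type $\lambda$ and end at $h$; and, for every $\lambda\vdash n$, $$q^{P_0}H(z,\mathcal J)E(w,\mathcal J)\,C_\lambda=\sum_{k,l\ge0}z^kw^l\sum_{\mu\vdash n}q^{n}E_{k,l}(\lambda,\mu)\,C_\mu .$$ (2) In $\Lambda\otimes\Lambda$, coefficientwise in $z,w$, $$(\mathrm{ch}\otimes\mathrm{ch})\Big(\sum_{g\in S_n}n!\,g\otimes q^{P_0}H(z,\mathcal J)E(w,\mathcal J)g\Big)=\sum_{k,l\ge0}z^kw^l\sum_{\lambda,\mu\vdash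 n}q^nE_{k,l}(\lambda,\mu)Z_\mu^{-1}P_\lambda\otimes P_\mu=\sum_{\lambda\vdash n}q^n r_\lambda(z,w)\,S_\lambda\otimes S_\lambda .$$ (3) Let $\alpha\in\mathbf C$ not be a positive integer and $N\ge1$. For $q\ne0$ let $\rho_j=q^j(1-\alpha)_j/j!$ for $j\ge1$ and $\rho_j=1$ for $j\le0$, where $(x)_j=x(x+1)\cdots(x+j-1)$, and put $r_j=\rho_j/\rho_{j-1}$, $r_0(N)=\prod_{j=0}^{N-1}\rho_j$, $r_\lambda(N)=r_0(N)\prod_{(i,j)\in\lambda}r_{N+j-i}$. For $a,b\in\mathbf C^N$ let $A=\mathrm{diag}(a)$, $B=\mathrm{diag}(b)$, write $f([A])$ for the value of $f\in\Lambda$ at $P_k=\mathrm{tr}(A^k)$, and, for $q\in\mathbf C$ such that $|q\,a_ib_j|<1$ for all $i,j$, let $$I_N(q)=\int_{U(N)}\det(\mathbf I_N-qUAU^\dagger B)^{\alpha-N}\,d\mu(U),$$ where $\mu$ is the normalized Haar measure and $\det(M)^s$ is the product of the principal $s$-th powers of the eigenvalues of $M$. (a) If $q\ne0$ and $\ell(\lambda)\le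 N$, then $$\Big(q\big(1-\tfrac\alpha N\big)\Big)^{|\lambda|}r_\lambda\Big(-\tfrac1N,\tfrac1{N-\alpha}\Big)=\frac{r_\lambda(N)}{r_0(N)} .$$ (b) If $q\ne0$ and $|q\,a_ib_j|<1$ for all $i,j$, then the integrand of $I_N(q)$ is integrable, and the hypergeometric $\tau$-function $\tau(N,\mathbf t,\mathbf s)=\sum_\lambda r_\lambda(N)S_\lambda(\mathbf t)S_\lambda(\mathbf s)$, evaluated at $\mathbf t=[A]$, $\mathbf s=[B]$, converges absolutely and equals $r_0(N)\,I_N(q)$. (c) There are numbers $c_n$, $n\ge0$ (depending on $N,\alpha,a,b$ but not on $q$) such that $I_N(q)=\sum_{n\ge0}c_nq^n$ whenever $|q\,a_ib_j|<1$ for all $i,j$, and for every $n\le N$, with an absolutely convergent sum, $$c_n=\Big(1-\frac\alpha N\Big)^{n}\sum_{k,l\ge0}\Big(-\frac1N\Big)^k\Big(\frac1{N-\alpha}\Big)^l\sum_{\lambda,\mu\vdash n}E_{k,l}(\lambda,\mu)Z_\mu^{-1}P_\lambda([A])P_\mu([B]).$$ Thus, as $N\to\infty$, the matrix integral is a generating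 function for the mixed weakly/strictly monotone double Hurwitz numbers $E_{k,l}(\lambda,\mu)$, with $z=-1/N$, $w=1/(N-\alpha)$ and $q$ replaced by $q(1-\alpha/N)$: in each degree $n$ the identity is exact as soon as $N\ge n$. -/

import Mathlib

open MeasureTheory
open scoped Nat TensorProduct Matrix

noncomputable section

namespace MonotoneHurwitz

/-! ### The group algebra of the symmetric group -/

/-- The group algebra `ℂ[S_n]`. -/
abbrev GroupAlg (n : ℕ) : Type := MonoidAlgebra ℂ (Equiv.Perm (Fin n))

/-- The permutation `g`, seen as an element of `ℂ[S_n]`. -/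
abbrev perm {n : ℕ} (g : Equiv.Perm (Fin n)) : GroupAlg n := MonoidAlgebra.of ℂ _ g

/-- `g` has cycle type `μ`, fixed points being recorded as parts equal to `1`. -/
def HasCycleType {n : ℕ} (g : Equiv.Perm (Fin n)) (μ : n.Partition) : Prop :=
  g.partition.parts = μ.parts

open Classical in
/-- The conjugacy class with cycle type `μ`. -/
def cycleClass {n : ℕ} (μ : n.Partition) : Finset (Equiv.Perm (Fin n)) :=
  Finset.univ.filter fun g => HasCycleType g μ

/-- The class sum `C_μ`. -/
def classSum {n : ℕ} (μ : n.Partition) : GroupAlg n := ∑ g ∈ cycleClass μ, perm g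

/-- The Jucys-Murphy element `𝒥_b`, the sum of the transpositions `(a b)` with `a < b`. -/
def jucysMurphy {n : ℕ} (b : Fin n) : GroupAlg n := ∑ a ∈ Finset.Iio b, perm (Equiv.swap a b)

/-! ### Formal power series in `z` (variable `0`) and `w` (variable `1`) -/

/-- The exponent of the monomial `z ^ k * w ^ l`. -/
def expo (k l : ℕ) : Fin 2 →₀ ℕ := Finsupp.single 0 k + Finsupp.single 1 l

/-- `H(z, 𝒥) = ∏_b 1 / (1 - z 𝒥_b)`, a formal power series with coefficients in `ℂ[S_n]`. -/
def genH (n : ℕ) : MvPowerSeries (Fin 2) (GroupAlg n) :=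
  (List.ofFn fun b : Fin n =>
    MvPowerSeries.invOfUnit
      (1 - MvPowerSeries.X 0 * MvPowerSeries.C (jucysMurphy b)) 1).prod

/-- `E(w, 𝒥) = ∏_b (1 + w 𝒥_b)`. -/
def genE (n : ℕ) : MvPowerSeries (Fin 2) (GroupAlg n) :=
  (List.ofFn fun b : Fin n => 1 + MvPowerSeries.X 1 * MvPowerSeries.C (jucysMurphy b)).prod

/-- `q ^ P₀ * H(z, 𝒥) * E(w, 𝒥)`, where `P₀` takes the value `n • 1` on `ℂ[S_n]`. -/
def twist (n : ℕ) (q : ℂ) : MvPowerSeries (Fin 2) (GroupAlg n) :=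
  MvPowerSeries.C (algebraMap ℂ (GroupAlg n) (q ^ n)) * genH n * genE n

/-! ### Weakly-then-strictly monotone walks in the Cayley graph -/

/-- The data of a `(k + l)`-step walk: its `k + l + 1` vertices, and the pairs `(a, b)` that label
the transpositions `(a b)` of its `k + l` steps. -/
abbrev WalkData (n k l : ℕ) : Type :=
  (Fin (k + l + 1) → Equiv.Perm (Fin n)) × (Fin (k + l) → Fin n × Fin n)

/-- A walk in the Cayley graph of `S_n` generated by all transpositions. The `i`-th step multiplies
the current vertex on the left by `(a_i b_i)`, `a_i < b_i` (so that the labels are determined by the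
vertices); the first `k` steps are weakly monotone, `b_1 ≤ ... ≤ b_k`, and the last `l` steps are
strictly monotone, `b_{k+1} < ... < b_{k+l}`. -/
def IsMixedWalk {n : ℕ} (k l : ℕ) (W : WalkData n k l) : Prop :=
  (∀ i : Fin (k + l), (W.2 i).1 < (W.2 i).2 ∧
    W.1 i.succ = Equiv.swap (W.2 i).1 (W.2 i).2 * W.1 i.castSucc) ∧
  (∀ i j : Fin (k + l), i < j → j.val < k → (W.2 i).2 ≤ (W.2 j).2) ∧
  (∀ i j : Fin (k + l), i < j → k ≤ i.val → (W.2 i).2 < (W.2 j).2)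

/-- The number of mixed walks from the conjugacy class of type `ν` to that of type `μ`. -/
def walkCount {n : ℕ} (k l : ℕ) (ν μ : n.Partition) : ℕ :=
  Set.ncard {W : WalkData n k l |
    IsMixedWalk k l W ∧ HasCycleType (W.1 0) ν ∧ HasCycleType (W.1 (Fin.last (k + l))) μ}

/-- The number of mixed walks from the conjugacy class of type `ν` to the vertex `h`. -/
def walkCountTo {n : ℕ} (k l : ℕ) (ν : n.Partition) (h : Equiv.Perm (Fin n)) : ℕ :=
  Set.ncard {W : WalkData n k l |
    IsMixedWalk k l W ∧ HasCycleType (W.1 0) ν ∧ W.1 (Fin.last (k + l)) = h}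

/-- The number `E_{k,l}(ν, μ)` of mixed walks from the class of type `ν` to the class of
type `μ`, per end vertex. -/
def mixedHurwitz {n : ℕ} (k l : ℕ) (ν μ : n.Partition) : ℂ :=
  (walkCount k l ν μ : ℂ) / ((cycleClass μ).card : ℂ)

/-! ### Partitions and contents -/

/-- The `i`-th part (counted from `0`, in decreasing order) of a partition, or `0`. -/
def row {n : ℕ} (ν : n.Partition) (i : ℕ) : ℕ := (ν.parts.sort (· ≥ ·)).getD i 0

/-- The cells `(i, j)` of the Young diagram, rows and columns counted from `0`. -/
def cells {n : ℕ} (ν : n.Partition) : Finset (ℕ × ℕ) :=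
  (Finset.range n ×ˢ Finset.range n).filter fun c => c.2 < row ν c.1

/-- The content `j - i` of a cell `(i, j)`. -/
def content (c : ℕ × ℕ) : ℤ := (c.2 : ℤ) - (c.1 : ℤ)

/-- `Z_μ = ∏_i m_i! i ^ m_i`, with `m_i` the multiplicity of the part `i`. -/
def zee {n : ℕ} (μ : n.Partition) : ℕ :=
  ∏ i ∈ μ.parts.toFinset, (μ.parts.count i)! * i ^ μ.parts.count i

/-- `r_λ(z, w) = ∏ (1 + (j - i) w) / (1 - (j - i) z)` as a formal power series in `z` and `w`. -/
def contentSeries {n : ℕ} (ν : n.Partition) : MvPowerSeries (Fin 2) ℂ :=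
  ∏ c ∈ cells ν,
    (1 + MvPowerSeries.C (content c : ℂ) * MvPowerSeries.X 1) *
      (1 - MvPowerSeries.C (content c : ℂ) * MvPowerSeries.X 0)⁻¹

/-- `r_λ(z, w)` at complex numbers `z` and `w`. -/
def contentProd {n : ℕ} (ν : n.Partition) (z w : ℂ) : ℂ :=
  ∏ c ∈ cells ν, (1 + (content c : ℂ) * w) / (1 - (content c : ℂ) * z)

/-! ### Symmetric functions and the characteristic map -/

/-- The ring of symmetric functions `ℂ[P_1, P_2, ...]`. -/
abbrev SymFun : Type := MvPolynomial ℕ+ ℂ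

/-- The power sum `P_k`, for `k ≥ 1`. -/
def psum (k : ℕ) : SymFun := MvPolynomial.X k.toPNat'

/-- The product of the power sums `P_k` over a multiset of `k`'s. -/
def psumMultiset (s : Multiset ℕ) : SymFun := (s.map psum).prod

/-- The power sum symmetric function `P_μ`. -/
def psumPart {n : ℕ} (μ : n.Partition) : SymFun := psumMultiset μ.parts

/-- The complete symmetric function `h_k = ∑_{μ ⊢ k} P_μ / Z_μ`. -/
def complete (k : ℕ) : SymFun := ∑ μ : k.Partition, (zee μ : ℂ)⁻¹ • psumPart μ

/-- `h_m` for integral `m`, equal to `0` for `m < 0`. -/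
def completeInt (m : ℤ) : SymFun := if m < 0 then 0 else complete m.toNat

/-- The Schur function `S_λ = det (h_{λ_i - i + j})`, with `1 ≤ i, j ≤ ℓ(λ)`. -/
def schur {n : ℕ} (ν : n.Partition) : SymFun :=
  Matrix.det (Matrix.of fun i j : Fin (Multiset.card ν.parts) =>
    completeInt ((row ν i : ℤ) - (i : ℤ) + (j : ℤ)))

/-- The characteristic map `ch_n : ℂ[S_n] → Λ`, `g ↦ P_{cyc(g)} / n!`. -/
def charMap (n : ℕ) : GroupAlg n →ₗ[ℂ] SymFun :=
  Finsupp.linearCombination ℂ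
    (fun g : Equiv.Perm (Fin n) => ((n ! : ℂ)⁻¹) • psumMultiset g.partition.parts) ∘ₗ
      (MonoidAlgebra.coeffLinearEquiv ℂ).toLinearMap

/-- `ch ⊗ ch : ℂ[S_n] ⊗ ℂ[S_n] → Λ ⊗ Λ`. -/
def charMap₂ (n : ℕ) : GroupAlg n ⊗[ℂ] GroupAlg n →ₗ[ℂ] SymFun ⊗[ℂ] SymFun :=
  TensorProduct.map (charMap n) (charMap n)

/-- The value of a symmetric function at `[A]`, for `A = diag(a_1, ..., a_N)`: the power sum `P_k`
takes the value `tr (A ^ k)`. -/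
def evalAt {N : ℕ} (a : Fin N → ℂ) (f : SymFun) : ℂ :=
  MvPolynomial.eval (fun k : ℕ+ => Matrix.trace (Matrix.diagonal a ^ (k : ℕ))) f

/-! ### The hypergeometric coefficients -/

/-- `ρ_j = q ^ j (1 - α)_j / j!` for `j ≥ 1`, and `1` for `j ≤ 0`. -/
def rho (α q : ℂ) (j : ℤ) : ℂ :=
  if 1 ≤ j then q ^ j.toNat * (ascPochhammer ℂ j.toNat).eval (1 - α) / (j.toNat ! : ℂ) else 1

/-- `r_j = ρ_j / ρ_{j-1}`. -/
def ratio (α q : ℂ) (j : ℤ) : ℂ := rho α q j / rho α q (j - 1)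

/-- `r_0(N) = ∏_{j=0}^{N-1} ρ_j`. -/
def rZero (α q : ℂ) (N : ℕ) : ℂ := ∏ j ∈ Finset.range N, rho α q j

/-- `r_λ(N) = r_0(N) ∏_{(i,j) ∈ λ} r_{N+j-i}`. -/
def rPart (α q : ℂ) (N : ℕ) {n : ℕ} (ν : n.Partition) : ℂ :=
  rZero α q N * ∏ c ∈ cells ν, ratio α q ((N : ℤ) + content c)

/-! ### The matrix integral -/

/-- `det(M) ^ s` for a matrix whose eigenvalues lie in the slit plane: the product of the principal
powers of the eigenvalues. On `{M | ‖M - 1‖ < 1}` it is the continuous branch that is `1` at the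
identity matrix. -/
def detPow {N : ℕ} (M : Matrix (Fin N) (Fin N) ℂ) (s : ℂ) : ℂ :=
  (M.charpoly.roots.map fun x => x ^ s).prod

/-- The unitary group `U(N)`. -/
abbrev UGroup (N : ℕ) : Type := Matrix.unitaryGroup (Fin N) ℂ

instance compactSpaceUGroup (N : ℕ) : CompactSpace (UGroup N) := by
  refine isCompact_iff_compactSpace.mp (?_ : IsCompact
    (Matrix.unitaryGroup (Fin N) ℂ : Set (Matrix (Fin N) (Fin N) ℂ)))
  have hcl : IsClosed (Matrix.unitaryGroup (Fin N) ℂ : Set (Matrix (Fin N) (Fin N) ℂ)) :=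
    isClosed_unitary
  have hK : IsCompact (Set.univ.pi fun _ : Fin N => Set.univ.pi fun _ : Fin N =>
      Metric.closedBall (0 : ℂ) 1) :=
    isCompact_univ_pi fun _ => isCompact_univ_pi fun _ => isCompact_closedBall _ _
  refine hK.of_isClosed_subset hcl fun U hU => ?_
  intro i _ j _
  simpa using entry_norm_bound_of_unitary hU i j

instance measurableSpaceUGroup (N : ℕ) : MeasurableSpace (UGroup N) := borel _

instance borelSpaceUGroup (N : ℕ) : BorelSpace (UGroup N) := ⟨rfl⟩

/-- The Haar measure on `U(N)` of total mass `1`. -/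
def unitaryHaar (N : ℕ) : Measure (UGroup N) := Measure.haarMeasure ⊤

/-- The integrand `det(1 - q U A U† B) ^ (α - N)`, for `A = diag(a)` and `B = diag(b)`. -/
def integrand (N : ℕ) (α q : ℂ) (a b : Fin N → ℂ) (U : UGroup N) : ℂ :=
  detPow (1 - q • ((U : Matrix (Fin N) (Fin N) ℂ) * Matrix.diagonal a *
    (U : Matrix (Fin N) (Fin N) ℂ)ᴴ * Matrix.diagonal b)) (α - N)

/-- The matrix integral over `U(N)` of `det(1 - q U A U† B) ^ (α - N)`. -/
def matrixIntegral (N : ℕ) (α q : ℂ) (a b : Fin N → ℂ) : ℂ :=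
  ∫ U, integrand N α q a b U ∂(unitaryHaar N)

end MonotoneHurwitz

end

/-! The coefficient of z^k w^l in H(z,𝒥)E(w,𝒥) is h_k(𝒥) e_l(𝒥). Expanding it into products of
transpositions yields exactly the label sequences of mixed walks (`sum_mixedLabels`). This element
is central: s = (i i+1) satisfies s 𝒥_{i+1} = 𝒥_i s + 1, hence commutes with 𝒥_i + 𝒥_{i+1} and
𝒥_{i+1} 𝒥_i, and so with every symmetric expression in the 𝒥_b (`commute_elem_jmSeq`). The number of
walks from a class to h therefore depends only on the class of h, which gives (1) and the power-sum
half of (2).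

For the Schur half, central elements act on the image of ch, and the point is that S_λ is an
eigenvector of e_l(𝒥) with eigenvalue e_l of the contents (`exists_eigenvector`). No representation
theory of S_n enters. On the alternating polynomials ch(x)·a_δ in N variables the sum T of all
transpositions acts as (∑ (x_i ∂_i)^2 - const)/2, the radial part of the Casimir element of gl_N, so
the alternant a_{λ+δ} has the sum of the contents of λ as eigenvalue. Multiplying S_u by P_1 adds a
box in all possible ways, with distinct content sums; a Lagrange polynomial in T isolates one
result, and 𝒥_{n+1} = T_{n+1} - T_n carries the eigenvalues from n to n + 1. The central element is
then applied to one side of the Cauchy identity (`charMap₂_sum_perm_eq_schur`).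

For the integral put M = N - α. The degree n part of det(1 - X)^{-M} is (1/n!) ∑_g M^{cycles(g)}
P_g(X). Its Haar average over U A U† is a conjugation-invariant polynomial in the remaining matrix,
hence a combination of Schur functions. The coefficients are found by pairing polynomials on words
with permutation operators: the pairing makes the integrand constant, and ∑_g M^{cycles(g)} g, the
product of the M + 𝒥_b, contributes ∏ (M + c) on one side against ∏ (N + c) on the other
(`wordPoly_avgCoeff`).

Box by box, (N - α + c)/(N + c) is both the factor of r_λ(N)/(r_0(N) q^n) and that of (1 - α/N)^n
r_λ(-1/N, 1/(N - α)). For n ≤ N every partition of n has at most N rows and every content is less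
than N in absolute value, so no term is cut off and the geometric series in z = -1/N converge; this
is why degree n is exact from N ≥ n on. -/

noncomputable section

namespace MonotoneHurwitz

/-! ### Elementary and complete symmetric expressions in commuting elements of a ring -/

section SymmetricExpressions

variable {R : Type*} [Ring R]

/-- The elementary symmetric expression of degree `l` in `c 0, ..., c (m - 1)`. -/
def elem (c : ℕ → R) : ℕ → ℕ → R
  | 0, _ => 1
  | _ + 1, 0 => 0
  | l + 1, m + 1 => elem c (l + 1) m + c m * elem c l m

/-- The complete symmetric expression of degree `k` in `c 0, ..., c (m - 1)`. -/
def homog (c : ℕ → R) : ℕ → ℕ → R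
  | 0, _ => 1
  | _ + 1, 0 => 0
  | k + 1, m + 1 => homog c (k + 1) m + c m * homog c k (m + 1)

@[simp] theorem elem_zero_left (c : ℕ → R) (m : ℕ) : elem c 0 m = 1 := by
  cases m <;> rfl

@[simp] theorem elem_zero_right (c : ℕ → R) (l : ℕ) : elem c (l + 1) 0 = 0 := rfl

theorem elem_succ_succ (c : ℕ → R) (l m : ℕ) :
    elem c (l + 1) (m + 1) = elem c (l + 1) m + c m * elem c l m := rfl

@[simp] theorem homog_zero_left (c : ℕ → R) (m : ℕ) : homog c 0 m = 1 := by
  cases m <;> simp [homog]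

@[simp] theorem homog_zero_right (c : ℕ → R) (l : ℕ) : homog c (l + 1) 0 = 0 := by
  simp [homog]

theorem homog_succ_succ (c : ℕ → R) (k m : ℕ) :
    homog c (k + 1) (m + 1) = homog c (k + 1) m + c m * homog c k (m + 1) := by
  simp [homog]

/-- Monomials are sorted by their largest index, which stands leftmost: the others are below `i`
here, and at most `i` in `homog_succ_eq_sum`. This is the shape of peeling the last step off a
strictly or weakly monotone walk. -/
theorem elem_succ_eq_sum (c : ℕ → R) (l m : ℕ) :
    elem c (l + 1) m = ∑ i ∈ Finset.range m, c i * elem c l i := by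
  induction m with
  | zero => simp
  | succ m ih => rw [elem_succ_succ, Finset.sum_range_succ, ih]

theorem homog_succ_eq_sum (c : ℕ → R) (k m : ℕ) :
    homog c (k + 1) m = ∑ i ∈ Finset.range m, c i * homog c k (i + 1) := by
  induction m with
  | zero => simp
  | succ m ih => rw [homog_succ_succ, Finset.sum_range_succ, ih]

theorem commute_elem {c : ℕ → R} {x : R} {m : ℕ} (h : ∀ i < m, Commute x (c i)) (l : ℕ) :
    Commute x (elem c l m) := by
  induction m generalizing l with
  | zero => cases l <;> simp
  | succ m ih =>
    cases l with
    | zero => simp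
    | succ l =>
      rw [elem_succ_succ]
      exact (ih (fun i hi => h i (by omega)) _).add_right
        ((h m (by omega)).mul_right (ih (fun i hi => h i (by omega)) _))

theorem elem_congr {c d : ℕ → R} {m : ℕ} (h : ∀ i < m, c i = d i) (l : ℕ) :
    elem c l m = elem d l m := by
  induction m generalizing l with
  | zero => cases l <;> simp
  | succ m ih =>
    cases l with
    | zero => simp
    | succ l =>
      rw [elem_succ_succ, elem_succ_succ, ih (fun i hi => h i (by omega)),
        ih (fun i hi => h i (by omega)), h m (by omega)]

theorem map_elem {R' : Type*} [Ring R'] (f : R →+* R') (c : ℕ → R) (l m : ℕ) :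
    f (elem c l m) = elem (fun i => f (c i)) l m := by
  induction m generalizing l with
  | zero => cases l <;> simp
  | succ m ih => cases l with
    | zero => simp
    | succ l => rw [elem_succ_succ, elem_succ_succ, map_add, map_mul, ih, ih]

/-- An element commuting with the sum and the product of two neighbouring variables and with all
the others commutes with the elementary symmetric expressions. -/
theorem commute_elem_of_swap {c : ℕ → R} {s : R} {m i : ℕ} (hi : i + 1 < m)
    (h : ∀ j < m, j ≠ i → j ≠ i + 1 → Commute s (c j))
    (hadd : Commute s (c i + c (i + 1))) (hmul : Commute s (c (i + 1) * c i)) (l : ℕ) :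
    Commute s (elem c l m) := by
  induction m generalizing l with
  | zero => omega
  | succ m ih =>
    rcases Nat.lt_or_ge (i + 1) m with hm | hm
    · cases l with
      | zero => simp
      | succ l =>
        rw [elem_succ_succ]
        exact (ih hm (fun j hj => h j (by omega)) _).add_right
          ((h m (by omega) (by omega) (by omega)).mul_right (ih hm (fun j hj => h j (by omega)) _))
    -- The exchanged variables are the two topmost ones: e_l is then e_l(c_0, …, c_{i-1}) + (c_i +
    -- c_{i+1}) e_{l-1} + c_{i+1} c_i e_{l-2}, the last two e's in the same lower variables.
    · obtain rfl : m = i + 1 := by omega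
      have hlow : ∀ l, Commute s (elem c l i) := fun l =>
        commute_elem (fun j hj => h j (by omega) (by omega) (by omega)) l
      rcases l with _ | _ | l
      · simp
      · have : elem c (0 + 1) (i + 1 + 1) = elem c 1 i + (c i + c (i + 1)) := by
          rw [elem_succ_succ, elem_succ_succ]; simp [add_assoc]
        rw [this]
        exact (hlow _).add_right hadd
      · simp only [elem_succ_succ, mul_add]
        have : elem c (l + 1 + 1) i + c i * elem c (l + 1) i +
            (c (i + 1) * elem c (l + 1) i + c (i + 1) * (c i * elem c l i)) =
            elem c (l + 1 + 1) i + ((c i + c (i + 1)) * elem c (l + 1) i +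
              (c (i + 1) * c i) * elem c l i) := by
          noncomm_ring
        rw [this]
        exact (hlow _).add_right ((hadd.mul_right (hlow _)).add_right (hmul.mul_right (hlow _)))

/-- The duality of elementary and complete symmetric expressions. -/
theorem homog_succ_eq_elem {c : ℕ → R} {m : ℕ}
    (hc : ∀ i < m, ∀ j < m, Commute (c i) (c j)) (k : ℕ) :
    homog c (k + 1) m =
      ∑ i ∈ Finset.range (k + 1), (-1) ^ i * elem c (i + 1) m * homog c (k - i) m := by
  induction m generalizing k with
  | zero => simp
  | succ m ih =>
    have ih' := fun k => ih (fun i hi j hj => hc i (by omega) j (by omega)) k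
    have hel : ∀ l, Commute (c m) (elem c l m) := fun l =>
      commute_elem (fun i hi => hc m (by omega) i (by omega)) l
    -- the full alternating sum
    have key : ∀ k, ∑ i ∈ Finset.range (k + 2),
        (-1) ^ i * elem c i (m + 1) * homog c (k + 1 - i) (m + 1) = 0 := by
      have hm : ∀ k, ∑ i ∈ Finset.range (k + 2),
          (-1) ^ i * elem c i m * homog c (k + 1 - i) m = 0 := by
        intro k
        rw [Finset.sum_range_succ']
        simp only [pow_zero, elem_zero_left, one_mul, Nat.sub_zero, ih' k, Nat.add_sub_add_right]
        rw [← Finset.sum_add_distrib]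
        refine Finset.sum_eq_zero fun i _ => ?_
        rw [pow_succ]; noncomm_ring
      intro k
      -- In generating series, `e1` multiplies E(-t) by 1 - c_m t and `e2` undoes the factor 1/(1 -
      -- c_m t) of H(t). The two corrections by c_m cancel, leaving the identity for m variables.
      have e1 : ∀ k, ∑ i ∈ Finset.range (k + 2),
          (-1) ^ i * elem c i (m + 1) * homog c (k + 1 - i) (m + 1) =
          ∑ i ∈ Finset.range (k + 2), (-1) ^ i * elem c i m * homog c (k + 1 - i) (m + 1) -
          c m * ∑ i ∈ Finset.range (k + 1), (-1) ^ i * elem c i m * homog c (k - i) (m + 1) := by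
        intro k
        rw [Finset.sum_range_succ', Finset.sum_range_succ' (n := k + 1), Finset.mul_sum,
          add_sub_right_comm, ← Finset.sum_sub_distrib]
        simp only [elem_zero_left, Nat.add_sub_add_right]
        congr 1
        refine Finset.sum_congr rfl fun i _ => ?_
        have hs : Commute (c m) ((-1 : R) ^ i) :=
          (Commute.neg_one_right _).pow_right i
        rw [elem_succ_succ, ← mul_assoc (c m), ← mul_assoc (c m), hs.eq, pow_succ]
        noncomm_ring
      rw [e1]
      have e2 : ∀ k, ∑ i ∈ Finset.range (k + 2),
          (-1) ^ i * elem c i m * homog c (k + 1 - i) (m + 1) =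
          ∑ i ∈ Finset.range (k + 2), (-1) ^ i * elem c i m * homog c (k + 1 - i) m +
          c m * ∑ i ∈ Finset.range (k + 1), (-1) ^ i * elem c i m * homog c (k - i) (m + 1) := by
        intro k
        rw [Finset.sum_range_succ, Finset.sum_range_succ (n := k + 1), Finset.mul_sum,
          add_right_comm, ← Finset.sum_add_distrib]
        simp only [Nat.sub_self, homog_zero_left]
        congr 1
        refine Finset.sum_congr rfl fun i hi => ?_
        have hs : Commute (c m) ((-1 : R) ^ i * elem c i m) :=
          ((Commute.neg_one_right _).pow_right i).mul_right (hel i)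
        rw [Finset.mem_range] at hi
        obtain ⟨j, rfl⟩ : ∃ j, k = i + j := ⟨k - i, by omega⟩
        rw [show i + j + 1 - i = j + 1 by omega, show i + j - i = j by omega, homog_succ_succ,
          mul_add, ← mul_assoc (c m), hs.eq]
        noncomm_ring
      rw [e2, hm, zero_add, sub_self]
    have := key k
    rw [Finset.sum_range_succ'] at this
    simp only [pow_zero, elem_zero_left, one_mul, Nat.sub_zero, Nat.add_sub_add_right] at this
    rw [add_comm] at this
    rw [eq_neg_of_add_eq_zero_left this, ← Finset.sum_neg_distrib]
    refine Finset.sum_congr rfl fun i _ => ?_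
    rw [pow_succ]; noncomm_ring

/-- By duality the complete expressions are polynomials in the elementary ones, so centrality need
only be proved for the latter. -/
theorem commute_homog {c : ℕ → R} {x : R} {m : ℕ}
    (hc : ∀ i < m, ∀ j < m, Commute (c i) (c j))
    (h : ∀ l, Commute x (elem c l m)) (k : ℕ) : Commute x (homog c k m) := by
  induction k using Nat.strong_induction_on with
  | _ k ih =>
    cases k with
    | zero => simp
    | succ k =>
      rw [homog_succ_eq_elem hc]
      refine Commute.sum_right _ _ _ fun i _ => ?_
      exact (((Commute.neg_one_right _).pow_right i).mul_right (h _)).mul_right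
        (ih _ (by omega))

/-- The two-variable power series with coefficients `f k l`. -/
def bivariate (f : ℕ → ℕ → R) : MvPowerSeries (Fin 2) R := fun d => f (d 0) (d 1)

theorem expo_apply_zero (k l : ℕ) : expo k l 0 = k := by simp [expo]

theorem expo_apply_one (k l : ℕ) : expo k l 1 = l := by simp [expo]

theorem expo_apply (d : Fin 2 →₀ ℕ) : expo (d 0) (d 1) = d := by
  ext i; fin_cases i
  · exact expo_apply_zero _ _
  · exact expo_apply_one _ _

@[simp] theorem coeff_bivariate (f : ℕ → ℕ → R) (k l : ℕ) :
    MvPowerSeries.coeff (expo k l) (bivariate f) = f k l := by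
  rw [MvPowerSeries.coeff_apply, bivariate, expo_apply_zero, expo_apply_one]

theorem ext_expo {F G : MvPowerSeries (Fin 2) R}
    (h : ∀ k l, MvPowerSeries.coeff (expo k l) F = MvPowerSeries.coeff (expo k l) G) : F = G := by
  refine MvPowerSeries.ext fun d => ?_
  rw [← expo_apply d]; exact h _ _

theorem expo_succ_left (k l : ℕ) : expo (k + 1) l = Finsupp.single 0 1 + expo k l := by
  simp only [expo, Finsupp.single_add]; abel

theorem expo_succ_right (k l : ℕ) : expo k (l + 1) = Finsupp.single 1 1 + expo k l := by
  simp only [expo, Finsupp.single_add]; abel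

theorem coeff_succ_X_zero_mul (k l : ℕ) (F : MvPowerSeries (Fin 2) R) :
    MvPowerSeries.coeff (expo (k + 1) l) (MvPowerSeries.X 0 * F) =
      MvPowerSeries.coeff (expo k l) F := by
  rw [expo_succ_left, MvPowerSeries.X_def, MvPowerSeries.coeff_add_monomial_mul, one_mul]

theorem coeff_zero_X_zero_mul (l : ℕ) (F : MvPowerSeries (Fin 2) R) :
    MvPowerSeries.coeff (expo 0 l) (MvPowerSeries.X 0 * F) = 0 := by
  classical
  rw [MvPowerSeries.X_def, MvPowerSeries.coeff_monomial_mul, if_neg]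
  intro h
  have := h 0
  simp [expo_apply_zero] at this

theorem coeff_succ_X_one_mul (k l : ℕ) (F : MvPowerSeries (Fin 2) R) :
    MvPowerSeries.coeff (expo k (l + 1)) (MvPowerSeries.X 1 * F) =
      MvPowerSeries.coeff (expo k l) F := by
  rw [expo_succ_right, MvPowerSeries.X_def, MvPowerSeries.coeff_add_monomial_mul, one_mul]

theorem coeff_zero_X_one_mul (k : ℕ) (F : MvPowerSeries (Fin 2) R) :
    MvPowerSeries.coeff (expo k 0) (MvPowerSeries.X 1 * F) = 0 := by
  classical
  rw [MvPowerSeries.X_def, MvPowerSeries.coeff_monomial_mul, if_neg]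
  intro h
  have := h 1
  simp [expo_apply_one] at this

theorem commute_of_inverse {a a' b : R} (h : a * a' = 1) (h' : a' * a = 1) (hb : Commute a b) :
    Commute a' b := by
  have : a' * b = b * a' := by
    calc a' * b = a' * b * (a * a') := by rw [h, mul_one]
      _ = a' * (b * a) * a' := by noncomm_ring
      _ = (a' * a) * b * a' := by rw [← hb.eq]; noncomm_ring
      _ = b * a' := by rw [h', one_mul]
  exact this

/-- The generating series of the elementary symmetric expressions. -/
theorem prod_one_add_eq_bivariate {c : ℕ → R} {m : ℕ}
    (hc : ∀ i < m, ∀ j < m, Commute (c i) (c j)) :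
    (List.ofFn fun b : Fin m =>
      (1 + MvPowerSeries.X 1 * MvPowerSeries.C (c b) : MvPowerSeries (Fin 2) R)).prod =
      bivariate fun k l => if k = 0 then elem c l m else 0 := by
  induction m with
  | zero =>
    refine ext_expo fun k l => ?_
    simp only [List.ofFn_zero, List.prod_nil, coeff_bivariate]
    rw [MvPowerSeries.coeff_one]
    rcases k with _ | k
    · rcases l with _ | l
      · simp [expo]
      · have : expo 0 (l + 1) ≠ 0 := fun h => by
          have := DFunLike.congr_fun h 1; simp [expo_apply_one] at this
        simp [this]
    · have : expo (k + 1) l ≠ 0 := fun h => by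
        have := DFunLike.congr_fun h 0; simp [expo_apply_zero] at this
      simp [this]
  | succ m ih =>
    rw [List.ofFn_succ', List.prod_concat]
    simp only [Fin.val_castSucc, Fin.val_last]
    rw [ih fun i hi j hj => hc i (by omega) j (by omega)]
    have hel : ∀ l, Commute (c m) (elem c l m) := fun l =>
      commute_elem (fun i hi => hc m (by omega) i (by omega)) l
    refine ext_expo fun k l => ?_
    rw [mul_add, mul_one, map_add, ← mul_assoc, ← MvPowerSeries.X_mul, mul_assoc]
    rcases l with _ | l
    · rw [coeff_zero_X_one_mul]; simp
    · rw [coeff_succ_X_one_mul, MvPowerSeries.coeff_mul_C]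
      simp only [coeff_bivariate]
      split_ifs with hk
      · rw [elem_succ_succ, (hel l).eq]
      · simp

/-- No inverse series is written out: multiplying the claimed answer by 1 - z c_m turns `homog` in m
+ 1 variables into `homog` in m variables. The factor depending on w is kept as an arbitrary
sequence `e`, so that the induction on m leaves it alone. -/
theorem prod_inv_mul_eq_bivariate {c : ℕ → R} {m : ℕ}
    (hc : ∀ i < m, ∀ j < m, Commute (c i) (c j)) (e : ℕ → R) :
    (List.ofFn fun b : Fin m =>
      (MvPowerSeries.invOfUnit (1 - MvPowerSeries.X 0 * MvPowerSeries.C (c b)) 1 :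
        MvPowerSeries (Fin 2) R)).prod * (bivariate fun k l => if k = 0 then e l else 0) =
      bivariate fun k l => homog c k m * e l := by
  have hinv : ∀ a : R, MvPowerSeries.constantCoeff
      (1 - MvPowerSeries.X 0 * MvPowerSeries.C a : MvPowerSeries (Fin 2) R) = ((1 : Rˣ) : R) := by
    intro a; simp
  have hl := fun a => MvPowerSeries.invOfUnit_mul _ _ (hinv a)
  have hr := fun a => MvPowerSeries.mul_invOfUnit _ _ (hinv a)
  have hcomm : ∀ a b : R, Commute a b → Commute
      (MvPowerSeries.invOfUnit (1 - MvPowerSeries.X 0 * MvPowerSeries.C a) 1 :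
        MvPowerSeries (Fin 2) R)
      (MvPowerSeries.invOfUnit (1 - MvPowerSeries.X 0 * MvPowerSeries.C b) 1) := by
    intro a b hab
    refine commute_of_inverse (hr a) (hl a) (commute_of_inverse (hr b) (hl b) ?_).symm
    have hX : ∀ F : MvPowerSeries (Fin 2) R, Commute F (MvPowerSeries.X 0) :=
      fun F => MvPowerSeries.commute_X F 0
    have hC : Commute (MvPowerSeries.C b : MvPowerSeries (Fin 2) R) (MvPowerSeries.C a) :=
      hab.symm.map MvPowerSeries.C
    refine Commute.sub_left (Commute.one_left _) (Commute.sub_right (Commute.one_right _) ?_)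
    exact ((hX _).symm.mul_left (((hX _)))).mul_right ((hX _).symm.mul_left hC)
  induction m with
  | zero =>
    refine ext_expo fun k l => ?_
    rcases k with _ | k <;> simp
  | succ m ih =>
    rw [List.ofFn_succ', List.prod_concat]
    simp only [Fin.val_castSucc, Fin.val_last]
    have h1 := ih fun i hi j hj => hc i (by omega) j (by omega)
    have h2 : Commute (MvPowerSeries.invOfUnit (1 - MvPowerSeries.X 0 * MvPowerSeries.C (c m)) 1 :
        MvPowerSeries (Fin 2) R) (List.ofFn fun b : Fin m =>
      (MvPowerSeries.invOfUnit (1 - MvPowerSeries.X 0 * MvPowerSeries.C (c b)) 1 :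
        MvPowerSeries (Fin 2) R)).prod := by
      refine Commute.list_prod_right _ _ fun x hx => ?_
      obtain ⟨b, rfl⟩ := (List.mem_ofFn' _ _).1 hx
      exact hcomm _ _ (hc _ (by omega) _ (by omega))
    rw [← h2.eq, mul_assoc, h1]
    have h3 : (1 - MvPowerSeries.X 0 * MvPowerSeries.C (c m)) *
        (bivariate fun k l => homog c k (m + 1) * e l) = bivariate fun k l => homog c k m * e l := by
      refine ext_expo fun k l => ?_
      rw [sub_mul, one_mul, map_sub, mul_assoc]
      rcases k with _ | k
      · rw [coeff_zero_X_zero_mul]; simp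
      · rw [coeff_succ_X_zero_mul, MvPowerSeries.coeff_C_mul]
        simp only [coeff_bivariate]
        rw [homog_succ_succ]; noncomm_ring
    rw [← h3, ← mul_assoc, hl, one_mul]

theorem coeff_prod_inv_mul_prod {c : ℕ → R} {m : ℕ}
    (hc : ∀ i < m, ∀ j < m, Commute (c i) (c j)) (k l : ℕ) :
    MvPowerSeries.coeff (expo k l) ((List.ofFn fun b : Fin m =>
      (MvPowerSeries.invOfUnit (1 - MvPowerSeries.X 0 * MvPowerSeries.C (c b)) 1 :
        MvPowerSeries (Fin 2) R)).prod * (List.ofFn fun b : Fin m =>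
      (1 + MvPowerSeries.X 1 * MvPowerSeries.C (c b) : MvPowerSeries (Fin 2) R)).prod) =
      homog c k m * elem c l m := by
  rw [prod_one_add_eq_bivariate hc, prod_inv_mul_eq_bivariate hc fun l => elem c l m,
    coeff_bivariate]

end SymmetricExpressions

end MonotoneHurwitz
end

noncomputable section

namespace MonotoneHurwitz

/-! ### Jucys-Murphy elements -/

section JucysMurphy

variable {n : ℕ}

theorem perm_mul (g h : Equiv.Perm (Fin n)) : perm (g * h) = perm g * perm h := map_mul _ _ _

theorem perm_one : perm (1 : Equiv.Perm (Fin n)) = 1 := map_one _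

theorem eq_sum_perm (x : GroupAlg n) : x = ∑ g, x.coeff g • perm g := by
  ext h
  simp [MonoidAlgebra.coeff_sum]

@[simp] theorem coeff_perm (g h : Equiv.Perm (Fin n)) [Decidable (g = h)] :
    (perm g).coeff h = if g = h then 1 else 0 := by
  simp [Finsupp.single_apply]

theorem coeff_perm_mul (g h : Equiv.Perm (Fin n)) (x : GroupAlg n) :
    (perm g * x).coeff h = x.coeff (g⁻¹ * h) := by
  simp

theorem coeff_mul_perm (g h : Equiv.Perm (Fin n)) (x : GroupAlg n) :
    (x * perm g).coeff h = x.coeff (h * g⁻¹) := by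
  simp

theorem commute_of_forall_perm {x : GroupAlg n} (h : ∀ g, Commute x (perm g)) (y : GroupAlg n) :
    Commute x y := by
  rw [eq_sum_perm y]
  exact Commute.sum_right _ _ _ fun g _ => (h g).smul_right _

/-- A permutation that fixes `b` and preserves `{a | a < b}` commutes with `𝒥_b`. -/
theorem commute_perm_jucysMurphy {b : Fin n} {g : Equiv.Perm (Fin n)} (hb : g b = b)
    (h : ∀ a, g a < b ↔ a < b) : Commute (perm g) (jucysMurphy b) := by
  have h1 : perm g * jucysMurphy b = ∑ a ∈ Finset.Iio b, perm (Equiv.swap (g a) b) * perm g := by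
    rw [jucysMurphy, Finset.mul_sum]
    refine Finset.sum_congr rfl fun a _ => ?_
    rw [← perm_mul, Equiv.mul_swap_eq_swap_mul, hb, perm_mul]
  have h2 : ∑ a ∈ Finset.Iio b, perm (Equiv.swap (g a) b) = jucysMurphy b := by
    refine Finset.sum_equiv g (fun a => ?_) fun a _ => rfl
    simp [h]
  rw [Commute, SemiconjBy, h1, ← Finset.sum_mul, h2]

theorem commute_swap_jucysMurphy {x y b : Fin n} (hx : x ≠ b) (hy : y ≠ b) (h : x < b ↔ y < b) :
    Commute (perm (Equiv.swap x y)) (jucysMurphy b) := by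
  refine commute_perm_jucysMurphy (Equiv.swap_apply_of_ne_of_ne hx.symm hy.symm) fun a => ?_
  rw [Equiv.swap_apply_def]
  split_ifs with h1 h2
  · rw [h1, h]
  · rw [h2, h]
  · rfl

/-- Each transposition in 𝒥_a permutes the points below b and fixes b, so it commutes with 𝒥_b
already by itself. -/
theorem commute_jucysMurphy_of_lt {a b : Fin n} (h : a < b) :
    Commute (jucysMurphy a) (jucysMurphy b) := by
  refine Commute.sum_left _ _ _ fun c hc => commute_swap_jucysMurphy ?_ h.ne ?_
  · exact ((Finset.mem_Iio.1 hc).trans h).ne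
  · exact iff_of_true ((Finset.mem_Iio.1 hc).trans h) h

theorem commute_jucysMurphy (a b : Fin n) : Commute (jucysMurphy a) (jucysMurphy b) := by
  rcases lt_trichotomy a b with h | h | h
  · exact commute_jucysMurphy_of_lt h
  · rw [h]
  · exact (commute_jucysMurphy_of_lt h).symm

/-- The Jucys-Murphy elements as a sequence, extended by zero. -/
def jmSeq (n : ℕ) (b : ℕ) : GroupAlg n := if h : b < n then jucysMurphy ⟨b, h⟩ else 0

theorem jmSeq_val (b : Fin n) : jmSeq n b = jucysMurphy b := by simp [jmSeq]

theorem jmSeq_of_lt {b : ℕ} (h : b < n) : jmSeq n b = jucysMurphy ⟨b, h⟩ := by simp [jmSeq, h]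

theorem commute_jmSeq (a b : ℕ) : Commute (jmSeq n a) (jmSeq n b) := by
  unfold jmSeq
  split_ifs
  · exact commute_jucysMurphy _ _
  all_goals simp

theorem commute_swap_jmSeq {x y b : ℕ} (hx : x < n) (hy : y < n) (hxb : x ≠ b) (hyb : y ≠ b)
    (h : x < b ↔ y < b) : Commute (perm (Equiv.swap ⟨x, hx⟩ ⟨y, hy⟩)) (jmSeq n b) := by
  unfold jmSeq
  split_ifs with hb
  · exact commute_swap_jucysMurphy (by simpa [Fin.ext_iff]) (by simpa [Fin.ext_iff])
      (by simpa [Fin.lt_def])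
  · simp

theorem perm_swap_mul_self (x y : Fin n) : perm (Equiv.swap x y) * perm (Equiv.swap x y) = 1 := by
  rw [← perm_mul, Equiv.swap_mul_self, perm_one]

/-- `s 𝒥_{i+1} = 𝒥_i s + 1` for the transposition `s = (i i+1)`. -/
theorem swap_mul_jmSeq_succ {i : ℕ} (hi : i + 1 < n) :
    perm (Equiv.swap ⟨i, by omega⟩ ⟨i + 1, hi⟩) * jmSeq n (i + 1) =
      jmSeq n i * perm (Equiv.swap ⟨i, by omega⟩ ⟨i + 1, hi⟩) + 1 := by
  set s : Equiv.Perm (Fin n) := Equiv.swap ⟨i, by omega⟩ ⟨i + 1, hi⟩ with hs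
  have hI : Finset.Iio (⟨i + 1, hi⟩ : Fin n) = insert ⟨i, by omega⟩
      (Finset.Iio (⟨i, by omega⟩ : Fin n)) := by
    ext a; simp only [Finset.mem_Iio, Finset.mem_insert, Fin.lt_def, Fin.ext_iff]; omega
  rw [jmSeq_of_lt hi, jmSeq_of_lt (show i < n by omega), jucysMurphy, hI,
    Finset.sum_insert (by simp), mul_add, perm_swap_mul_self, add_comm, jucysMurphy,
    Finset.mul_sum, Finset.sum_mul]
  congr 1
  refine Finset.sum_congr rfl fun a ha => ?_
  have ha' : a < ⟨i, _⟩ := Finset.mem_Iio.1 ha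
  rw [Fin.lt_def] at ha'
  dsimp only at ha'
  rw [← perm_mul, ← perm_mul, Equiv.mul_swap_eq_swap_mul, hs,
    Equiv.swap_apply_of_ne_of_ne (by simp [Fin.ext_iff]; omega) (by simp [Fin.ext_iff]; omega),
    Equiv.swap_apply_right]

theorem jmSeq_succ_mul_swap {i : ℕ} (hi : i + 1 < n) :
    jmSeq n (i + 1) * perm (Equiv.swap ⟨i, by omega⟩ ⟨i + 1, hi⟩) =
      perm (Equiv.swap ⟨i, by omega⟩ ⟨i + 1, hi⟩) * jmSeq n i + 1 := by
  set s : GroupAlg n := perm (Equiv.swap ⟨i, by omega⟩ ⟨i + 1, hi⟩) with hs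
  have h := swap_mul_jmSeq_succ hi
  have h2 : s * s = 1 := perm_swap_mul_self _ _
  rw [← hs] at h
  calc jmSeq n (i + 1) * s = s * (s * jmSeq n (i + 1)) * s := by rw [← mul_assoc, h2, one_mul]
    _ = s * jmSeq n i * (s * s) + s * s := by rw [h]; noncomm_ring
    _ = _ := by rw [h2, mul_one]

/-- The two exchange relations differ from plain conjugation by +1 on either side; these cancel in
the sum and in the product of 𝒥_i and 𝒥_{i+1}, which is all that a symmetric expression sees of
them. -/
theorem commute_elem_jmSeq_swap {i : ℕ} (hi : i + 1 < n) (l : ℕ) :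
    Commute (perm (Equiv.swap ⟨i, by omega⟩ ⟨i + 1, hi⟩)) (elem (jmSeq n) l n) := by
  have h1 := swap_mul_jmSeq_succ hi
  have h2 := jmSeq_succ_mul_swap hi
  refine commute_elem_of_swap hi (fun j _ hj hj' => ?_) ?_ ?_ l
  · exact commute_swap_jmSeq _ _ (Ne.symm hj) (Ne.symm hj') (by omega)
  · rw [Commute, SemiconjBy, mul_add, add_mul, h1, h2]; abel
  · rw [Commute, SemiconjBy, ← mul_assoc, h1, (commute_jmSeq (i + 1) i).eq, mul_assoc, h2]
    noncomm_ring

/-- Adjacent transpositions generate the group. The case n = 0 is separate because the generators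
are indexed by n - 1 positions. -/
theorem commute_elem_jmSeq (l : ℕ) (x : GroupAlg n) : Commute (elem (jmSeq n) l n) x := by
  refine commute_of_forall_perm (fun g => ?_) x
  rcases n with _ | n
  · rw [Subsingleton.elim g 1, perm_one]; exact Commute.one_right _
  · have hg : g ∈ Submonoid.closure
        (Set.range fun i : Fin n => Equiv.swap i.castSucc i.succ) := by
      rw [Equiv.Perm.mclosure_swap_castSucc_succ]; trivial
    induction hg using Submonoid.closure_induction with
    | mem x hx =>
      obtain ⟨i, rfl⟩ := hx
      exact (commute_elem_jmSeq_swap (i := i) (by omega) l).symm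
    | one => rw [perm_one]; exact Commute.one_right _
    | mul x y _ _ hx hy => rw [perm_mul]; exact hx.mul_right hy

theorem commute_homog_jmSeq (k : ℕ) (x : GroupAlg n) : Commute (homog (jmSeq n) k n) x :=
  (commute_homog (fun _ _ _ _ => commute_jmSeq _ _)
    (fun l => (commute_elem_jmSeq l x).symm) k).symm

/-- The coefficients of `H(z, 𝒥) E(w, 𝒥)`. -/
def mixedElem (n k l : ℕ) : GroupAlg n := homog (jmSeq n) k n * elem (jmSeq n) l n

theorem commute_mixedElem (k l : ℕ) (x : GroupAlg n) : Commute (mixedElem n k l) x :=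
  (commute_homog_jmSeq k x).mul_left (commute_elem_jmSeq l x)

theorem coeff_twist (k l : ℕ) (q : ℂ) :
    MvPowerSeries.coeff (expo k l) (twist n q) = q ^ n • mixedElem n k l := by
  have h := coeff_prod_inv_mul_prod (c := jmSeq n) (m := n)
    (fun _ _ _ _ => commute_jmSeq _ _) k l
  simp only [jmSeq_val] at h
  rw [twist, mul_assoc, MvPowerSeries.coeff_C_mul, genH, genE, h, mixedElem, Algebra.smul_def]

end JucysMurphy

/-! ### Counting walks -/

section Walks

variable {n : ℕ}

/-- The vertices of the walk from `1` with given labels. -/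
def vertices {t : ℕ} (s : Fin t → Fin n × Fin n) : Fin (t + 1) → Equiv.Perm (Fin n) :=
  Fin.induction 1 fun i g => Equiv.swap (s i).1 (s i).2 * g

theorem vertices_zero {t : ℕ} (s : Fin t → Fin n × Fin n) : vertices s 0 = 1 := rfl

theorem vertices_succ {t : ℕ} (s : Fin t → Fin n × Fin n) (i : Fin t) :
    vertices s i.succ = Equiv.swap (s i).1 (s i).2 * vertices s i.castSucc :=
  Fin.induction_succ _ _ _

theorem vertices_snoc_castSucc {t : ℕ} (s : Fin t → Fin n × Fin n) (x : Fin n × Fin n)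
    (i : Fin (t + 1)) : vertices (Fin.snoc s x : Fin (t + 1) → Fin n × Fin n) i.castSucc =
      vertices s i := by
  induction i using Fin.induction with
  | zero => rfl
  | succ i ih =>
    rw [← Fin.succ_castSucc, vertices_succ, vertices_succ, ih, Fin.snoc_castSucc]

theorem vertices_snoc_last {t : ℕ} (s : Fin t → Fin n × Fin n) (x : Fin n × Fin n) :
    vertices (Fin.snoc s x : Fin (t + 1) → Fin n × Fin n) (Fin.last (t + 1)) =
      Equiv.swap x.1 x.2 * vertices s (Fin.last t) := by
  rw [← Fin.succ_last, vertices_succ, vertices_snoc_castSucc, Fin.snoc_last]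

/-- The weakly monotone label sequences with labels below `m`. -/
def WeakLabels (m t : ℕ) (s : Fin t → Fin n × Fin n) : Prop :=
  (∀ i, (s i).1 < (s i).2) ∧ (∀ i j, i < j → (s i).2 ≤ (s j).2) ∧ ∀ i, ((s i).2 : ℕ) < m

/-- The weakly, then strictly monotone label sequences with strict labels below `m`. -/
def MixedLabels (m k l : ℕ) (s : Fin (k + l) → Fin n × Fin n) : Prop :=
  (∀ i, (s i).1 < (s i).2) ∧ (∀ i j, i < j → j.val < k → (s i).2 ≤ (s j).2) ∧
    (∀ i j, i < j → k ≤ i.val → (s i).2 < (s j).2) ∧ ∀ i, k ≤ i.val → ((s i).2 : ℕ) < m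

theorem forall_fin_snoc {t : ℕ} {P : Fin (t + 1) → Prop} :
    (∀ i, P i) ↔ (∀ i : Fin t, P i.castSucc) ∧ P (Fin.last t) :=
  ⟨fun h => ⟨fun i => h _, h _⟩, fun h i => Fin.lastCases h.2 h.1 i⟩

/-- Once the last label is removed, its larger entry bounds all earlier ones: weakly, hence the
bound `x.2 + 1`; in `mixedLabels_snoc` strictly, hence `x.2`, and only for the strict steps. -/
theorem weakLabels_snoc (m t : ℕ) (s : Fin t → Fin n × Fin n) (x : Fin n × Fin n) :
    WeakLabels m (t + 1) (Fin.snoc s x : Fin (t + 1) → Fin n × Fin n) ↔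
      x.1 < x.2 ∧ (x.2 : ℕ) < m ∧ WeakLabels (x.2 + 1) t s := by
  simp only [WeakLabels, forall_fin_snoc, Fin.snoc_castSucc, Fin.snoc_last,
    lt_irrefl, Fin.le_def, Fin.lt_def]
  constructor
  · rintro ⟨⟨h1, h2⟩, ⟨h3, h4⟩, h5, h6⟩
    exact ⟨h2, h6, h1, fun i => (h3 i).1, fun i => Nat.lt_succ_of_le ((h3 i).2 (by simp))⟩
  · rintro ⟨h1, h2, h3, h4, h5⟩
    refine ⟨⟨h3, h1⟩, ⟨fun i => ⟨h4 i, fun _ => Nat.le_of_lt_succ (h5 i)⟩, fun i hi => ?_,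
      fun _ => le_rfl⟩, fun i => lt_of_le_of_lt (Nat.le_of_lt_succ (h5 i)) h2, h2⟩
    have := i.isLt; simp only [Fin.val_last, Fin.val_castSucc] at hi; omega

theorem mixedLabels_snoc (m k l : ℕ) (s : Fin (k + l) → Fin n × Fin n) (x : Fin n × Fin n) :
    MixedLabels m k (l + 1) (Fin.snoc s x : Fin (k + l + 1) → Fin n × Fin n) ↔
      x.1 < x.2 ∧ (x.2 : ℕ) < m ∧ MixedLabels x.2 k l s := by
  change ((∀ i : Fin (k + l + 1), _) ∧ (∀ i j : Fin (k + l + 1), _) ∧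
    (∀ i j : Fin (k + l + 1), _) ∧ ∀ i : Fin (k + l + 1), _) ↔ _
  simp only [MixedLabels, forall_fin_snoc, Fin.snoc_castSucc, Fin.snoc_last,
    lt_irrefl, Fin.le_def, Fin.lt_def,
    Fin.val_last, Fin.val_castSucc]
  constructor
  · rintro ⟨⟨h1, h2⟩, ⟨h3, h4⟩, ⟨h5, h6⟩, h7, h8⟩
    exact ⟨h2, h8 (by omega), h1, fun i => (h3 i).1, fun i => (h5 i).1,
      fun i hi => (h5 i).2 i.isLt hi⟩
  · rintro ⟨h1, h2, h3, h4, h5, h6⟩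
    refine ⟨⟨h3, h1⟩, ⟨fun i => ⟨h4 i, fun _ h => by omega⟩, fun i hi => ?_, fun h _ => le_rfl⟩,
      ⟨fun i => ⟨h5 i, fun _ h => h6 i h⟩, fun i hi => ?_, fun h => ?_⟩,
      fun i hi => (h6 i hi).trans h2, fun _ => h2⟩
    · have := i.isLt; omega
    · have := i.isLt; omega
    · exact h.elim

-- The last step is the leftmost factor of the end vertex, so it can be taken out of the sum. The
-- relation `Q` abstracts what remains, and both kinds of labels share the recursion.
open Classical in
theorem sum_snoc {t : ℕ} {P : (Fin (t + 1) → Fin n × Fin n) → Prop}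
    {Q : Fin n × Fin n → (Fin t → Fin n × Fin n) → Prop}
    {m : ℕ} (h : ∀ s x, P (Fin.snoc s x) ↔ x.1 < x.2 ∧ (x.2 : ℕ) < m ∧ Q x s) :
    ∑ s with P s, perm (vertices s (Fin.last (t + 1))) =
      ∑ x : Fin n × Fin n with x.1 < x.2 ∧ (x.2 : ℕ) < m, perm (Equiv.swap x.1 x.2) *
        ∑ s with Q x s, perm (vertices s (Fin.last t)) := by
  rw [Finset.sum_filter, ← (Fin.snocEquiv fun _ : Fin (t + 1) => Fin n × Fin n).sum_comp,
    Fintype.sum_prod_type, Finset.sum_filter]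
  refine Finset.sum_congr rfl fun x _ => ?_
  have hs : ∀ s : Fin t → Fin n × Fin n,
      (Fin.snocEquiv fun _ : Fin (t + 1) => Fin n × Fin n) (x, s) = Fin.snoc s x := fun s => rfl
  simp only [hs, h, vertices_snoc_last, perm_mul]
  split_ifs with hx
  · rw [Finset.sum_filter, Finset.mul_sum]
    refine Finset.sum_congr rfl fun s _ => ?_
    simp [hx.1, hx.2]
  · refine Finset.sum_eq_zero fun s _ => if_neg fun hh => hx ⟨hh.1, hh.2.1⟩

theorem sum_lt_pairs {m : ℕ} (hm : m ≤ n) (F : ℕ → GroupAlg n) :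
    ∑ x : Fin n × Fin n with x.1 < x.2 ∧ (x.2 : ℕ) < m, perm (Equiv.swap x.1 x.2) * F x.2 =
      ∑ c ∈ Finset.range m, jmSeq n c * F c := by
  rw [Finset.sum_filter, Fintype.sum_prod_type_right]
  have h1 : ∀ c : Fin n, ∑ a : Fin n, (if a < c ∧ (c : ℕ) < m then
      perm (Equiv.swap a c) * F c else 0) = if (c : ℕ) < m then jmSeq n c * F c else 0 := by
    intro c
    rw [jmSeq_val, jucysMurphy, Finset.sum_mul]
    split_ifs with hc
    · simp only [hc, and_true]
      rw [← Finset.sum_filter]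
      exact Finset.sum_congr (by ext; simp) fun _ _ => rfl
    · simp [hc]
  simp only [h1]
  rw [Fin.sum_univ_eq_sum_range (fun c => if c < m then jmSeq n c * F c else 0),
    ← Finset.sum_filter]
  refine Finset.sum_congr ?_ fun _ _ => rfl
  ext c; simp only [Finset.mem_filter, Finset.mem_range]; omega

open Classical in
theorem sum_weakLabels {m : ℕ} (hm : m ≤ n) (k : ℕ) :
    ∑ s : Fin k → Fin n × Fin n with WeakLabels m k s, perm (vertices s (Fin.last k)) =
      homog (jmSeq n) k m := by
  induction k generalizing m with
  | zero =>
    rw [Finset.sum_eq_single default]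
    · rw [homog_zero_left, ← perm_one]; rfl
    · intro b _ hb; exact (hb (Subsingleton.elim _ _)).elim
    · intro h; simp [WeakLabels] at h
  | succ k ih =>
    rw [sum_snoc fun s x => weakLabels_snoc m k s x, homog_succ_eq_sum,
      ← sum_lt_pairs hm fun c => homog (jmSeq n) k (c + 1)]
    refine Finset.sum_congr rfl fun x _ => ?_
    rw [ih (by omega)]

-- The strict steps come last, so `elem` stands on the left. The bound `m` restrains only them; the
-- weak part keeps all n variables.
open Classical in
theorem sum_mixedLabels {m : ℕ} (hm : m ≤ n) (k l : ℕ) :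
    ∑ s : Fin (k + l) → Fin n × Fin n with MixedLabels m k l s,
      perm (vertices s (Fin.last (k + l))) = elem (jmSeq n) l m * homog (jmSeq n) k n := by
  induction l generalizing m with
  | zero =>
    rw [elem_zero_left, one_mul, ← sum_weakLabels le_rfl]
    refine Finset.sum_congr (Finset.filter_congr fun s _ => ?_) fun _ _ => rfl
    constructor
    · exact fun h => ⟨h.1, fun i j hij => h.2.1 i j hij j.isLt, fun i => (s i).2.isLt⟩
    · exact fun h => ⟨h.1, fun i j hij _ => h.2.1 i j hij,
        fun i j _ hi => absurd i.isLt (by omega), fun i hi => absurd i.isLt (by omega)⟩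
  | succ l ih =>
    have h := sum_snoc (m := m) fun s x => mixedLabels_snoc (n := n) m k l s x
    refine h.trans ?_
    rw [elem_succ_eq_sum, Finset.sum_mul]
    simp only [mul_assoc]
    rw [← sum_lt_pairs hm fun c => elem (jmSeq n) l c * homog (jmSeq n) k n]
    refine Finset.sum_congr rfl fun x _ => ?_
    rw [ih (by omega)]

theorem isMixedWalk_iff {k l : ℕ} (W : WalkData n k l) :
    IsMixedWalk k l W ↔ MixedLabels n k l W.2 ∧ W.1 = fun i => vertices W.2 i * W.1 0 := by
  constructor
  · rintro ⟨h1, h2, h3⟩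
    refine ⟨⟨fun i => (h1 i).1, h2, h3, fun i _ => (W.2 i).2.isLt⟩, funext fun i => ?_⟩
    induction i using Fin.induction with
    | zero => rw [vertices_zero, one_mul]
    | succ i ih => rw [(h1 i).2, ih, vertices_succ, mul_assoc]
  · rintro ⟨⟨h1, h2, h3, _⟩, h4⟩
    refine ⟨fun i => ⟨h1 i, ?_⟩, h2, h3⟩
    rw [h4]
    simp only [vertices_succ, mul_assoc]

open Classical in
/-- The walks to `h`, counted by a coefficient in the group algebra. -/
theorem walkCountTo_eq_coeff (k l : ℕ) (ν : n.Partition) (h : Equiv.Perm (Fin n)) :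
    (walkCountTo k l ν h : ℂ) = (mixedElem n k l * classSum ν).coeff h := by
  have h1 : mixedElem n k l = ∑ s : Fin (k + l) → Fin n × Fin n with MixedLabels n k l s,
      perm (vertices s (Fin.last (k + l))) := by
    rw [sum_mixedLabels le_rfl, mixedElem]
    exact commute_homog_jmSeq _ _
  -- A walk amounts to its labels together with its starting vertex.
  have h2 : walkCountTo k l ν h = Finset.card
      {p : (Fin (k + l) → Fin n × Fin n) × Equiv.Perm (Fin n) | MixedLabels n k l p.1 ∧
        p.2 ∈ cycleClass ν ∧ vertices p.1 (Fin.last (k + l)) * p.2 = h} := by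
    rw [walkCountTo, ← Set.ncard_coe_finset]
    symm
    refine Set.ncard_congr (fun p _ => (fun i => vertices p.1 i * p.2, p.1)) ?_ ?_ ?_
    · rintro ⟨s, g⟩ hp
      simp only [Finset.coe_filter, Finset.mem_univ, true_and, Set.mem_ofPred_eq, cycleClass,
        Finset.mem_filter] at hp
      simp only [Set.mem_ofPred_eq, isMixedWalk_iff, vertices_zero, one_mul]
      exact ⟨⟨hp.1, trivial⟩, hp.2.1, hp.2.2⟩
    · rintro ⟨s, g⟩ ⟨s', g'⟩ _ _ hpq
      simp only [Prod.mk.injEq] at hpq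
      obtain ⟨h3, rfl⟩ := hpq
      have := congrFun h3 0
      simp only [vertices_zero, one_mul] at this
      rw [this]
    · rintro W hW
      simp only [Set.mem_ofPred_eq, isMixedWalk_iff] at hW
      refine ⟨(W.2, W.1 0), ?_, ?_⟩
      · simp only [Finset.coe_filter, Finset.mem_univ, true_and, Set.mem_ofPred_eq, cycleClass,
          Finset.mem_filter]
        refine ⟨hW.1.1, hW.2.1, ?_⟩
        rw [← hW.2.2]
        exact (congrFun hW.1.2 _).symm
      · exact Prod.ext hW.1.2.symm rfl
  rw [h2, h1, classSum, Finset.sum_mul_sum, MonoidAlgebra.coeff_sum, Finsupp.finsetSum_apply]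
  simp only [MonoidAlgebra.coeff_sum, Finsupp.finsetSum_apply, ← perm_mul]
  rw [Finset.card_filter, Nat.cast_sum, Fintype.sum_prod_type, Finset.sum_filter]
  refine Finset.sum_congr rfl fun s _ => ?_
  split_ifs with hs
  · rw [← Finset.sum_filter_add_sum_filter_not Finset.univ (fun g => g ∈ cycleClass ν)]
    rw [Finset.sum_eq_zero (s := Finset.univ.filter fun g => g ∉ cycleClass ν), add_zero]
    · refine Finset.sum_congr (by ext; simp) fun g hg => ?_
      rw [coeff_perm]
      simp [hs, hg]
    · intro g hg; simp [(Finset.mem_filter.1 hg).2]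
  · simp [hs]

end Walks

end MonotoneHurwitz
end

noncomputable section

namespace MonotoneHurwitz

/-! ### Cycle types, conjugacy classes and the characteristic map -/

section CycleTypes

variable {n : ℕ}

/-- The cycle type of a permutation of `Fin n`, as a partition of `n`. -/
def cyc (g : Equiv.Perm (Fin n)) : n.Partition :=
  ⟨g.partition.parts, g.partition.parts_pos, by rw [g.partition.parts_sum, Fintype.card_fin]⟩

theorem cyc_parts (g : Equiv.Perm (Fin n)) : (cyc g).parts = g.partition.parts := rfl

theorem hasCycleType_iff {g : Equiv.Perm (Fin n)} {μ : n.Partition} :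
    HasCycleType g μ ↔ cyc g = μ := by
  rw [Nat.Partition.ext_iff]; rfl

theorem mem_cycleClass {g : Equiv.Perm (Fin n)} {μ : n.Partition} :
    g ∈ cycleClass μ ↔ cyc g = μ := by
  simp [cycleClass, hasCycleType_iff]

theorem cyc_eq_iff {g h : Equiv.Perm (Fin n)} : cyc g = cyc h ↔ IsConj g h := by
  rw [Equiv.Perm.partition_eq_of_isConj, Nat.Partition.ext_iff, Nat.Partition.ext_iff]
  rfl

theorem cyc_conj (g h : Equiv.Perm (Fin n)) : cyc (h * g * h⁻¹) = cyc g :=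
  cyc_eq_iff.2 (isConj_iff.2 ⟨h⁻¹, by group⟩)

theorem cyc_inv (g : Equiv.Perm (Fin n)) : cyc g⁻¹ = cyc g := by
  rw [cyc_eq_iff, Equiv.Perm.isConj_iff_cycleType_eq, Equiv.Perm.cycleType_inv]

theorem cyc_mul_comm (g h : Equiv.Perm (Fin n)) : cyc (g * h) = cyc (h * g) := by
  rw [← cyc_conj (g * h) h]; group

theorem cycleType_eq_iff_cyc {g : Equiv.Perm (Fin n)} {μ : n.Partition} :
    g.cycleType = μ.parts.filter (2 ≤ ·) ↔ cyc g = μ := by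
  constructor
  · intro h
    have h2 : μ.parts.filter (¬ 2 ≤ ·) = Multiset.replicate (n - g.cycleType.sum) 1 := by
      have h3 : ∀ i ∈ μ.parts.filter (¬ 2 ≤ ·), i = 1 := fun i hi => by
        have := μ.parts_pos (Multiset.mem_filter.1 hi).1
        have := (Multiset.mem_filter.1 hi).2
        omega
      have h4 := Multiset.eq_replicate_card.2 h3
      rw [h4]
      congr 1
      have h5 := congrArg Multiset.sum (Multiset.filter_add_not (2 ≤ ·) μ.parts)
      rw [Multiset.sum_add, μ.parts_sum, h4, ← h, Multiset.sum_replicate, smul_eq_mul,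
        mul_one] at h5
      omega
    refine Nat.Partition.ext ?_
    rw [cyc_parts, Equiv.Perm.parts_partition, ← Equiv.Perm.sum_cycleType, Fintype.card_fin, ← h2,
      h, Multiset.filter_add_not]
  · rintro rfl
    rw [cyc_parts, Equiv.Perm.filter_parts_partition_eq_cycleType]

/-- The count available for `cycleType` ignores fixed points and carries a factor (n - m.sum)! for
them; that factor is the contribution of the parts equal to 1 in Z_μ. -/
theorem card_cycleClass_mul_zee (μ : n.Partition) : (cycleClass μ).card * zee μ = n ! := by
  classical
  set m := μ.parts.filter (2 ≤ ·) with hm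
  have h1 := Equiv.Perm.card_of_cycleType_mul_eq (Fin n) m
  have hsum : m.sum + μ.parts.count 1 = n := by
    have h5 := congrArg Multiset.sum (Multiset.filter_add_not (2 ≤ ·) μ.parts)
    have h3 : ∀ i ∈ μ.parts.filter (¬ 2 ≤ ·), i = 1 := fun i hi => by
      have := μ.parts_pos (Multiset.mem_filter.1 hi).1
      have := (Multiset.mem_filter.1 hi).2
      omega
    have h4 := Multiset.eq_replicate_card.2 h3
    have h6 : (μ.parts.filter (¬ 2 ≤ ·)).count 1 = μ.parts.count 1 :=
      Multiset.count_filter_of_pos (by norm_num)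
    have h7 : (μ.parts.filter (¬ 2 ≤ ·)).card = μ.parts.count 1 := by
      rw [← h6, h4, Multiset.count_replicate_self, Multiset.card_replicate]
    rw [Multiset.sum_add, μ.parts_sum, h4, Multiset.sum_replicate, smul_eq_mul, mul_one, h7] at h5
    exact h5
  rw [Fintype.card_fin, if_pos ⟨by omega, fun a ha => (Multiset.mem_filter.1 ha).2⟩] at h1
  have h2 : (Finset.univ.filter fun g : Equiv.Perm (Fin n) => g.cycleType = m) = cycleClass μ := by
    ext g; simp [mem_cycleClass, hm, cycleType_eq_iff_cyc]
  rw [h2] at h1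
  rw [← h1]
  congr 1
  have h8 : μ.parts.prod = m.prod := by
    rw [← Multiset.filter_add_not (2 ≤ ·) μ.parts, Multiset.prod_add]
    rw [Multiset.prod_eq_one (s := μ.parts.filter (¬ 2 ≤ ·)), mul_one]
    intro i hi
    have := μ.parts_pos (Multiset.mem_filter.1 hi).1
    have := (Multiset.mem_filter.1 hi).2
    omega
  have h9 : ∏ i ∈ μ.parts.toFinset, (μ.parts.count i)! =
      (μ.parts.count 1)! * ∏ i ∈ m.toFinset, (m.count i)! := by
    have h10 : ∏ i ∈ μ.parts.toFinset, (μ.parts.count i)! =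
        ∏ i ∈ insert 1 m.toFinset, (μ.parts.count i)! := by
      refine Finset.prod_subset (fun i hi => ?_) fun i _ hi => ?_
      · rw [Multiset.mem_toFinset] at hi
        rw [Finset.mem_insert, Multiset.mem_toFinset, hm, Multiset.mem_filter]
        have := μ.parts_pos hi
        by_cases h : i = 1
        · exact Or.inl h
        · exact Or.inr ⟨hi, by omega⟩
      · rw [Multiset.mem_toFinset] at hi
        rw [Multiset.count_eq_zero_of_notMem hi, Nat.factorial_zero]
    rw [h10, Finset.prod_insert (by simp [hm])]
    congr 1
    refine Finset.prod_congr rfl fun i hi => ?_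
    rw [hm, Multiset.count_filter_of_pos]
    exact (Multiset.mem_filter.1 (Multiset.mem_toFinset.1 hi)).2
  rw [zee, Finset.prod_mul_distrib, h9, ← Finset.prod_multiset_count, h8,
    show n - m.sum = μ.parts.count 1 by omega]
  ring

theorem zee_ne_zero (μ : n.Partition) : (zee μ : ℂ) ≠ 0 := by
  have h := card_cycleClass_mul_zee μ
  have : zee μ ≠ 0 := fun h0 => by
    rw [h0, mul_zero] at h; exact (Nat.factorial_ne_zero n) h.symm
  exact_mod_cast this

theorem card_cycleClass_ne_zero (μ : n.Partition) : ((cycleClass μ).card : ℂ) ≠ 0 := by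
  have h := card_cycleClass_mul_zee μ
  have : (cycleClass μ).card ≠ 0 := fun h0 => by
    rw [h0, zero_mul] at h; exact (Nat.factorial_ne_zero n) h.symm
  exact_mod_cast this

theorem exists_cyc_eq (μ : n.Partition) : ∃ g : Equiv.Perm (Fin n), cyc g = μ := by
  have h := card_cycleClass_ne_zero μ
  obtain ⟨g, hg⟩ := Finset.card_ne_zero.1 (Nat.cast_ne_zero.1 h)
  exact ⟨g, mem_cycleClass.1 hg⟩

theorem card_cycleClass (μ : n.Partition) : ((cycleClass μ).card : ℂ) = n ! / zee μ := by
  rw [eq_div_iff (zee_ne_zero μ)]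
  exact_mod_cast card_cycleClass_mul_zee μ

theorem sum_perm_eq_sum_partition {A : Type*} [AddCommMonoid A] (f : Equiv.Perm (Fin n) → A) :
    ∑ g, f g = ∑ μ : n.Partition, ∑ g ∈ cycleClass μ, f g := by
  classical
  rw [← Finset.sum_fiberwise_of_maps_to (s := Finset.univ) (t := Finset.univ)
    (g := fun g : Equiv.Perm (Fin n) => cyc g) fun _ _ => Finset.mem_univ _]
  refine Finset.sum_congr rfl fun μ _ => Finset.sum_congr ?_ fun _ _ => rfl
  ext g; simp [mem_cycleClass]

theorem commute_classSum (μ : n.Partition) (x : GroupAlg n) : Commute (classSum μ) x := by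
  refine commute_of_forall_perm (fun h => ?_) x
  rw [Commute, SemiconjBy, classSum, Finset.sum_mul, Finset.mul_sum]
  refine Finset.sum_equiv (MulAut.conj h⁻¹).toEquiv (fun g => ?_) fun g _ => ?_
  · rw [mem_cycleClass, mem_cycleClass]
    change _ ↔ cyc (h⁻¹ * g * h⁻¹⁻¹) = μ
    rw [cyc_conj]
  · change _ = perm h * perm (h⁻¹ * g * h⁻¹⁻¹)
    rw [← perm_mul, ← perm_mul]; group

theorem coeff_eq_of_central {x : GroupAlg n} (hx : ∀ y, Commute x y)
    {g h : Equiv.Perm (Fin n)} (hgh : cyc g = cyc h) : x.coeff g = x.coeff h := by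
  obtain ⟨c, hc⟩ := isConj_iff.1 (cyc_eq_iff.1 hgh)
  have h1 := congrArg (fun y => MonoidAlgebra.coeff y (h * c)) (hx (perm c)).eq
  simp only [coeff_mul_perm, coeff_perm_mul] at h1
  rw [← hc] at h1 ⊢
  simpa [mul_assoc] using h1.symm

theorem eq_sum_classSum {x : GroupAlg n} {f : n.Partition → ℂ}
    (hf : ∀ g, x.coeff g = f (cyc g)) : x = ∑ μ, f μ • classSum μ := by
  conv_lhs => rw [eq_sum_perm x, sum_perm_eq_sum_partition]
  refine Finset.sum_congr rfl fun μ _ => ?_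
  rw [classSum, Finset.smul_sum]
  refine Finset.sum_congr rfl fun g hg => ?_
  rw [hf, mem_cycleClass.1 hg]

/-- The count is a coefficient of a product of two central elements, and such coefficients are
constant on conjugacy classes. -/
theorem walkCountTo_eq_of_cyc_eq (k l : ℕ) (ν : n.Partition) {g h : Equiv.Perm (Fin n)}
    (hgh : cyc g = cyc h) : walkCountTo k l ν g = walkCountTo k l ν h := by
  have : (walkCountTo k l ν g : ℂ) = walkCountTo k l ν h := by
    rw [walkCountTo_eq_coeff, walkCountTo_eq_coeff]
    exact coeff_eq_of_central
      (fun y => (commute_mixedElem k l y).mul_left (commute_classSum ν y)) hgh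
  exact_mod_cast this

theorem walkCount_eq_sum (k l : ℕ) (ν μ : n.Partition) :
    walkCount k l ν μ = ∑ h ∈ cycleClass μ, walkCountTo k l ν h := by
  classical
  have h1 : walkCount k l ν μ = Finset.card {W : WalkData n k l | IsMixedWalk k l W ∧
      HasCycleType (W.1 0) ν ∧ HasCycleType (W.1 (Fin.last (k + l))) μ} := by
    rw [walkCount, ← Set.ncard_coe_finset]; congr 1; ext; simp
  rw [h1, Finset.card_eq_sum_card_fiberwise (f := fun W => W.1 (Fin.last (k + l)))
    (t := cycleClass μ)]
  · refine Finset.sum_congr rfl fun h hh => ?_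
    rw [walkCountTo, ← Set.ncard_coe_finset]
    congr 1
    ext W
    simp only [Finset.coe_filter, Finset.mem_filter, Finset.mem_univ, true_and,
      Set.mem_ofPred_eq]
    constructor
    · rintro ⟨⟨h1, h2, _⟩, h4⟩; exact ⟨h1, h2, h4⟩
    · rintro ⟨h1, h2, h4⟩
      exact ⟨⟨h1, h2, by rw [h4]; exact hasCycleType_iff.2 (mem_cycleClass.1 hh)⟩, h4⟩
  · intro W hW
    simp only [Finset.coe_filter, Finset.mem_univ, true_and, Set.mem_ofPred_eq] at hW
    exact mem_cycleClass.2 (hasCycleType_iff.1 hW.2.2)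

theorem mixedHurwitz_eq_walkCountTo (k l : ℕ) (ν μ : n.Partition) {h : Equiv.Perm (Fin n)}
    (hh : HasCycleType h μ) : mixedHurwitz k l ν μ = walkCountTo k l ν h := by
  have h1 : walkCount k l ν μ = (cycleClass μ).card * walkCountTo k l ν h := by
    rw [walkCount_eq_sum, Finset.sum_congr rfl fun g hg => walkCountTo_eq_of_cyc_eq k l ν
      ((mem_cycleClass.1 hg).trans (hasCycleType_iff.1 hh).symm), Finset.sum_const, smul_eq_mul]
  rw [mixedHurwitz, h1, Nat.cast_mul, mul_div_cancel_left₀ _ (card_cycleClass_ne_zero μ)]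

theorem mixedElem_mul_classSum (k l : ℕ) (ν : n.Partition) :
    mixedElem n k l * classSum ν = ∑ μ, mixedHurwitz k l ν μ • classSum μ := by
  refine eq_sum_classSum fun g => ?_
  rw [mixedHurwitz_eq_walkCountTo k l ν (cyc g) (hasCycleType_iff.2 rfl), walkCountTo_eq_coeff]

theorem coeff_twist_mul_classSum (k l : ℕ) (q : ℂ) (ν : n.Partition) :
    MvPowerSeries.coeff (expo k l) (twist n q * MvPowerSeries.C (classSum ν)) =
      ∑ μ : n.Partition, (q ^ n * mixedHurwitz k l ν μ) • classSum μ := by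
  rw [MvPowerSeries.coeff_mul_C, coeff_twist, smul_mul_assoc, mixedElem_mul_classSum,
    Finset.smul_sum]
  simp only [smul_smul]

theorem charMap_perm (g : Equiv.Perm (Fin n)) :
    charMap n (perm g) = ((n ! : ℂ)⁻¹) • psumPart (cyc g) := by
  simp [charMap, psumPart, cyc_parts]

theorem charMap_classSum (μ : n.Partition) : charMap n (classSum μ) = (zee μ : ℂ)⁻¹ • psumPart μ := by
  rw [classSum, map_sum, Finset.sum_congr rfl fun g hg => by
    rw [charMap_perm, mem_cycleClass.1 hg], Finset.sum_const, ← Nat.cast_smul_eq_nsmul ℂ, smul_smul,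
    card_cycleClass]
  congr 1
  have : (n ! : ℂ) ≠ 0 := by exact_mod_cast Nat.factorial_ne_zero n
  field_simp

/-- The factor n! cancels the denominator of the first ch, which sees only the cycle type; grouping
by type assembles a class sum in the second factor. -/
theorem charMap₂_sum_eq (x : GroupAlg n) :
    charMap₂ n (∑ g : Equiv.Perm (Fin n), (n ! : ℂ) • (perm g ⊗ₜ[ℂ] (x * perm g))) =
      ∑ ν : n.Partition, psumPart ν ⊗ₜ[ℂ] charMap n (x * classSum ν) := by
  rw [map_sum, sum_perm_eq_sum_partition]
  refine Finset.sum_congr rfl fun ν _ => ?_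
  have h0 : (n ! : ℂ) ≠ 0 := by exact_mod_cast Nat.factorial_ne_zero n
  rw [classSum, Finset.mul_sum, map_sum, TensorProduct.tmul_sum]
  refine Finset.sum_congr rfl fun g hg => ?_
  rw [map_smul, charMap₂, TensorProduct.map_tmul, charMap_perm, mem_cycleClass.1 hg,
    TensorProduct.smul_tmul', smul_smul, mul_inv_cancel₀ h0, one_smul]

theorem charMap₂_twist_eq_psum (k l : ℕ) (q : ℂ) :
    charMap₂ n (∑ g : Equiv.Perm (Fin n), (n ! : ℂ) •
        (perm g ⊗ₜ[ℂ] (MvPowerSeries.coeff (expo k l) (twist n q) * perm g))) =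
      ∑ ν : n.Partition, ∑ μ : n.Partition,
        (q ^ n * mixedHurwitz k l ν μ / (zee μ : ℂ)) • (psumPart ν ⊗ₜ[ℂ] psumPart μ) := by
  rw [charMap₂_sum_eq]
  refine Finset.sum_congr rfl fun ν _ => ?_
  rw [coeff_twist, smul_mul_assoc, mixedElem_mul_classSum, map_smul, map_sum, Finset.smul_sum,
    TensorProduct.tmul_sum]
  refine Finset.sum_congr rfl fun μ _ => ?_
  rw [map_smul, charMap_classSum, smul_smul, smul_smul, TensorProduct.tmul_smul, div_eq_mul_inv]

end CycleTypes

end MonotoneHurwitz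
end

noncomputable section

namespace MonotoneHurwitz

/-! ### Traces of permutations on tensor powers -/

section PermTrace

variable {ι R : Type*} [Fintype ι] [CommRing R]

/-- The trace of `X ⊗ ... ⊗ X` composed with the permutation `g` of the tensor factors. -/
def permTrace {A : Type*} [Fintype A] [DecidableEq A] (g : Equiv.Perm A) (X : Matrix ι ι R) : R :=
  ∑ w : A → ι, ∏ a, X (w a) (w (g a))

theorem permTrace_permCongr {A B : Type*} [Fintype A] [DecidableEq A] [Fintype B] [DecidableEq B]
    (e : A ≃ B) (g : Equiv.Perm A) (X : Matrix ι ι R) :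
    permTrace (e.permCongr g) X = permTrace g X := by
  unfold permTrace
  rw [← (e.arrowCongr (Equiv.refl ι)).sum_comp]
  refine Finset.sum_congr rfl fun w _ => ?_
  rw [← e.prod_comp]
  simp

theorem permTrace_conj {A : Type*} [Fintype A] [DecidableEq A] (g h : Equiv.Perm A)
    (X : Matrix ι ι R) : permTrace (h * g * h⁻¹) X = permTrace g X :=
  permTrace_permCongr h g X

theorem permTrace_sumCongr {A B : Type*} [Fintype A] [DecidableEq A] [Fintype B] [DecidableEq B]
    (g : Equiv.Perm A) (h : Equiv.Perm B) (X : Matrix ι ι R) :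
    permTrace (Equiv.Perm.sumCongr g h) X = permTrace g X * permTrace h X := by
  unfold permTrace
  rw [← (Equiv.sumArrowEquivProdArrow A B ι).symm.sum_comp, Fintype.sum_prod_type,
    Finset.sum_mul_sum]
  refine Finset.sum_congr rfl fun w _ => Finset.sum_congr rfl fun w' _ => ?_
  rw [Fintype.prod_sum_type]
  simp [Equiv.sumArrowEquivProdArrow]

variable [DecidableEq ι]

/-- A power of X is a sum over paths. The weight `H` on the end points is arbitrary so that the
induction can absorb the first step into it; a cycle is the case where `H` closes the path by one
more entry of X. -/
theorem sum_path (X : Matrix ι ι R) (r : ℕ) (H : ι → ι → R) :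
    ∑ w : Fin (r + 1) → ι, H (w 0) (w (Fin.last r)) * ∏ k : Fin r, X (w k.castSucc) (w k.succ) =
      ∑ a, ∑ b, H a b * (X ^ r) a b := by
  induction r generalizing H with
  | zero =>
    rw [← (Equiv.funUnique (Fin 1) ι).symm.sum_comp]
    simp [Matrix.one_apply]
  | succ r ih =>
    rw [← (Fin.consEquiv fun _ : Fin (r + 2) => ι).sum_comp, Fintype.sum_prod_type]
    have h1 : ∀ (a : ι) (w : Fin (r + 1) → ι),
        (Fin.consEquiv fun _ : Fin (r + 2) => ι) (a, w) = Fin.cons a w := fun _ _ => rfl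
    simp only [h1, Fin.cons_zero]
    have h2 : ∀ (a : ι) (w : Fin (r + 1) → ι),
        ∏ k : Fin (r + 1), X ((Fin.cons a w : Fin (r + 2) → ι) k.castSucc)
          ((Fin.cons a w : Fin (r + 2) → ι) k.succ) =
        X a (w 0) * ∏ k : Fin r, X (w k.castSucc) (w k.succ) := by
      intro a w
      rw [Fin.prod_univ_succ]
      simp
    have h3 : ∀ (a : ι) (w : Fin (r + 1) → ι),
        (Fin.cons a w : Fin (r + 2) → ι) (Fin.last (r + 1)) = w (Fin.last r) := by
      intro a w
      rw [← Fin.succ_last, Fin.cons_succ]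
    simp only [h2, h3]
    rw [Finset.sum_comm]
    have h4 := ih fun c b => ∑ a, H a b * X a c
    simp only [Finset.sum_mul, mul_assoc] at h4 ⊢
    rw [h4]
    simp only [pow_succ', Matrix.mul_apply, Finset.mul_sum]
    rw [Finset.sum_comm]
    conv_rhs => rw [Finset.sum_comm]
    refine Finset.sum_congr rfl fun b _ => ?_
    rw [Finset.sum_comm]

theorem permTrace_finRotate (X : Matrix ι ι R) (r : ℕ) :
    permTrace (finRotate (r + 1)) X = (X ^ (r + 1)).trace := by
  unfold permTrace
  have h := sum_path X r fun a b => X b a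
  rw [Matrix.trace, pow_succ]
  simp only [Matrix.diag_apply, Matrix.mul_apply]
  simp only [mul_comm ((X ^ r) _ _)]
  rw [← h]
  refine Finset.sum_congr rfl fun w _ => ?_
  rw [Fin.prod_univ_castSucc, mul_comm]
  simp

theorem cycleType_eq_of_injective {A B : Type*} [Fintype A] [DecidableEq A] [Fintype B]
    [DecidableEq B] {f : A → B} (hf : Function.Injective f) {g : Equiv.Perm A} {h : Equiv.Perm B}
    (h1 : ∀ a, h (f a) = f (g a)) (h2 : ∀ b, b ∉ Set.range f → h b = b) :
    h.cycleType = g.cycleType := by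
  classical
  have : h = g.extendDomain (Equiv.ofInjective f hf) := by
    ext b
    by_cases hb : b ∈ Set.range f
    · obtain ⟨a, rfl⟩ := hb
      rw [h1]
      have := Equiv.Perm.extendDomain_apply_image g (Equiv.ofInjective f hf) a
      simpa using this.symm
    · rw [h2 b hb, Equiv.Perm.extendDomain_apply_not_subtype _ _ hb]
  rw [this, Equiv.Perm.cycleType_extendDomain]

theorem cycleType_sumCongr {A B : Type*} [Fintype A] [DecidableEq A] [Fintype B] [DecidableEq B]
    (g : Equiv.Perm A) (h : Equiv.Perm B) :
    (Equiv.Perm.sumCongr g h).cycleType = g.cycleType + h.cycleType := by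
  have h0 : Equiv.Perm.sumCongr g h = Equiv.Perm.sumCongr g 1 * Equiv.Perm.sumCongr 1 h := by
    ext x; rcases x with a | b <;> simp
  have hd : Equiv.Perm.Disjoint (Equiv.Perm.sumCongr g (1 : Equiv.Perm B))
      (Equiv.Perm.sumCongr (1 : Equiv.Perm A) h) := by
    intro x; rcases x with a | b <;> simp
  rw [h0, hd.cycleType_mul]
  congr 1
  · refine cycleType_eq_of_injective Sum.inl_injective (fun a => by simp) fun b hb => ?_
    rcases b with a | b
    · exact (hb ⟨a, rfl⟩).elim
    · simp
  · refine cycleType_eq_of_injective Sum.inr_injective (fun a => by simp) fun b hb => ?_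
    rcases b with a | b
    · simp
    · exact (hb ⟨b, rfl⟩).elim

/-- A block sum of rotations is a representative of each cycle type for which the trace visibly
factors. Conjugation invariance carries the formula to all permutations in `permTrace_eq_prod`. -/
theorem exists_perm_permTrace (s : Multiset ℕ) (hs : ∀ i ∈ s, 0 < i) :
    ∃ g : Equiv.Perm (Fin s.sum), g.cycleType = s.filter (2 ≤ ·) ∧
      ∀ X : Matrix ι ι R, permTrace g X = (s.map fun k => (X ^ k).trace).prod := by
  induction s using Multiset.induction with
  | empty =>
    refine ⟨1, Equiv.Perm.cycleType_one, fun X => ?_⟩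
    have : IsEmpty (Fin (0 : Multiset ℕ).sum) := Fin.isEmpty
    rw [permTrace, Fintype.sum_unique, Finset.univ_eq_empty, Finset.prod_empty]
    simp
  | cons r s ih =>
    obtain ⟨g, hg, hX⟩ := ih fun i hi => hs i (Multiset.mem_cons_of_mem hi)
    obtain ⟨r, rfl⟩ : ∃ r', r = r' + 1 := ⟨r - 1, by have := hs r (Multiset.mem_cons_self _ _); omega⟩
    let e : Fin (r + 1) ⊕ Fin s.sum ≃ Fin ((r + 1) ::ₘ s).sum :=
      finSumFinEquiv.trans (finCongr (Multiset.sum_cons _ _).symm)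
    refine ⟨e.permCongr (Equiv.Perm.sumCongr (finRotate (r + 1)) g), ?_, fun X => ?_⟩
    · rw [cycleType_eq_of_injective (g := Equiv.Perm.sumCongr (finRotate (r + 1)) g) e.injective
        (fun a => by rw [Equiv.permCongr_apply, e.symm_apply_apply])
        (fun b hb => (hb (e.surjective b)).elim), cycleType_sumCongr, hg]
      rcases r with _ | r
      · rw [Multiset.filter_cons_of_neg _ (by norm_num), show finRotate (0 + 1) = 1 from
            Equiv.ext fun x => Subsingleton.elim (α := Fin 1) _ _,
          Equiv.Perm.cycleType_one, zero_add]
      · rw [Multiset.filter_cons_of_pos _ (by omega), cycleType_finRotate, Multiset.singleton_add]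
    · rw [permTrace_permCongr, permTrace_sumCongr, permTrace_finRotate, hX, Multiset.map_cons,
        Multiset.prod_cons]

theorem permTrace_eq_prod {n : ℕ} (g : Equiv.Perm (Fin n)) (X : Matrix ι ι R) :
    permTrace g X = ((cyc g).parts.map fun k => (X ^ k).trace).prod := by
  obtain ⟨h, h1, h2⟩ := exists_perm_permTrace (ι := ι) (R := R) (cyc g).parts
    fun i hi => (cyc g).parts_pos hi
  rw [← h2 X]
  let e : Fin (cyc g).parts.sum ≃ Fin n := finCongr (cyc g).parts_sum
  rw [← permTrace_permCongr e]
  have h3 : (e.permCongr h).cycleType = g.cycleType := by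
    rw [cycleType_eq_of_injective (g := h) e.injective
        (fun a => by rw [Equiv.permCongr_apply, e.symm_apply_apply])
        (fun b hb => (hb (e.surjective b)).elim), h1, cyc_parts,
      Equiv.Perm.filter_parts_partition_eq_cycleType]
  obtain ⟨c, hc⟩ := isConj_iff.1 (Equiv.Perm.isConj_iff_cycleType_eq.2 h3)
  rw [← permTrace_conj (e.permCongr h) c, hc]

theorem permTrace_diagonal {A : Type*} [Fintype A] [DecidableEq A] (g : Equiv.Perm A) (x : ι → R) :
    permTrace g (Matrix.diagonal x) =
      ∑ w : A → ι, if w ∘ g = w then ∏ a, x (w a) else 0 := by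
  unfold permTrace
  refine Finset.sum_congr rfl fun w _ => ?_
  split_ifs with h
  · refine Finset.prod_congr rfl fun a _ => ?_
    rw [show w (g a) = w a from congrFun h a, Matrix.diagonal_apply_eq]
  · obtain ⟨a, ha⟩ : ∃ a, w (g a) ≠ w a := by
      by_contra hh; push Not at hh; exact h (funext hh)
    exact Finset.prod_eq_zero (Finset.mem_univ a) (Matrix.diagonal_apply_ne _ ha.symm)

end PermTrace

/-! ### Specializations of symmetric functions -/

section Specializations

variable {S : Type*} [CommRing S] [Algebra ℂ S]

/-- The specialization of symmetric functions sending `P_k` to `t k`. -/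
def spec (t : ℕ → S) : SymFun →ₐ[ℂ] S := MvPolynomial.aeval fun k : ℕ+ => t k

theorem spec_psum (t : ℕ → S) {k : ℕ} (hk : 0 < k) : spec t (psum k) = t k := by
  rw [spec, psum, MvPolynomial.aeval_X, Nat.toPNat'_coe, if_pos hk]

theorem spec_psumMultiset (t : ℕ → S) {s : Multiset ℕ} (hs : ∀ i ∈ s, 0 < i) :
    spec t (psumMultiset s) = (s.map t).prod := by
  rw [psumMultiset, map_multiset_prod, Multiset.map_map]
  exact congrArg _ (Multiset.map_congr rfl fun i hi => spec_psum t (hs i hi))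

theorem spec_psumPart (t : ℕ → S) {n : ℕ} (μ : n.Partition) :
    spec t (psumPart μ) = (μ.parts.map t).prod :=
  spec_psumMultiset t fun _ hi => μ.parts_pos hi

theorem spec_congr {t t' : ℕ → S} (h : ∀ k, 0 < k → t k = t' k) : spec t = spec t' := by
  unfold spec
  congr 1
  exact funext fun k => h k k.pos

theorem map_spec {S' : Type*} [CommRing S'] [Algebra ℂ S'] (F : S →ₐ[ℂ] S') (t : ℕ → S)
    (f : SymFun) : F (spec t f) = spec (fun k => F (t k)) f := by
  rw [spec, spec, MvPolynomial.comp_aeval_apply]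

/-- The specialization of symmetric functions at the matrix `X`. -/
abbrev specMatrix {N : ℕ} (X : Matrix (Fin N) (Fin N) S) : SymFun →ₐ[ℂ] S :=
  spec fun k => (X ^ k).trace

/-- The specialization of symmetric functions at the variables `x`. -/
abbrev specVars {ι : Type*} [Fintype ι] (x : ι → S) : SymFun →ₐ[ℂ] S :=
  spec fun k => ∑ i, x i ^ k

theorem specMatrix_diagonal {N : ℕ} (x : Fin N → S) :
    specMatrix (Matrix.diagonal x) = specVars x := by
  refine spec_congr fun k _ => ?_
  rw [Matrix.diagonal_pow, Matrix.trace_diagonal]; simp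

theorem evalAt_eq {N : ℕ} (a : Fin N → ℂ) (f : SymFun) : evalAt a f = specVars a f := by
  rw [← specMatrix_diagonal, evalAt, specMatrix, spec]
  rfl

theorem specMatrix_psumPart_cyc {N n : ℕ} (X : Matrix (Fin N) (Fin N) S)
    (g : Equiv.Perm (Fin n)) : specMatrix X (psumPart (cyc g)) = permTrace g X := by
  rw [spec_psumPart, permTrace_eq_prod]

end Specializations

end MonotoneHurwitz
end

noncomputable section

namespace MonotoneHurwitz

/-! ### The complete symmetric functions -/

section Complete

theorem psumPart_cons {n r : ℕ} (ν : n.Partition) :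
    psumMultiset (r ::ₘ ν.parts) = psum r * psumPart ν := by
  rw [psumMultiset, Multiset.map_cons, Multiset.prod_cons, psumPart, psumMultiset]

theorem zee_eq_of_parts_eq_cons {n m r : ℕ} {μ : n.Partition} {ν : m.Partition}
    (h : μ.parts = r ::ₘ ν.parts) : zee μ = zee ν * (r * μ.parts.count r) := by
  classical
  have hr : r ∈ μ.parts := by rw [h]; exact Multiset.mem_cons_self _ _
  have h1 : zee ν = ∏ i ∈ μ.parts.toFinset, (ν.parts.count i)! * i ^ ν.parts.count i := by
    refine Finset.prod_subset (fun i hi => ?_) fun i _ hi => ?_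
    · rw [Multiset.mem_toFinset] at hi ⊢
      rw [h]; exact Multiset.mem_cons_of_mem hi
    · rw [Multiset.mem_toFinset] at hi
      rw [Multiset.count_eq_zero_of_notMem hi]; simp
  rw [h1, zee, ← Finset.mul_prod_erase _ _ (Multiset.mem_toFinset.2 hr),
    ← Finset.mul_prod_erase _ _ (Multiset.mem_toFinset.2 hr)]
  have h2 : ∏ i ∈ μ.parts.toFinset.erase r, (μ.parts.count i)! * i ^ μ.parts.count i =
      ∏ i ∈ μ.parts.toFinset.erase r, (ν.parts.count i)! * i ^ ν.parts.count i := by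
    refine Finset.prod_congr rfl fun i hi => ?_
    rw [h, Multiset.count_cons_of_ne (Finset.ne_of_mem_erase hi)]
  rw [h2, h, Multiset.count_cons_self, Nat.factorial_succ, pow_succ]
  ring

theorem complete_zero : complete 0 = 1 := by
  rw [complete, Fintype.sum_unique]
  simp [zee, psumPart, psumMultiset]

/-- Newton's identity for the complete symmetric functions. -/
theorem natCast_smul_complete (n : ℕ) :
    (n : ℂ) • complete n = ∑ r ∈ Finset.Icc 1 n, psum r * complete (n - r) := by
  classical
  -- Adding a part r to ν gives μ with Z_μ = Z_ν · r m_r(μ). Hence P_μ/Z_μ occurs with total weight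
  -- ∑_r r m_r(μ), which is n.
  have h1 : ∀ r ∈ Finset.Icc 1 n, psum r * complete (n - r) =
      ∑ μ : n.Partition, if r ∈ μ.parts then
        ((r * μ.parts.count r : ℕ) * (zee μ : ℂ)⁻¹) • psumPart μ else 0 := by
    intro r hr
    rw [Finset.mem_Icc] at hr
    rw [← Finset.sum_filter, ← Finset.sum_subtype_eq_sum_filter, Finset.subtype_univ,
      ← (Nat.Partition.partitionWithPartEquiv hr.1 hr.2).symm.sum_comp, complete, Finset.mul_sum]
    refine Finset.sum_congr rfl fun ν _ => ?_
    have h2 := Nat.Partition.partitionWithPartEquiv_symm_apply_parts hr.1 hr.2 ν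
    have h4 : psumPart ((Nat.Partition.partitionWithPartEquiv hr.1 hr.2).symm ν).1 =
        psum r * psumPart ν := by rw [psumPart, h2, psumPart_cons]
    have h5 := zee_eq_of_parts_eq_cons h2
    rw [h4, h5, mul_smul_comm]
    congr 1
    have h3 : (((r * ((Nat.Partition.partitionWithPartEquiv hr.1 hr.2).symm
        ν).1.parts.count r : ℕ)) : ℂ) ≠ 0 := by
      rw [h2, Multiset.count_cons_self]
      norm_cast
      exact Nat.mul_ne_zero (by omega) (by omega)
    have h6 := zee_ne_zero ν
    rw [Nat.cast_mul (zee ν)]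
    field_simp
  rw [Finset.sum_congr rfl h1, Finset.sum_comm, complete, Finset.smul_sum]
  refine Finset.sum_congr rfl fun μ _ => ?_
  rw [← Finset.sum_filter, ← Finset.sum_smul, smul_smul, ← Finset.sum_mul, ← Nat.cast_sum]
  congr 3
  have h6 : (Finset.Icc 1 n).filter (· ∈ μ.parts) = μ.parts.toFinset := by
    ext i
    simp only [Finset.mem_filter, Finset.mem_Icc, Multiset.mem_toFinset]
    exact ⟨fun h => h.2, fun h => ⟨⟨μ.parts_pos h, μ.le_of_mem_parts h⟩, h⟩⟩
  rw [h6]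
  conv_lhs => rw [← μ.parts_sum, Finset.sum_multiset_count]
  exact Finset.sum_congr rfl fun i _ => by rw [smul_eq_mul, mul_comm]

theorem charMap_sum_perm (n : ℕ) : charMap n (∑ g, perm g) = complete n := by
  rw [sum_perm_eq_sum_partition, map_sum, complete]
  exact Finset.sum_congr rfl fun μ _ => charMap_classSum μ

variable {S : Type*} [CommRing S] [Algebra ℂ S]

/-- The generating series of the values of the complete symmetric functions at `P_k = t k`. -/
def completeSeries (t : ℕ → S) : PowerSeries S := PowerSeries.mk fun n => spec t (complete n)

theorem coeff_completeSeries (t : ℕ → S) (n : ℕ) :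
    PowerSeries.coeff n (completeSeries t) = spec t (complete n) := PowerSeries.coeff_mk _ _

theorem coeff_zero_completeSeries (t : ℕ → S) : PowerSeries.coeff 0 (completeSeries t) = 1 := by
  rw [coeff_completeSeries, complete_zero, map_one]

/-- Newton's identities in the form of a first-order linear equation. By `eq_completeSeries` this
equation and the constant term 1 determine the series, because the positive integers are invertible;
the closed forms below are all verified in this way. -/
theorem derivative_completeSeries (t : ℕ → S) :
    PowerSeries.derivative S (completeSeries t) =
      PowerSeries.mk (fun i => t (i + 1)) * completeSeries t := by
  ext n
  rw [PowerSeries.coeff_derivative, PowerSeries.coeff_mul,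
    Finset.Nat.sum_antidiagonal_eq_sum_range_succ_mk]
  simp only [PowerSeries.coeff_mk, coeff_completeSeries]
  have h := congrArg (spec t) (natCast_smul_complete (n + 1))
  rw [map_smul, map_sum] at h
  have h2 : spec t (complete (n + 1)) * ((n : S) + 1) =
      ((n + 1 : ℕ) : ℂ) • spec t (complete (n + 1)) := by
    rw [Algebra.smul_def, mul_comm]; simp
  have h3 := Finset.sum_Ico_add' (fun i => t i * spec t (complete (n + 1 - i))) 0 (n + 1) 1
  rw [h2, h, Finset.range_eq_Ico]
  refine Eq.trans ?_ (h3.symm.trans ?_)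
  · refine Finset.sum_congr rfl fun r hr => ?_
    rw [map_mul, spec_psum t (Finset.mem_Icc.1 hr).1]
  · refine Finset.sum_congr rfl fun i hi => ?_
    rw [show n + 1 - (i + 1) = n - i by omega]

theorem eq_completeSeries {t : ℕ → S} {E : PowerSeries S} (h0 : PowerSeries.coeff 0 E = 1)
    (h : PowerSeries.derivative S E = PowerSeries.mk (fun i => t (i + 1)) * E) :
    E = completeSeries t := by
  have hn : ∀ n, PowerSeries.coeff n E = PowerSeries.coeff n (completeSeries t) := by
    intro n
    induction n using Nat.strong_induction_on with
    | _ n ih =>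
      rcases n with _ | n
      · rw [h0, coeff_zero_completeSeries]
      · have h1 := congrArg (PowerSeries.coeff n) h
        have h2 := congrArg (PowerSeries.coeff n) (derivative_completeSeries t)
        rw [PowerSeries.coeff_derivative, PowerSeries.coeff_mul] at h1 h2
        have h3 : PowerSeries.coeff (n + 1) E * ((n : S) + 1) =
            PowerSeries.coeff (n + 1) (completeSeries t) * ((n : S) + 1) := by
          rw [h1, h2]
          refine Finset.sum_congr rfl fun p hp => ?_
          rw [ih p.2 (by have := Finset.HasAntidiagonal.mem_antidiagonal.1 hp; omega)]
        have h4 : IsUnit ((n : S) + 1) := by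
          have : (n : S) + 1 = algebraMap ℂ S ((n : ℂ) + 1) := by simp
          rw [this]
          exact (IsUnit.mk0 _ (by exact_mod_cast Nat.succ_ne_zero n)).map _
        exact h4.mul_left_inj.1 h3
  exact PowerSeries.ext hn

theorem completeSeries_add (t t' : ℕ → S) :
    completeSeries (fun k => t k + t' k) = completeSeries t * completeSeries t' := by
  refine (eq_completeSeries ?_ ?_).symm
  · rw [PowerSeries.coeff_mul]
    simp [complete_zero, coeff_completeSeries]
  · rw [Derivation.leibniz, derivative_completeSeries, derivative_completeSeries]
    have : (PowerSeries.mk fun i => t (i + 1) + t' (i + 1)) =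
        PowerSeries.mk (fun i => t (i + 1)) + PowerSeries.mk (fun i => t' (i + 1)) := by
      ext; simp
    rw [this, smul_eq_mul, smul_eq_mul]; ring

theorem completeSeries_zero : completeSeries (fun _ => (0 : S)) = 1 := by
  refine (eq_completeSeries (by simp) ?_).symm
  have : (PowerSeries.mk fun _ => (0 : S)) = 0 := by ext; simp
  rw [this, zero_mul, ← map_one (algebraMap S _), Derivation.map_algebraMap]

theorem completeSeries_sum {ι : Type*} (s : Finset ι) (t : ι → ℕ → S) :
    completeSeries (fun k => ∑ i ∈ s, t i k) = ∏ i ∈ s, completeSeries (t i) := by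
  classical
  induction s using Finset.induction with
  | empty => simpa using completeSeries_zero
  | insert i s hi ih =>
    rw [Finset.prod_insert hi, ← ih, ← completeSeries_add]
    simp only [Finset.sum_insert hi]

/-- Rising factorials, as coefficients of `(1 - x) ^ (-M)`. -/
theorem completeSeries_const_mul_pow (M : ℂ) (x : S) :
    completeSeries (fun k => M • x ^ k) =
      PowerSeries.mk fun n => ((ascPochhammer ℂ n).eval M / n !) • x ^ n := by
  refine (eq_completeSeries ?_ ?_).symm
  · simp
  · ext n
    rw [PowerSeries.coeff_derivative, PowerSeries.coeff_mul,
      Finset.Nat.sum_antidiagonal_eq_sum_range_succ_mk]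
    simp only [PowerSeries.coeff_mk]
    have h1 : ∀ i ∈ Finset.range (n + 1), M • x ^ (i + 1) *
        ((ascPochhammer ℂ (n - i)).eval M / (n - i)!) • x ^ (n - i) =
        (M * ((ascPochhammer ℂ (n - i)).eval M / (n - i)!)) • x ^ (n + 1) := by
      intro i hi
      have := Finset.mem_range.1 hi
      rw [smul_mul_smul_comm, ← pow_add]
      congr 2; omega
    rw [Finset.sum_congr rfl h1, ← Finset.sum_smul, ← Finset.mul_sum]
    have h2 : ∀ m : ℕ, M * ∑ j ∈ Finset.range (m + 1), (ascPochhammer ℂ j).eval M / (j ! : ℂ) =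
        (m + 1) * ((ascPochhammer ℂ (m + 1)).eval M / ((m + 1)! : ℂ)) := by
      intro m
      induction m with
      | zero => simp
      | succ m ih =>
        rw [Finset.sum_range_succ, mul_add, ih, ascPochhammer_succ_eval (m + 1),
          Nat.factorial_succ (m + 1)]
        have : ((m + 1)! : ℂ) ≠ 0 := by exact_mod_cast Nat.factorial_ne_zero _
        have h3 : (m : ℂ) + 1 + 1 ≠ 0 := by exact_mod_cast Nat.succ_ne_zero (m + 1)
        push_cast
        field_simp
        ring
    have h4 : ∑ j ∈ Finset.range (n + 1), (ascPochhammer ℂ (n - j)).eval M / ((n - j)! : ℂ) =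
        ∑ j ∈ Finset.range (n + 1), (ascPochhammer ℂ j).eval M / (j ! : ℂ) :=
      Finset.sum_range_reflect (fun j => (ascPochhammer ℂ j).eval M / (j ! : ℂ)) (n + 1)
    rw [h4, h2, smul_mul_assoc, Algebra.smul_def, Algebra.smul_def]
    simp
    ring

theorem completeSeries_pow (x : S) :
    completeSeries (fun k => x ^ k) = PowerSeries.mk fun n => x ^ n := by
  have h := completeSeries_const_mul_pow 1 x
  simp only [one_smul] at h
  rw [h]
  ext n
  rw [PowerSeries.coeff_mk, PowerSeries.coeff_mk, ascPochhammer_eval_one, div_self, one_smul]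
  exact_mod_cast Nat.factorial_ne_zero n

theorem spec_scale_complete (t : ℕ → S) (y : S) (n : ℕ) :
    spec (fun k => t k * y ^ k) (complete n) = y ^ n * spec t (complete n) := by
  have h : PowerSeries.mk (fun n => y ^ n * spec t (complete n)) =
      completeSeries fun k => t k * y ^ k := by
    refine eq_completeSeries ?_ ?_
    · simp [complete_zero]
    · have hd := derivative_completeSeries t
      ext n
      have h1 := congrArg (PowerSeries.coeff n) hd
      rw [PowerSeries.coeff_derivative, PowerSeries.coeff_mul] at h1 ⊢
      simp only [PowerSeries.coeff_mk, coeff_completeSeries] at h1 ⊢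
      rw [mul_assoc, h1, Finset.mul_sum]
      refine Finset.sum_congr rfl fun p hp => ?_
      have : n + 1 = (p.1 + 1) + p.2 := by have := Finset.HasAntidiagonal.mem_antidiagonal.1 hp; omega
      rw [this, pow_add]; ring
  rw [← coeff_completeSeries, ← h, PowerSeries.coeff_mk]

end Complete

end MonotoneHurwitz
end

noncomputable section

namespace MonotoneHurwitz

/-! ### Symmetric functions are separated by their values -/

section Separation

open Finset in
/-- The power sums of `N` complex variables take arbitrary values in degrees `1, ..., N`. -/
theorem exists_powerSums (N : ℕ) (t : ℕ → ℂ) :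
    ∃ a : Fin N → ℂ, ∀ k, 0 < k → k ≤ N → ∑ i, a i ^ k = t k := by
  -- With -t in place of t, h_k becomes (-1)^k e_k of the alphabet sought. These numbers are the
  -- coefficients of the monic polynomial whose roots are the required variables, and Newton's
  -- identities recover t from them.
  set c : ℕ → ℂ := fun k => spec (fun k => -t k) (complete k) with hc
  have hc0 : c 0 = 1 := by simp [hc, complete_zero]
  have hck : ∀ k : ℕ, (k : ℂ) * c k = -∑ r ∈ Icc 1 k, t r * c (k - r) := by
    intro k
    have h := congrArg (spec fun k => -t k) (natCast_smul_complete k)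
    rw [map_smul, map_sum, smul_eq_mul] at h
    rw [hc, h, ← sum_neg_distrib]
    refine sum_congr rfl fun r hr => ?_
    rw [map_mul, spec_psum _ (mem_Icc.1 hr).1, neg_mul]
  let p : Polynomial ℂ := ∑ k ∈ range (N + 1), Polynomial.C (c k) * Polynomial.X ^ (N - k)
  have hcoeff : ∀ k ≤ N, p.coeff (N - k) = c k := by
    intro k hk
    rw [Polynomial.finsetSum_coeff, sum_eq_single k]
    · simp
    · intro j hj hjk
      rw [Polynomial.coeff_C_mul_X_pow, if_neg]
      have := mem_range.1 hj
      omega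
    · intro h; exact absurd (mem_range.2 (by omega)) h
  have hdeg : p.natDegree ≤ N := by
    refine Polynomial.natDegree_sum_le_of_forall_le _ _ fun k _ => ?_
    exact (Polynomial.natDegree_C_mul_X_pow_le _ _).trans (by omega)
  have hN : p.coeff N = 1 := by simpa [hc0] using hcoeff 0 (Nat.zero_le _)
  have hdeg' : p.natDegree = N :=
    le_antisymm hdeg (Polynomial.le_natDegree_of_ne_zero (by rw [hN]; exact one_ne_zero))
  have hlead : p.leadingCoeff = 1 := by rw [Polynomial.leadingCoeff, hdeg', hN]
  have hcard : p.roots.card = p.natDegree :=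
    Polynomial.splits_iff_card_roots.1 (IsAlgClosed.splits p)
  have hcard' : p.roots.toList.length = N := by rw [Multiset.length_toList, hcard, hdeg']
  let a : Fin N → ℂ := fun i => p.roots.toList.get (i.cast hcard'.symm)
  have hroots : univ.val.map a = p.roots := by
    have h1 : List.ofFn a = p.roots.toList := by
      refine List.ext_get (by simp [hcard']) fun i h1 h2 => ?_
      simp [a]
    rw [Fin.univ_val_map, h1, Multiset.coe_toList]
  have hesymm : ∀ k ≤ N, MvPolynomial.aeval a (MvPolynomial.esymm (Fin N) ℂ k) =
      (-1) ^ k * c k := by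
    intro k hk
    rw [MvPolynomial.aeval_esymm_eq_multiset_esymm, hroots]
    have h1 := Polynomial.coeff_eq_esymm_roots_of_card hcard (k := N - k) (by omega)
    rw [hcoeff k hk, hlead, hdeg', show N - (N - k) = k by omega, one_mul] at h1
    rw [h1, ← mul_assoc, ← mul_pow]; simp
  refine ⟨a, fun k => ?_⟩
  induction k using Nat.strong_induction_on with
  | _ k ih =>
    intro hk0 hkN
    have h1 := congrArg (MvPolynomial.aeval a) (MvPolynomial.psum_eq_mul_esymm_sub_sum (Fin N) ℂ k hk0)
    have hps : ∀ j, MvPolynomial.aeval a (MvPolynomial.psum (Fin N) ℂ j) = ∑ i, a i ^ j := by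
      intro j; simp [MvPolynomial.psum]
    simp only [map_sub, map_sum, map_mul, map_pow, map_neg, map_one, map_natCast, hps] at h1
    rw [h1, hesymm k hkN]
    have h2 : ∑ x ∈ antidiagonal k with x.1 ∈ Set.Ioo 0 k, (-1) ^ x.1 *
        MvPolynomial.aeval a (MvPolynomial.esymm (Fin N) ℂ x.1) * ∑ i, a i ^ x.2 =
        ∑ r ∈ Ico 1 k, t r * c (k - r) := by
      symm
      refine sum_bij' (fun r _ => (k - r, r)) (fun x _ => x.2) ?_ ?_ ?_ ?_ ?_
      · intro r hr; rw [mem_Ico] at hr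
        simp only [mem_filter, HasAntidiagonal.mem_antidiagonal, Set.mem_Ioo]; omega
      · intro x hx
        simp only [mem_filter, HasAntidiagonal.mem_antidiagonal, Set.mem_Ioo] at hx
        rw [mem_Ico]; omega
      · intro r _; rfl
      · intro x hx
        simp only [mem_filter, HasAntidiagonal.mem_antidiagonal, Set.mem_Ioo] at hx
        ext <;> simp; omega
      · intro r hr
        rw [mem_Ico] at hr
        rw [hesymm (k - r) (by omega), ih r (by omega) (by omega) (by omega), ← mul_assoc,
          ← mul_pow]
        simp [mul_comm]
    rw [h2]
    have h3 := hck k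
    rw [← Ico_add_one_right_eq_Icc, sum_Ico_succ_top (by omega), Nat.sub_self, hc0, mul_one] at h3
    have h4 : (-1 : ℂ) ^ (k + 1) * (k : ℂ) * ((-1) ^ k * c k) = -((k : ℂ) * c k) := by
      have : (-1 : ℂ) ^ (k + 1) * (-1) ^ k = -1 := by
        rw [pow_succ]
        have : (-1 : ℂ) ^ k * (-1) ^ k = 1 := by rw [← mul_pow]; simp
        linear_combination -this
      linear_combination (k : ℂ) * c k * this
    rw [h4, h3]; ring

/-- The symmetric function `f` only depends on `P_1, ..., P_N`. -/
def DependsOn (N : ℕ) (f : SymFun) : Prop :=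
  ∀ t t' : ℕ → ℂ, (∀ k, 0 < k → k ≤ N → t k = t' k) → spec t f = spec t' f

theorem dependsOn_psumPart {n N : ℕ} (hn : n ≤ N) (μ : n.Partition) : DependsOn N (psumPart μ) := by
  intro t t' h
  rw [spec_psumPart, spec_psumPart]
  exact congrArg _ (Multiset.map_congr rfl fun i hi =>
    h i (μ.parts_pos hi) ((μ.le_of_mem_parts hi).trans hn))

theorem dependsOn_sum {N : ℕ} {ι : Type*} {s : Finset ι} {f : ι → SymFun}
    (h : ∀ i ∈ s, DependsOn N (f i)) : DependsOn N (∑ i ∈ s, f i) := by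
  intro t t' htt
  rw [map_sum, map_sum]
  exact Finset.sum_congr rfl fun i hi => h i hi t t' htt

theorem dependsOn_smul {N : ℕ} {f : SymFun} (h : DependsOn N f) (c : ℂ) :
    DependsOn N (c • f) := by
  intro t t' htt
  rw [map_smul, map_smul, h t t' htt]

theorem dependsOn_sub {N : ℕ} {f g : SymFun} (hf : DependsOn N f) (hg : DependsOn N g) :
    DependsOn N (f - g) := by
  intro t t' htt
  rw [map_sub, map_sub, hf t t' htt, hg t t' htt]

theorem dependsOn_charMap {n N : ℕ} (hn : n ≤ N) (x : GroupAlg n) : DependsOn N (charMap n x) := by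
  rw [eq_sum_perm x, map_sum]
  refine dependsOn_sum fun g _ => ?_
  rw [map_smul, charMap_perm]
  exact dependsOn_smul (dependsOn_smul (dependsOn_psumPart hn _) _) _

theorem eq_zero_of_spec {f : SymFun} (h : ∀ t : ℕ → ℂ, spec t f = 0) : f = 0 := by
  refine MvPolynomial.funext fun x => ?_
  have h1 := h fun k => if hk : 0 < k then x ⟨k, hk⟩ else 0
  rw [map_zero, ← h1, spec]
  have : (fun k : ℕ+ => if hk : 0 < (k : ℕ) then x ⟨k, hk⟩ else 0) = x := by
    funext k
    exact dif_pos k.pos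
  rw [this]; rfl

/-- N complex variables realize every value of (P_1, …, P_N), so they separate functions of these
power sums alone. -/
theorem eq_zero_of_specVars {N : ℕ} {f : SymFun} (hf : DependsOn N f)
    (h : ∀ a : Fin N → ℂ, specVars a f = 0) : f = 0 := by
  refine eq_zero_of_spec fun t => ?_
  obtain ⟨a, ha⟩ := exists_powerSums N t
  rw [← h a]
  exact hf _ _ fun k hk hkN => (ha k hk hkN).symm

theorem eq_of_specVars {N : ℕ} {f g : SymFun} (hf : DependsOn N f) (hg : DependsOn N g)
    (h : ∀ a : Fin N → ℂ, specVars a f = specVars a g) : f = g :=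
  sub_eq_zero.1 (eq_zero_of_specVars (dependsOn_sub hf hg) fun a => by
    rw [map_sub, h, sub_self])

/-- The specialization of `Λ ⊗ Λ` given by two specializations of `Λ`. -/
def spec₂ (t t' : ℕ → ℂ) : SymFun ⊗[ℂ] SymFun →ₐ[ℂ] ℂ :=
  Algebra.TensorProduct.lift (spec t) (spec t') fun _ _ => Commute.all _ _

theorem spec₂_tmul (t t' : ℕ → ℂ) (f g : SymFun) : spec₂ t t' (f ⊗ₜ g) = spec t f * spec t' g := by
  simp [spec₂]

theorem eq_of_spec₂ {F G : SymFun ⊗[ℂ] SymFun} (h : ∀ t t' : ℕ → ℂ, spec₂ t t' F = spec₂ t t' G) :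
    F = G := by
  apply (MvPolynomial.tensorEquivSum ℂ ℕ+ ℕ+ ℂ).injective
  refine MvPolynomial.funext fun x => ?_
  have h1 : ∀ F : SymFun ⊗[ℂ] SymFun,
      MvPolynomial.eval x (MvPolynomial.tensorEquivSum ℂ ℕ+ ℕ+ ℂ F) =
      spec₂ (fun k => if hk : 0 < k then x (Sum.inl ⟨k, hk⟩) else 0)
        (fun k => if hk : 0 < k then x (Sum.inr ⟨k, hk⟩) else 0) F := by
    have : (MvPolynomial.aeval x).comp (MvPolynomial.tensorEquivSum ℂ ℕ+ ℕ+ ℂ).toAlgHom =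
      spec₂ (fun k => if hk : 0 < k then x (Sum.inl ⟨k, hk⟩) else 0)
        (fun k => if hk : 0 < k then x (Sum.inr ⟨k, hk⟩) else 0) := by
      ext k <;> simp [spec₂, spec] <;> rfl
    intro F
    exact DFunLike.congr_fun this F
  rw [h1, h1, h]

theorem psumPart_eq_monomial {n : ℕ} (μ : n.Partition) :
    psumPart μ = MvPolynomial.monomial (Multiset.toFinsupp (μ.parts.map Nat.toPNat')) 1 := by
  rw [psumPart, psumMultiset]
  induction μ.parts using Multiset.induction with
  | empty => simp
  | cons r s ih =>
    rw [Multiset.map_cons, Multiset.prod_cons, ih, Multiset.map_cons, ← Multiset.singleton_add,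
      Multiset.toFinsupp_add, Multiset.toFinsupp_singleton, psum, MvPolynomial.X,
      MvPolynomial.monomial_mul, one_mul]

theorem psumPart_exponent_injective {n : ℕ} : Function.Injective fun μ : n.Partition =>
    Multiset.toFinsupp (μ.parts.map Nat.toPNat') := by
  intro μ ν h
  have h1 := Multiset.toFinsupp.injective h
  have h2 := congrArg (Multiset.map fun k : ℕ+ => (k : ℕ)) h1
  have h3 : ∀ μ : n.Partition, (μ.parts.map Nat.toPNat').map (fun k : ℕ+ => (k : ℕ)) = μ.parts := by
    intro μ
    rw [Multiset.map_map]
    conv_rhs => rw [← Multiset.map_id μ.parts]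
    refine Multiset.map_congr rfl fun i hi => ?_
    have := μ.parts_pos hi
    simp [Nat.toPNat'_coe, this]
  rw [h3, h3] at h2
  exact Nat.Partition.ext h2

/-- The P_μ are distinct monomials in Λ, so their coefficients in ch(x) can be read off one class at
a time. -/
theorem sum_coeff_eq_zero {n : ℕ} {x : GroupAlg n} (hx : charMap n x = 0) (μ : n.Partition) :
    ∑ g ∈ cycleClass μ, x.coeff g = 0 := by
  classical
  have h1 : charMap n x = ∑ ν : n.Partition,
      ((n ! : ℂ)⁻¹ * ∑ g ∈ cycleClass ν, x.coeff g) • psumPart ν := by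
    conv_lhs => rw [eq_sum_perm x, map_sum, sum_perm_eq_sum_partition]
    refine Finset.sum_congr rfl fun ν _ => ?_
    rw [Finset.mul_sum, Finset.sum_smul]
    refine Finset.sum_congr rfl fun g hg => ?_
    rw [map_smul, charMap_perm, smul_smul, mem_cycleClass.1 hg, mul_comm]
  have h2 := congrArg (MvPolynomial.coeff (Multiset.toFinsupp (μ.parts.map Nat.toPNat')))
    (h1.symm.trans hx)
  rw [MvPolynomial.coeff_sum, Finset.sum_eq_single μ, psumPart_eq_monomial] at h2
  · simp only [MvPolynomial.coeff_smul, MvPolynomial.coeff_monomial, if_true, smul_eq_mul, mul_one,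
      MvPolynomial.coeff_zero, mul_eq_zero, inv_eq_zero] at h2
    refine h2.resolve_left ?_
    exact_mod_cast Nat.factorial_ne_zero n
  · intro ν _ hν
    rw [psumPart_eq_monomial, MvPolynomial.coeff_smul, MvPolynomial.coeff_monomial, if_neg, smul_zero]
    exact fun h => hν (psumPart_exponent_injective h)
  · intro h; exact absurd (Finset.mem_univ μ) h

/-- An element with vanishing characteristic is annihilated by all class functions. -/
theorem sum_smul_eq_zero_of_charMap {n : ℕ} {V : Type*} [AddCommGroup V] [Module ℂ V]
    {x : GroupAlg n} (hx : charMap n x = 0) {F : Equiv.Perm (Fin n) → V}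
    (hF : ∀ g h, cyc g = cyc h → F g = F h) : ∑ g, x.coeff g • F g = 0 := by
  rw [sum_perm_eq_sum_partition]
  refine Finset.sum_eq_zero fun μ _ => ?_
  obtain ⟨g₀, hg₀⟩ := exists_cyc_eq μ
  rw [Finset.sum_congr rfl fun g hg => by
    rw [hF g g₀ ((mem_cycleClass.1 hg).trans hg₀.symm)], ← Finset.sum_smul, sum_coeff_eq_zero hx,
    zero_smul]

theorem charMap_mul_comm {n : ℕ} (x y : GroupAlg n) : charMap n (x * y) = charMap n (y * x) := by
  rw [eq_sum_perm x, eq_sum_perm y, Finset.sum_mul_sum, Finset.sum_mul_sum, Finset.sum_comm]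
  simp only [map_sum, smul_mul_smul_comm, map_smul, ← perm_mul, charMap_perm]
  refine Finset.sum_congr rfl fun g _ => Finset.sum_congr rfl fun h _ => ?_
  rw [cyc_mul_comm, mul_comm]

/-- For central z the map g ↦ ch(z g) is a class function, so it kills the kernel of ch. Thus z acts
on the image of ch, and eigenvalues may be computed on any preimage of a Schur function. -/
theorem charMap_mul_eq_of_central {n : ℕ} {z : GroupAlg n} (hz : ∀ y, Commute z y)
    {x y : GroupAlg n} (hxy : charMap n x = charMap n y) :
    charMap n (z * x) = charMap n (z * y) := by
  have h1 : charMap n (x - y) = 0 := by rw [map_sub, hxy, sub_self]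
  have h2 := sum_smul_eq_zero_of_charMap h1 (F := fun g => charMap n (z * perm g)) fun g h hgh => by
    obtain ⟨c, hc⟩ := isConj_iff.1 (cyc_eq_iff.1 hgh)
    rw [← hc, perm_mul, perm_mul, ← mul_assoc, ← mul_assoc, (hz (perm c)).eq, mul_assoc (perm c),
      mul_assoc (perm c), charMap_mul_comm (perm c), mul_assoc (z * perm g), ← perm_mul,
      inv_mul_cancel, perm_one, mul_one]
  have h3 : charMap n (z * (x - y)) = ∑ g, (x - y).coeff g • charMap n (z * perm g) := by
    conv_lhs => rw [eq_sum_perm (x - y), Finset.mul_sum, map_sum]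
    simp only [mul_smul_comm, map_smul]
  rw [h2, mul_sub, map_sub] at h3
  exact sub_eq_zero.1 h3

end Separation

end MonotoneHurwitz
end

noncomputable section

namespace MonotoneHurwitz

/-! ### Partitions as decreasing sequences -/

section Rows

variable {n : ℕ}

theorem row_antitone (ν : n.Partition) : Antitone (row ν) := by
  intro i j hij
  unfold row
  set L := ν.parts.sort (· ≥ ·)
  have hL : L.Pairwise (· ≥ ·) := Multiset.pairwise_sort _ _
  rcases lt_or_ge j L.length with hj | hj
  · rw [List.getD_eq_getElem _ _ hj, List.getD_eq_getElem _ _ (hij.trans_lt hj)]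
    rcases hij.eq_or_lt with rfl | h
    · exact le_rfl
    · exact List.pairwise_iff_getElem.1 hL i j _ hj h
  · rw [List.getD_eq_default _ _ hj]
    exact Nat.zero_le _

theorem row_eq_zero_iff (ν : n.Partition) (i : ℕ) : row ν i = 0 ↔ Multiset.card ν.parts ≤ i := by
  unfold row
  rw [← Multiset.length_sort (r := (· ≥ ·)) (s := ν.parts)]
  rcases lt_or_ge i (ν.parts.sort (· ≥ ·)).length with hi | hi
  · rw [List.getD_eq_getElem _ _ hi]
    have : 0 < (ν.parts.sort (· ≥ ·))[i] :=
      ν.parts_pos ((Multiset.mem_sort (r := (· ≥ ·))).1 (List.getElem_mem hi))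
    omega
  · rw [List.getD_eq_default _ _ hi]
    exact ⟨fun _ => hi, fun _ => rfl⟩

theorem sum_range_getD (L : List ℕ) {N : ℕ} (h : L.length ≤ N) :
    ∑ i ∈ Finset.range N, L.getD i 0 = L.sum := by
  induction L generalizing N with
  | nil => simp
  | cons a L ih =>
    obtain ⟨N, rfl⟩ : ∃ M, N = M + 1 := ⟨N - 1, by simp at h; omega⟩
    rw [Finset.sum_range_succ']
    simp only [List.getD_cons_succ, List.getD_cons_zero, List.sum_cons]
    rw [ih (by simpa using h), add_comm]

theorem sum_row (ν : n.Partition) {N : ℕ} (h : Multiset.card ν.parts ≤ N) :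
    ∑ i : Fin N, row ν i = n := by
  rw [Fin.sum_univ_eq_sum_range (fun i => row ν i) N]
  unfold row
  rw [sum_range_getD _ (by rwa [Multiset.length_sort]), ← Multiset.sum_coe, Multiset.sort_eq,
    ν.parts_sum]

theorem card_parts_le (ν : n.Partition) : Multiset.card ν.parts ≤ n := by
  have h := Multiset.card_nsmul_le_sum (s := ν.parts) (a := 1) fun x hx => ν.parts_pos hx
  rw [ν.parts_sum] at h
  simpa using h

theorem eq_of_getD_eq {L L' : List ℕ} (hL : ∀ x ∈ L, 0 < x) (hL' : ∀ x ∈ L', 0 < x)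
    (h : ∀ i, L.getD i 0 = L'.getD i 0) : L = L' := by
  induction L generalizing L' with
  | nil =>
    cases L' with
    | nil => rfl
    | cons b L' =>
      have := h 0
      simp at this
      have := hL' b (by simp)
      omega
  | cons a L ih =>
    cases L' with
    | nil =>
      have := h 0
      simp at this
      have := hL a (by simp)
      omega
    | cons b L' =>
      have h0 := h 0
      simp only [List.getD_cons_zero] at h0
      rw [h0, ih (fun x hx => hL x (List.mem_cons_of_mem _ hx))
        (fun x hx => hL' x (List.mem_cons_of_mem _ hx))
        fun i => by simpa only [List.getD_cons_succ] using h (i + 1)]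

theorem eq_of_row_eq {ν ν' : n.Partition} (h : ∀ i, row ν i = row ν' i) : ν = ν' := by
  have h1 : ∀ ν : n.Partition, ∀ x ∈ ν.parts.sort (· ≥ ·), 0 < x :=
    fun ν x hx => ν.parts_pos ((Multiset.mem_sort (r := (· ≥ ·))).1 hx)
  have h2 := eq_of_getD_eq (h1 ν) (h1 ν') h
  have h3 := congrArg (fun L : List ℕ => (L : Multiset ℕ)) h2
  simp only [Multiset.sort_eq] at h3
  exact Nat.Partition.ext h3

theorem getD_filter_of_pairwise {L : List ℕ} (hL : L.Pairwise (· ≥ ·)) (i : ℕ) :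
    (L.filter (· ≠ 0)).getD i 0 = L.getD i 0 := by
  induction L generalizing i with
  | nil => simp
  | cons a L ih =>
    rw [List.pairwise_cons] at hL
    by_cases ha : a = 0
    · subst ha
      have h0 : ∀ b ∈ L, b = 0 := fun b hb => Nat.le_zero.1 (hL.1 b hb)
      have : (0 :: L).filter (· ≠ 0) = [] := by
        rw [List.filter_eq_nil_iff]
        intro b hb
        rcases List.mem_cons.1 hb with rfl | hb
        · simp
        · simp [h0 b hb]
      rw [this]
      rcases lt_or_ge i (0 :: L).length with hi | hi
      · rw [List.getD_eq_getElem _ _ hi]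
        have := List.getElem_mem hi
        rcases List.mem_cons.1 this with h | h
        · rw [h]; rfl
        · rw [h0 _ h]; rfl
      · rw [List.getD_eq_default _ _ hi]; rfl
    · rw [List.filter_cons_of_pos (by simpa using ha)]
      cases i with
      | zero => rfl
      | succ i => simpa only [List.getD_cons_succ] using ih hL.2 i

theorem exists_row_eq {N : ℕ} {f : Fin N → ℕ} (hf : Antitone f) (hn : ∑ i, f i = n) :
    ∃ ν : n.Partition, Multiset.card ν.parts ≤ N ∧ ∀ i : Fin N, row ν i = f i := by
  have hL : (List.ofFn f).Pairwise (· ≥ ·) := by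
    rw [List.pairwise_ofFn]
    exact fun i j h => hf h.le
  have hsum : ((List.ofFn f : List ℕ) : Multiset ℕ).sum = n := by
    rw [Multiset.sum_coe, List.sum_ofFn, hn]
  refine ⟨Nat.Partition.ofSums n (List.ofFn f : List ℕ) hsum, ?_, fun i => ?_⟩
  · calc _ ≤ Multiset.card (List.ofFn f : Multiset ℕ) :=
        Multiset.card_le_card (Multiset.filter_le (· ≠ 0) _)
      _ = N := by rw [Multiset.coe_card, List.length_ofFn]
      _ ≤ N := le_rfl
  · have : (Nat.Partition.ofSums n (List.ofFn f : List ℕ) hsum).parts.sort (· ≥ ·) =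
        (List.ofFn f).filter (· ≠ 0) := by
      have hp : ((List.ofFn f).filter (· ≠ 0)).Pairwise (· ≥ ·) := hL.filter _
      refine List.Perm.eq_of_pairwise' (Multiset.pairwise_sort _ _) hp ?_
      rw [← Multiset.coe_eq_coe, Multiset.sort_eq]
      rfl
    rw [row, this, getD_filter_of_pairwise hL, List.getD_eq_getElem _ _ (by simp)]
    simp

/-- The exponents `N - 1 - i` of the Vandermonde determinant. -/
def staircase (N : ℕ) (i : Fin N) : ℕ := N - 1 - i

theorem strictAnti_add_staircase {N : ℕ} {f : Fin N → ℕ} (hf : Antitone f) :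
    StrictAnti fun i => f i + staircase N i := by
  intro i j h
  have h1 := hf h.le
  have h2 : (i : ℕ) < j := h
  have := j.isLt
  simp only [staircase]
  omega

theorem exists_antitone_add_staircase {N : ℕ} {β : Fin N → ℕ} (hβ : StrictAnti β) :
    ∃ f : Fin N → ℕ, Antitone f ∧ β = fun i => f i + staircase N i := by
  have key : ∀ i j : Fin N, i ≤ j → β j + (j - i : ℕ) ≤ β i := by
    intro i j h
    obtain ⟨d, hd⟩ : ∃ d : ℕ, (j : ℕ) = i + d := ⟨j - i, by have : (i : ℕ) ≤ j := h; omega⟩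
    induction d generalizing j with
    | zero => have : i = j := Fin.ext (by omega); subst this; simp
    | succ d ih =>
      have hj := j.isLt
      have h1 := ih ⟨i + d, by omega⟩ (by rw [Fin.le_def]; exact Nat.le_add_right _ _) rfl
      have h2 : β j < β ⟨i + d, by omega⟩ := hβ (show (i : ℕ) + d < j by omega)
      simp only at h1
      omega
  have hle : ∀ i, staircase N i ≤ β i := by
    intro i
    have hi := i.isLt
    have := key i ⟨N - 1, by omega⟩ (by rw [Fin.le_def]; simp; omega)
    simp [staircase] at this ⊢
    omega
  refine ⟨fun i => β i - staircase N i, fun i j h => ?_, funext fun i => ?_⟩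
  · have h1 := key i j h
    have h2 : (i : ℕ) ≤ j := h
    have h3 := hle i
    have h4 := hle j
    have := j.isLt
    simp only [staircase] at *
    omega
  · have := hle i
    simp only
    omega

/-- An injective tuple is a strictly decreasing one up to a permutation of the indices: a sum over
tuples with a fixed total that only sees the injective ones is a sum over partitions and
permutations. -/
theorem sum_tuples_eq_sum_partition {M : Type*} [AddCommMonoid M] {N : ℕ} (n : ℕ)
    (G : (Fin N → ℕ) → M) (hG : ∀ β, ¬ Function.Injective β → G β = 0) :
    ∑ β ∈ Finset.piAntidiag Finset.univ (n + ∑ i, staircase N i), G β =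
      ∑ ν : n.Partition with Multiset.card ν.parts ≤ N, ∑ w : Equiv.Perm (Fin N),
        G fun i => row ν (w i) + staircase N (w i) := by
  classical
  rw [← Finset.sum_product', ← Finset.sum_filter_add_sum_filter_not _ Function.Injective,
    Finset.sum_eq_zero (s := Finset.filter (fun β => ¬ Function.Injective β) _)
      fun β hβ => hG β (Finset.mem_filter.1 hβ).2, add_zero]
  have hanti : ∀ ν : n.Partition, StrictAnti fun i : Fin N => row ν i + staircase N i :=
    fun ν => strictAnti_add_staircase fun i j h => row_antitone ν h
  symm
  refine Finset.sum_nbij (fun p i => row p.1 (p.2 i) + staircase N (p.2 i)) ?_ ?_ ?_ fun _ _ => rfl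
  · rintro ⟨ν, w⟩ h
    simp only [Finset.mem_product, Finset.mem_filter, Finset.mem_univ, true_and, and_true,
      Finset.mem_piAntidiag, implies_true] at h ⊢
    refine ⟨?_, (hanti ν).injective.comp w.injective⟩
    rw [Equiv.sum_comp w fun i => row ν i + staircase N i, Finset.sum_add_distrib, sum_row ν h]
  · rintro ⟨ν, w⟩ h ⟨ν', w'⟩ h' heq
    simp only [Finset.coe_product, Finset.coe_filter, Finset.mem_univ, true_and, Set.mem_prod,
      Set.mem_ofPred_eq, Finset.coe_univ, Set.mem_univ, and_true] at h h'
    simp only at heq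
    have hcomp : (fun i : Fin N => row ν i + staircase N i) ∘ w =
      (fun i : Fin N => row ν' i + staircase N i) ∘ w' := heq
    have hr := congrArg Set.range hcomp
    rw [w.surjective.range_comp, w'.surjective.range_comp, (hanti ν).range_inj (hanti ν')] at hr
    have hνν : ν = ν' := by
      refine eq_of_row_eq fun i => ?_
      rcases lt_or_ge i N with hi | hi
      · simpa using congrFun hr ⟨i, hi⟩
      · rw [(row_eq_zero_iff ν i).2 (h.trans hi), (row_eq_zero_iff ν' i).2 (h'.trans hi)]
    subst hνν
    rw [Prod.mk.injEq]
    exact ⟨rfl, Equiv.ext fun i => (hanti ν).injective (congrFun hcomp i)⟩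
  · intro γ hγ
    simp only [Finset.coe_filter, Finset.mem_piAntidiag, Finset.mem_univ, implies_true, and_true,
      Set.mem_ofPred_eq] at hγ
    obtain ⟨hsum, hinj⟩ := hγ
    set w := Tuple.sort (OrderDual.toDual ∘ γ) with hw
    have hmono : Monotone ((OrderDual.toDual ∘ γ) ∘ w) := Tuple.monotone_sort _
    have hs : StrictAnti (γ ∘ w) := by
      refine Antitone.strictAnti_of_injective (fun i j h => ?_) (hinj.comp w.injective)
      exact OrderDual.toDual_le_toDual.1 (hmono h)
    obtain ⟨f, hf, hβ⟩ := exists_antitone_add_staircase hs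
    have hfn : ∑ i, f i = n := by
      have h1 : ∑ i, (γ ∘ w) i = ∑ i, γ i := Equiv.sum_comp w γ
      rw [hsum, hβ, Finset.sum_add_distrib] at h1
      omega
    obtain ⟨ν, hν, hrow⟩ := exists_row_eq hf hfn
    refine ⟨(ν, w⁻¹), ?_, funext fun i => ?_⟩
    · simpa using hν
    · have := congrFun hβ (w⁻¹ i)
      rw [Function.comp_apply, ← Equiv.Perm.mul_apply, mul_inv_cancel, Equiv.Perm.one_apply] at this
      simp only [hrow, this]

end Rows

end MonotoneHurwitz
end

noncomputable section

namespace MonotoneHurwitz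

/-! ### Schur functions as quotients of alternants -/

section Alternants

/-- The Jacobi-Trudi determinant of size `N` for the row lengths `f`. -/
def jacobiTrudi (N : ℕ) (f : ℕ → ℕ) : SymFun :=
  Matrix.det (Matrix.of fun i j : Fin N => completeInt ((f i : ℤ) - (i : ℤ) + (j : ℤ)))

theorem completeInt_of_neg {m : ℤ} (hm : m < 0) : completeInt m = 0 := if_pos hm

theorem completeInt_natCast (m : ℕ) : completeInt m = complete m := by
  rw [completeInt, if_neg (by omega), Int.toNat_natCast]

/-- Padding with empty rows adds a lower left block of h's with negative index and a unitriangular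
lower right block. The size of the determinant can therefore be matched to the number of variables.
-/
theorem schur_eq_jacobiTrudi {n N : ℕ} (ν : n.Partition) (h : Multiset.card ν.parts ≤ N) :
    schur ν = jacobiTrudi N (row ν) := by
  obtain ⟨d, rfl⟩ := Nat.exists_eq_add_of_le h
  rw [jacobiTrudi, ← Matrix.det_reindex_self finSumFinEquiv.symm]
  set L := Multiset.card ν.parts
  set M := Matrix.reindex finSumFinEquiv.symm finSumFinEquiv.symm
    (Matrix.of fun i j : Fin (L + d) => completeInt ((row ν i : ℤ) - (i : ℤ) + (j : ℤ)))
  have hrow : ∀ i : Fin d, row ν (L + i) = 0 := fun i =>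
    (row_eq_zero_iff ν _).2 (Nat.le_add_right _ _)
  have h21 : M.toBlocks₂₁ = 0 := by
    refine Matrix.ext fun i j => ?_
    simp only [M, Matrix.toBlocks₂₁, Matrix.reindex_apply, Matrix.submatrix_apply, Matrix.of_apply,
      Equiv.symm_symm, finSumFinEquiv_apply_left, finSumFinEquiv_apply_right, Fin.val_castAdd,
      Fin.val_natAdd, Matrix.zero_apply, hrow]
    refine completeInt_of_neg ?_
    have := j.isLt
    push_cast
    omega
  have h11 : M.toBlocks₁₁.det = schur ν := rfl
  have h22 : M.toBlocks₂₂.det = 1 := by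
    rw [Matrix.det_of_isUpperTriangular]
    · refine Finset.prod_eq_one fun i _ => ?_
      simp only [M, Matrix.toBlocks₂₂, Matrix.reindex_apply, Matrix.submatrix_apply,
        Matrix.of_apply, Equiv.symm_symm, finSumFinEquiv_apply_right, Fin.val_natAdd, hrow]
      rw [show ((0 : ℕ) : ℤ) - ((L + i : ℕ) : ℤ) + ((L + i : ℕ) : ℤ) = (0 : ℕ) by ring,
        completeInt_natCast, complete_zero]
    · intro i j hij
      simp only [M, Matrix.toBlocks₂₂, Matrix.reindex_apply, Matrix.submatrix_apply,
        Matrix.of_apply, Equiv.symm_symm, finSumFinEquiv_apply_right, Fin.val_natAdd, hrow]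
      have hij' : (j : ℕ) < i := hij
      exact completeInt_of_neg (by push_cast; omega)
  rw [← Matrix.fromBlocks_toBlocks M, h21, Matrix.det_fromBlocks_zero₂₁, h11, h22, mul_one]

variable {S : Type*} [CommRing S]

/-- The alternant `det (x_j ^ β_i)`. -/
def alternant {N : ℕ} (x : Fin N → S) (β : Fin N → ℕ) : S :=
  Matrix.det (Matrix.of fun i j : Fin N => x j ^ β i)

theorem alternant_eq_sum {N : ℕ} (x : Fin N → S) (β : Fin N → ℕ) :
    alternant x β = ∑ w : Equiv.Perm (Fin N), ((Equiv.Perm.sign w : ℤ) : S) * ∏ i, x i ^ β (w i) := by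
  rw [alternant, Matrix.det_apply']
  rfl

theorem alternant_staircase {N : ℕ} (x : Fin N → S) : alternant x (staircase N) =
    ((Equiv.Perm.sign (Fin.revPerm (n := N)) : ℤ) : S) * (Matrix.vandermonde x).det := by
  rw [← Matrix.det_transpose (Matrix.vandermonde x), ← Matrix.det_permute, alternant]
  congr 1
  ext i j
  simp [Matrix.vandermonde, staircase, Fin.val_rev]
  congr 1
  omega

theorem alternant_ne_zero [IsDomain S] {N : ℕ} {x : Fin N → S} (hx : Function.Injective x) :
    alternant x (staircase N) ≠ 0 := by
  rw [alternant_staircase]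
  refine mul_ne_zero ?_ (Matrix.det_vandermonde_ne_zero_iff.2 hx)
  rcases Int.units_eq_one_or (Equiv.Perm.sign (Fin.revPerm (n := N))) with h | h <;> simp [h]

/-- The product of the `1 - x_k T` over `k ∈ s`. -/
def oneSubProd {N : ℕ} (x : Fin N → S) (s : Finset (Fin N)) : Polynomial S :=
  ∏ k ∈ s, (1 - Polynomial.C (x k) * Polynomial.X)

theorem natDegree_oneSubProd_le {N : ℕ} (x : Fin N → S) (s : Finset (Fin N)) :
    (oneSubProd x s).natDegree ≤ s.card := by
  refine (Polynomial.natDegree_prod_le _ _).trans ?_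
  refine (Finset.sum_le_card_nsmul _ _ 1 fun k _ => ?_).trans (by simp)
  refine (Polynomial.natDegree_sub_le _ _).trans ?_
  rw [Polynomial.natDegree_one, Nat.zero_max]
  exact (Polynomial.natDegree_C_mul_le _ _).trans Polynomial.natDegree_X_le

variable [Algebra ℂ S]

/-- H(T) is the product of the 1/(1 - x_i T), and the polynomial cancels the factors with index in
`s`. Leaving one factor gives the bialternant formula; leaving none gives the vanishing of Schur
functions with too many rows. -/
theorem completeSeries_mul_oneSubProd {N : ℕ} (x : Fin N → S) (s : Finset (Fin N)) :
    completeSeries (fun k => ∑ i, x i ^ k) * (oneSubProd x s : PowerSeries S) =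
      completeSeries (fun k => ∑ i ∈ sᶜ, x i ^ k) := by
  have h1 : (fun k => ∑ i, x i ^ k) = fun k => ∑ i ∈ sᶜ, x i ^ k + ∑ i ∈ s, x i ^ k := by
    funext k; rw [Finset.sum_compl_add_sum]
  have h2 : completeSeries (fun k => ∑ i ∈ s, x i ^ k) * (oneSubProd x s : PowerSeries S) = 1 := by
    rw [completeSeries_sum s fun i k => x i ^ k, oneSubProd,
      ← Polynomial.coeToPowerSeries.ringHom_apply, map_prod, ← Finset.prod_mul_distrib]
    refine Finset.prod_eq_one fun i _ => ?_
    rw [completeSeries_pow]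
    ext m
    rw [Polynomial.coeToPowerSeries.ringHom_apply, Polynomial.coe_sub, Polynomial.coe_mul, Polynomial.coe_one, Polynomial.coe_C,
      Polynomial.coe_X, mul_sub, mul_one, map_sub, ← mul_assoc, mul_comm _ (PowerSeries.C (x i)),
      mul_assoc]
    cases m with
    | zero => simp
    | succ m =>
      rw [PowerSeries.coeff_C_mul, PowerSeries.coeff_succ_mul_X]
      simp [pow_succ, mul_comm, PowerSeries.coeff_one]
  rw [h1, completeSeries_add, mul_assoc, h2, mul_one]

/-- A row of a Jacobi-Trudi matrix times the reversed coefficient vector of p is one coefficient of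
H(T) p(T). Both sides are truncations of the same sum, whose extra terms vanish by a negative index
of h or by the degree of p. -/
theorem sum_completeInt_mul_coeff {N : ℕ} (x : Fin N → S) {p : Polynomial S} {L : ℕ}
    (hp : p.natDegree < L) (m : ℕ) :
    ∑ l : Fin L, specVars x (completeInt ((m : ℤ) - (L - 1 : ℕ) + (l : ℤ))) *
        p.coeff (L - 1 - l) =
      PowerSeries.coeff m (completeSeries (fun k => ∑ i, x i ^ k) * (p : PowerSeries S)) := by
  set F : ℕ → S := fun k => specVars x (completeInt ((m : ℤ) - k)) * p.coeff k with hF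
  have hF1 : ∀ k, m < k → F k = 0 := fun k hk => by
    simp only [hF]
    rw [completeInt_of_neg (by omega), map_zero, zero_mul]
  have hF2 : ∀ k, L ≤ k → F k = 0 := fun k hk => by
    simp only [hF]
    rw [Polynomial.coeff_eq_zero_of_natDegree_lt (hp.trans_le hk), mul_zero]
  have h1 : PowerSeries.coeff m (completeSeries (fun k => ∑ i, x i ^ k) * (p : PowerSeries S)) =
      ∑ k ∈ Finset.range (m + 1), F k := by
    rw [mul_comm, PowerSeries.coeff_mul, Finset.Nat.sum_antidiagonal_eq_sum_range_succ_mk]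
    refine Finset.sum_congr rfl fun k hk => ?_
    have hk' := Finset.mem_range.1 hk
    simp only [hF, coeff_completeSeries, Polynomial.coeff_coe]
    rw [mul_comm, ← completeInt_natCast]
    congr 3
    omega
  have h2 : ∑ l : Fin L, specVars x (completeInt ((m : ℤ) - (L - 1 : ℕ) + (l : ℤ))) *
      p.coeff (L - 1 - l) = ∑ k ∈ Finset.range L, F k := by
    rw [← Finset.sum_range_reflect, ← Fin.sum_univ_eq_sum_range fun k => F (L - 1 - k)]
    refine Finset.sum_congr rfl fun l _ => ?_
    have := l.isLt
    simp only [hF]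
    congr 3
    omega
  rw [h1, h2]
  have h3 : ∀ K, K ≤ m + 1 + L → (∀ k, K ≤ k → F k = 0) →
      ∑ k ∈ Finset.range K, F k = ∑ k ∈ Finset.range (m + 1 + L), F k := fun K hK h =>
    Finset.sum_subset (Finset.range_mono hK) fun k _ hk => h k (by simpa using hk)
  rw [h3 L (by omega) hF2, h3 (m + 1) (by omega) fun k hk => hF1 k hk]

/-- The bialternant formula. -/
theorem specVars_jacobiTrudi_mul {N : ℕ} (x : Fin N → S) (f : ℕ → ℕ) :
    specVars x (jacobiTrudi N f) * alternant x (staircase N) =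
      alternant x fun i => f i + staircase N i := by
  -- Column j holds the coefficients of ∏_{k ≠ j} (1 - x_k T). The Jacobi-Trudi matrix times E
  -- therefore has entries x_j^{f_i + δ_i}.
  set E : Matrix (Fin N) (Fin N) S := Matrix.of fun l j =>
    (oneSubProd x (Finset.univ.erase j)).coeff (N - 1 - l) with hE
  have key : ∀ f : ℕ → ℕ, specVars x (jacobiTrudi N f) * E.det =
      alternant x fun i => f i + staircase N i := by
    intro f
    rw [jacobiTrudi, AlgHom.map_det, ← Matrix.det_mul, alternant]
    congr 1
    ext i j
    have hN : 0 < N := i.pos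
    have hi := i.isLt
    simp only [Matrix.mul_apply, hE, Matrix.of_apply, AlgHom.mapMatrix_apply, Matrix.map_apply]
    have h1 := sum_completeInt_mul_coeff x (p := oneSubProd x (Finset.univ.erase j)) (L := N)
      ((natDegree_oneSubProd_le _ _).trans_lt (by simp; omega)) (f i + staircase N i)
    rw [completeSeries_mul_oneSubProd] at h1
    have h2 : (Finset.univ.erase j)ᶜ = {j} := by ext k; simp
    rw [h2] at h1
    simp only [Finset.sum_singleton, completeSeries_pow, PowerSeries.coeff_mk] at h1
    rw [← h1]
    refine Finset.sum_congr rfl fun l _ => ?_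
    congr 4
    simp only [staircase]
    omega
  -- The empty diagram has Jacobi-Trudi determinant 1, which identifies det E with the Vandermonde
  -- alternant.
  have h0 := key fun _ => 0
  have h1 : jacobiTrudi N (fun _ => 0) = 1 := by
    rw [jacobiTrudi, Matrix.det_of_isUpperTriangular]
    · refine Finset.prod_eq_one fun i _ => ?_
      rw [Matrix.of_apply, show ((0 : ℕ) : ℤ) - (i : ℤ) + (i : ℤ) = (0 : ℕ) by ring,
        completeInt_natCast, complete_zero]
    · intro i j hij
      have hij' : (j : ℕ) < i := hij
      exact completeInt_of_neg (by push_cast; omega)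
  rw [h1, map_one, one_mul] at h0
  simp only [zero_add] at h0
  rw [← key f, h0]

theorem specVars_schur_mul {n N : ℕ} (ν : n.Partition) (h : Multiset.card ν.parts ≤ N)
    (x : Fin N → S) : specVars x (schur ν) * alternant x (staircase N) =
      alternant x fun i => row ν i + staircase N i := by
  rw [schur_eq_jacobiTrudi ν h, specVars_jacobiTrudi_mul]

/-- The coefficients of ∏ (1 - x_k T) form a nonzero vector, since the constant term is 1. The
matrix kills it because H(T) ∏ (1 - x_k T) = 1 has no coefficient in the positive degrees ν_i + L -
1 - i. -/
theorem specVars_schur_eq_zero {n N : ℕ} (ν : n.Partition) (h : N < Multiset.card ν.parts)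
    (x : Fin N → ℂ) : specVars x (schur ν) = 0 := by
  set L := Multiset.card ν.parts
  rw [schur, AlgHom.map_det, ← Matrix.exists_mulVec_eq_zero_iff]
  refine ⟨fun l => (oneSubProd x Finset.univ).coeff (L - 1 - l), fun h0 => ?_, ?_⟩
  · have := congrFun h0 ⟨L - 1, by omega⟩
    simp [Polynomial.coeff_zero_eq_eval_zero, oneSubProd, Polynomial.eval_prod] at this
  · funext i
    have hi := i.isLt
    have hpos : row ν i ≠ 0 := by rw [Ne, row_eq_zero_iff]; omega
    have h1 := sum_completeInt_mul_coeff x (p := oneSubProd x Finset.univ) (L := L)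
      ((natDegree_oneSubProd_le _ _).trans_lt (by simpa using h)) (row ν i + (L - 1 - i))
    rw [completeSeries_mul_oneSubProd] at h1
    simp only [Finset.compl_univ, Finset.sum_empty, completeSeries_zero, PowerSeries.coeff_one] at h1
    rw [if_neg (by omega)] at h1
    rw [Pi.zero_apply, ← h1, Matrix.mulVec, dotProduct]
    refine Finset.sum_congr rfl fun l _ => ?_
    simp only [AlgHom.mapMatrix_apply, Matrix.map_apply, Matrix.of_apply]
    congr 3
    omega

end Alternants

end MonotoneHurwitz
end

noncomputable section

namespace MonotoneHurwitz

/-! ### The Cauchy identity -/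

section Cauchy

variable {S : Type*} [CommRing S] [Algebra ℂ S]

theorem spec_mul_sum_complete {N : ℕ} (t : ℕ → S) (b : Fin N → S) (n : ℕ) :
    spec (fun k => t k * ∑ i, b i ^ k) (complete n) =
      ∑ α ∈ Finset.piAntidiag (Finset.univ : Finset (Fin N)) n,
        ∏ i, (spec t (complete (α i)) * b i ^ α i) := by
  rw [← coeff_completeSeries]
  have h : (fun k => t k * ∑ i, b i ^ k) = fun k => ∑ i, t k * b i ^ k := by
    funext k; rw [Finset.mul_sum]
  rw [h, completeSeries_sum Finset.univ fun i k => t k * b i ^ k, PowerSeries.coeff_prod]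
  simp only [coeff_completeSeries, spec_scale_complete]
  refine Finset.sum_nbij (fun l i => l i) ?_ ?_ ?_ ?_
  · intro l hl
    rw [Finset.mem_finsuppAntidiag] at hl
    rw [Finset.mem_piAntidiag]
    exact ⟨hl.1, fun i _ => Finset.mem_univ i⟩
  · intro l _ l' _ h
    exact Finsupp.ext fun i => congrFun h i
  · intro α hα
    rw [Finset.mem_coe, Finset.mem_piAntidiag] at hα
    refine ⟨Finsupp.equivFunOnFinite.symm α, ?_, rfl⟩
    rw [Finset.mem_coe, Finset.mem_finsuppAntidiag]
    exact ⟨hα.1, Finset.subset_univ _⟩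
  · intro l _
    exact Finset.prod_congr rfl fun i _ => mul_comm _ _

/-- The alternant is expanded over w and the exponents are collected as γ = α + wδ; for fixed γ the
sum over w is a determinant of h's. It alternates in γ, so only injective γ count, and sorting them
produces Jacobi-Trudi determinants times alternants. -/
theorem spec_mul_complete_mul_alternant {N : ℕ} (t : ℕ → S) (b : Fin N → S) (n : ℕ) :
    spec (fun k => t k * ∑ i, b i ^ k) (complete n) * alternant b (staircase N) =
      ∑ ν : n.Partition with Multiset.card ν.parts ≤ N,
        spec t (schur ν) * alternant b fun i => row ν i + staircase N i := by
  set K : (Fin N → ℕ) → Matrix (Fin N) (Fin N) S := fun γ => Matrix.of fun i j =>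
    spec t (completeInt ((γ i : ℤ) - staircase N j)) with hK
  have h1 : ∀ w : Equiv.Perm (Fin N),
      ∑ α ∈ Finset.piAntidiag (Finset.univ : Finset (Fin N)) n,
        (∏ i, (spec t (complete (α i)) * b i ^ α i)) *
          (((Equiv.Perm.sign w : ℤ) : S) * ∏ i, b i ^ staircase N (w i)) =
      ∑ γ ∈ Finset.piAntidiag (Finset.univ : Finset (Fin N)) (n + ∑ i, staircase N i),
        (∏ i, b i ^ γ i) * (((Equiv.Perm.sign w : ℤ) : S) * ∏ i, K γ i (w i)) := by
    intro w
    refine Finset.sum_of_injOn (fun α i => α i + staircase N (w i)) ?_ ?_ ?_ ?_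
    · intro α _ α' _ h
      exact funext fun i => Nat.add_right_cancel (congrFun h i)
    · intro α hα
      rw [Finset.mem_coe, Finset.mem_piAntidiag] at hα ⊢
      refine ⟨?_, fun i _ => Finset.mem_univ i⟩
      rw [Finset.sum_add_distrib, hα.1, Equiv.sum_comp w (staircase N)]
    · intro γ hγ hγ'
      rw [Finset.mem_piAntidiag] at hγ
      by_cases hle : ∀ i, staircase N (w i) ≤ γ i
      · refine absurd ⟨fun i => γ i - staircase N (w i), ?_, funext fun i => ?_⟩ hγ'
        · rw [Finset.mem_coe, Finset.mem_piAntidiag]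
          refine ⟨?_, fun i _ => Finset.mem_univ i⟩
          have h1 : ∑ i, (γ i - staircase N (w i)) + ∑ i, staircase N (w i) = ∑ i, γ i := by
            rw [← Finset.sum_add_distrib]
            exact Finset.sum_congr rfl fun i _ => Nat.sub_add_cancel (hle i)
          rw [hγ.1, Equiv.sum_comp w (staircase N)] at h1
          exact Nat.add_right_cancel h1
        · exact Nat.sub_add_cancel (hle i)
      -- An exponent γ that does not dominate wδ is not of the form α + wδ, but it may be included
      -- because one of its h's has negative index.
      · push Not at hle
        obtain ⟨i, hi⟩ := hle
        rw [Finset.prod_eq_zero (Finset.mem_univ i) (i := i) (f := fun i => K γ i (w i)), mul_zero,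
          mul_zero]
        simp only [hK, Matrix.of_apply]
        rw [completeInt_of_neg (by omega), map_zero]
    · intro α _
      have : ∀ i, K (fun i => α i + staircase N (w i)) i (w i) = spec t (complete (α i)) := by
        intro i
        simp only [hK, Matrix.of_apply]
        rw [← completeInt_natCast]
        congr 2
        push_cast
        ring
      simp only [this, pow_add, Finset.prod_mul_distrib]
      ring
  have h2 : spec (fun k => t k * ∑ i, b i ^ k) (complete n) * alternant b (staircase N) =
      ∑ γ ∈ Finset.piAntidiag (Finset.univ : Finset (Fin N)) (n + ∑ i, staircase N i),
        (∏ i, b i ^ γ i) * (K γ).det := by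
    rw [spec_mul_sum_complete, alternant_eq_sum, Finset.sum_mul_sum, Finset.sum_comm,
      Finset.sum_congr rfl fun w _ => h1 w, Finset.sum_comm]
    refine Finset.sum_congr rfl fun γ _ => ?_
    rw [← Finset.mul_sum, ← Matrix.det_transpose (K γ), Matrix.det_apply']
    rfl
  have hperm : ∀ (γ : Fin N → ℕ) (w : Equiv.Perm (Fin N)),
      (K fun i => γ (w i)).det = ((Equiv.Perm.sign w : ℤ) : S) * (K γ).det := fun γ w => by
    rw [← Matrix.det_permute]; rfl
  rw [h2, sum_tuples_eq_sum_partition n fun γ => (∏ i, b i ^ γ i) * (K γ).det]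
  · refine Finset.sum_congr rfl fun ν hν => ?_
    have hdet : (K fun i : Fin N => row ν i + staircase N i).det = spec t (schur ν) := by
      rw [schur_eq_jacobiTrudi ν (Finset.mem_filter.1 hν).2, jacobiTrudi, AlgHom.map_det]
      congr 1
      ext i j
      have hi := i.isLt
      have hj := j.isLt
      simp only [hK, Matrix.of_apply, AlgHom.mapMatrix_apply, Matrix.map_apply, staircase]
      congr 2
      omega
    rw [alternant_eq_sum, Finset.mul_sum]
    refine Finset.sum_congr rfl fun w _ => ?_
    rw [hperm (fun i => row ν i + staircase N i) w, hdet]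
    ring
  · intro γ hγ
    simp only [Function.Injective, not_forall] at hγ
    obtain ⟨i, j, hij, hne⟩ := hγ
    have : (K γ).det = 0 := Matrix.det_zero_of_row_eq hne (by funext k; simp [hK, hij])
    simp only [this, mul_zero]

/-- The Cauchy identity, the second alphabet having `N` variables. -/
theorem spec_mul_complete {N : ℕ} (t : ℕ → ℂ) (b : Fin N → ℂ) (n : ℕ) :
    spec (fun k => t k * ∑ i, b i ^ k) (complete n) =
      ∑ ν : n.Partition with Multiset.card ν.parts ≤ N,
        spec t (schur ν) * specVars b (schur ν) := by
  -- The identity is proved for indeterminates, where the alternant can be cancelled, and then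
  -- specialized to `b`, whose entries may coincide.
  have h := spec_mul_complete_mul_alternant (fun k => algebraMap ℂ (MvPolynomial (Fin N) ℂ) (t k))
    (MvPolynomial.X : Fin N → MvPolynomial (Fin N) ℂ) n
  have h1 : ∀ ν ∈ Finset.univ.filter fun ν : n.Partition => Multiset.card ν.parts ≤ N,
      spec (fun k => algebraMap ℂ (MvPolynomial (Fin N) ℂ) (t k)) (schur ν) *
        alternant MvPolynomial.X (fun i => row ν i + staircase N i) =
      spec (fun k => algebraMap ℂ (MvPolynomial (Fin N) ℂ) (t k)) (schur ν) *
        specVars (MvPolynomial.X : Fin N → MvPolynomial (Fin N) ℂ) (schur ν) *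
          alternant MvPolynomial.X (staircase N) := fun ν hν => by
    rw [mul_assoc, specVars_schur_mul ν (Finset.mem_filter.1 hν).2]
  rw [Finset.sum_congr rfl h1, ← Finset.sum_mul] at h
  have h2 := mul_right_cancel₀ (alternant_ne_zero (MvPolynomial.X_injective)) h
  have h3 := congrArg (MvPolynomial.aeval b) h2
  simp only [map_sum, map_mul, map_spec, map_pow, MvPolynomial.aeval_X, AlgHom.commutes] at h3
  exact h3

theorem DependsOn.mono {N N' : ℕ} (h : N ≤ N') {f : SymFun} (hf : DependsOn N f) :
    DependsOn N' f := fun t t' htt => hf t t' fun k hk hkN => htt k hk (hkN.trans h)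

theorem exists_dependsOn (f : SymFun) : ∃ N, DependsOn N f := by
  refine ⟨f.vars.sup fun k => (k : ℕ), fun t t' h => ?_⟩
  refine MvPolynomial.eval₂Hom_congr' rfl (fun i hi _ => ?_) rfl
  exact h i i.pos (Finset.le_sup (f := fun k : ℕ+ => (k : ℕ)) hi)

theorem exists_dependsOn_forall {ι : Type*} (s : Finset ι) (f : ι → SymFun) :
    ∃ N, ∀ i ∈ s, DependsOn N (f i) := by
  choose N hN using fun i => exists_dependsOn (f i)
  exact ⟨s.sup N, fun i hi => (hN i).mono (Finset.le_sup hi)⟩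

/-- Since P_μ(t) P_μ(t') = P_μ(t t'), the left side takes the value of h_n at the products t_k t'_k,
to which the Cauchy identity applies. The number of variables standing for t' is chosen so large
that no partition of n is excluded and every Schur function involved sees the right power sums. -/
theorem charMap₂_sum_perm_eq_schur (n : ℕ) :
    charMap₂ n (∑ g : Equiv.Perm (Fin n), (n ! : ℂ) • (perm g ⊗ₜ[ℂ] perm g)) =
      ∑ ν : n.Partition, schur ν ⊗ₜ[ℂ] schur ν := by
  have hn : (n ! : ℂ) ≠ 0 := by exact_mod_cast Nat.factorial_ne_zero n
  refine eq_of_spec₂ fun t t' => ?_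
  obtain ⟨N₀, hN₀⟩ := exists_dependsOn_forall Finset.univ fun ν : n.Partition => schur ν
  obtain ⟨b, hb⟩ := exists_powerSums (max N₀ n) t'
  have h1 := spec_mul_complete t b n
  rw [← charMap_sum_perm, Finset.filter_true_of_mem fun ν _ =>
    (card_parts_le ν).trans (le_max_right N₀ n)] at h1
  rw [map_sum, map_sum, map_sum]
  rw [map_sum, map_sum] at h1
  convert h1 using 2 with g _ ν _
  · rw [map_smul, charMap₂, TensorProduct.map_tmul, charMap_perm, map_smul, spec₂_tmul, map_smul,
      map_smul, map_smul, spec_psumPart, spec_psumPart, spec_psumPart]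
    have : ((cyc g).parts.map fun k => t k * ∑ i, b i ^ k).prod =
        ((cyc g).parts.map t).prod * ((cyc g).parts.map t').prod := by
      rw [← Multiset.prod_map_mul]
      refine congrArg _ (Multiset.map_congr rfl fun k hk => ?_)
      rw [hb k ((cyc g).parts_pos hk) ((le_trans (Multiset.le_sum_of_mem hk)
        (cyc g).parts_sum.le).trans (le_max_right _ _))]
    rw [this]
    simp only [smul_eq_mul]
    field_simp
  · rw [spec₂_tmul]
    congr 1
    exact (hN₀ ν (Finset.mem_univ _)).mono (le_max_left _ _) _ _ fun k hk hkN => (hb k hk hkN).symm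

end Cauchy

end MonotoneHurwitz
end

noncomputable section

namespace MonotoneHurwitz

/-! ### The Casimir element on words -/

section Words

variable {ι R A : Type*} [Fintype ι] [DecidableEq ι] [CommRing R] [Fintype A] [DecidableEq A]

variable (R A) in
/-- The action of the matrix unit `E_{ij}` on the tensor power indexed by `A`. -/
def wordUnit (i j : ι) : Matrix (A → ι) (A → ι) R :=
  Matrix.of fun w w' => ∑ a, if w a = i ∧ w' = Function.update w a j then 1 else 0

variable (ι R) in
/-- The action of a permutation on a tensor power. -/
def wordPerm (g : Equiv.Perm A) : Matrix (A → ι) (A → ι) R :=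
  Matrix.of fun w w' => if w' = w ∘ g then 1 else 0

variable (A) in
/-- The action of a diagonal matrix on a tensor power. -/
def wordDiag (x : ι → R) : Matrix (A → ι) (A → ι) R := Matrix.diagonal fun w => ∏ a, x (w a)

theorem wordUnit_mul_apply (i j : ι) (M : Matrix (A → ι) (A → ι) R) (w w' : A → ι) :
    (wordUnit R A i j * M) w w' = ∑ a, if w a = i then M (Function.update w a j) w' else 0 := by
  simp only [Matrix.mul_apply, wordUnit, Matrix.of_apply, Finset.sum_mul]
  rw [Finset.sum_comm]
  refine Finset.sum_congr rfl fun a _ => ?_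
  rw [Finset.sum_eq_single (Function.update w a j)]
  · by_cases h : w a = i <;> simp [h]
  · intro v _ hv
    simp [hv]
  · simp

/-- Both units may act at the same position, which restores the word, or at positions a ≠ b carrying
i and j, which exchanges these letters. The second case is how transpositions arise from the Casimir
element. -/
theorem wordUnit_mul_wordUnit_mul_apply (i j : ι) (M : Matrix (A → ι) (A → ι) R) (w w' : A → ι) :
    (wordUnit R A i j * (wordUnit R A j i * M)) w w' =
      (∑ a, if w a = i then M w w' else 0) +
        ∑ a, ∑ b, if a ≠ b ∧ w a = i ∧ w b = j then M (w ∘ Equiv.swap a b) w' else 0 := by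
  rw [wordUnit_mul_apply, ← Finset.sum_add_distrib]
  refine Finset.sum_congr rfl fun a _ => ?_
  by_cases ha : w a = i
  · rw [if_pos ha, if_pos ha, wordUnit_mul_apply, ← Finset.add_sum_erase _ _ (Finset.mem_univ a),
      ← Finset.sum_erase (s := Finset.univ) (a := a) (f := fun b => if a ≠ b ∧ w a = i ∧ w b = j then
        M (w ∘ Equiv.swap a b) w' else 0) (by simp)]
    congr 1
    · rw [Function.update_self, if_pos rfl, Function.update_idem, ← ha, Function.update_eq_self]
    · refine Finset.sum_congr rfl fun b hb => ?_
      have hab : b ≠ a := Finset.ne_of_mem_erase hb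
      rw [Function.update_of_ne hab]
      by_cases hbj : w b = j
      · rw [if_pos hbj, if_pos ⟨hab.symm, ha, hbj⟩, ← ha, ← hbj, Equiv.comp_swap_eq_update,
          Function.update_comm hab]
      · rw [if_neg hbj, if_neg fun h => hbj h.2.2]
  · rw [if_neg ha, if_neg ha, zero_add]
    exact (Finset.sum_eq_zero fun b _ => if_neg fun h => ha h.2.1).symm

theorem wordUnit_self_mul_apply (i : ι) (M : Matrix (A → ι) (A → ι) R) (w w' : A → ι) :
    (wordUnit R A i i * M) w w' = (∑ a, if w a = i then 1 else 0) * M w w' := by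
  rw [wordUnit_mul_apply, Finset.sum_mul]
  refine Finset.sum_congr rfl fun a _ => ?_
  by_cases ha : w a = i
  · rw [if_pos ha, if_pos ha, one_mul, ← ha, Function.update_eq_self]
  · rw [if_neg ha, if_neg ha, zero_mul]

/-- The relation [E_ij, E_ji] = E_ii - E_jj of gl_N: the exchange terms are symmetric in i and j and
drop out. -/
theorem wordUnit_commutator (i j : ι) (M : Matrix (A → ι) (A → ι) R) :
    wordUnit R A i j * (wordUnit R A j i * M) - wordUnit R A j i * (wordUnit R A i j * M) =
      wordUnit R A i i * M - wordUnit R A j j * M := by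
  ext w w'
  rw [Matrix.sub_apply, Matrix.sub_apply, wordUnit_mul_wordUnit_mul_apply,
    wordUnit_mul_wordUnit_mul_apply, wordUnit_self_mul_apply, wordUnit_self_mul_apply,
    Finset.sum_comm (f := fun a b => if a ≠ b ∧ w a = j ∧ w b = i then _ else _)]
  have : ∀ a b : A, (if b ≠ a ∧ w b = j ∧ w a = i then M (w ∘ Equiv.swap b a) w' else 0) =
      if a ≠ b ∧ w a = i ∧ w b = j then M (w ∘ Equiv.swap a b) w' else 0 := fun a b => by
    rw [Equiv.swap_comm]
    exact if_congr ⟨fun h => ⟨h.1.symm, h.2.2, h.2.1⟩, fun h => ⟨h.1.symm, h.2.2, h.2.1⟩⟩ rfl rfl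
  simp only [this, Finset.sum_mul, ite_mul, one_mul, zero_mul]
  ring

theorem wordUnit_mul_wordPerm (i j : ι) (g : Equiv.Perm A) :
    wordUnit R A i j * wordPerm ι R g = (wordPerm ι R g * wordUnit R A i j : Matrix (A → ι) (A → ι) R) := by
  ext w w'
  rw [wordUnit_mul_apply, Matrix.mul_apply, Finset.sum_eq_single (w ∘ g)]
  · simp only [wordPerm, wordUnit, Matrix.of_apply, if_true, one_mul]
    rw [← Equiv.sum_comp g]
    refine Finset.sum_congr rfl fun a _ => ?_
    have : Function.update w (g a) j ∘ g = Function.update (w ∘ g) a j := by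
      rw [Function.update_comp_equiv, Equiv.symm_apply_apply]
    rw [this, Function.comp_apply, ite_and]
  · intro v _ hv
    simp [wordPerm, hv]
  · simp

theorem wordDiag_mul_wordUnit (x : ι → R) (i j : ι) :
    x j • (wordDiag A x * wordUnit R A i j) =
      (x i • (wordUnit R A i j * wordDiag A x) : Matrix (A → ι) (A → ι) R) := by
  ext w w'
  simp only [wordDiag, Matrix.smul_apply, Matrix.diagonal_mul, Matrix.mul_diagonal, wordUnit,
    Matrix.of_apply, smul_eq_mul, Finset.mul_sum, Finset.sum_mul]
  refine Finset.sum_congr rfl fun a _ => ?_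
  by_cases h : w a = i ∧ w' = Function.update w a j
  · rw [if_pos h, mul_one, one_mul, h.2, ← Finset.mul_prod_erase _ _ (Finset.mem_univ a),
      ← Finset.mul_prod_erase _ (fun b => x (Function.update w a j b)) (Finset.mem_univ a), h.1,
      Function.update_self, Finset.prod_congr rfl fun b hb =>
        congrArg x (Function.update_of_ne (Finset.ne_of_mem_erase hb) j w)]
    ring
  · rw [if_neg h]; ring

theorem permTrace_diagonal_eq_trace (g : Equiv.Perm A) (x : ι → R) :
    permTrace g (Matrix.diagonal x) = (wordPerm ι R g * wordDiag A x : Matrix (A → ι) (A → ι) R).trace := by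
  rw [permTrace_diagonal, Matrix.trace]
  refine Finset.sum_congr rfl fun w _ => ?_
  rw [Matrix.diag_apply, wordDiag, Matrix.mul_diagonal, wordPerm, Matrix.of_apply]
  by_cases h : w = w ∘ g
  · rw [if_pos h.symm, if_pos h, one_mul]
  · rw [if_neg fun h' => h h'.symm, if_neg h, zero_mul]

/-- Moving E_ij cyclically around the trace past the diagonal operator multiplies by x_i/x_j,
whereas the commutator exchanges the order at the cost of E_ii - E_jj. The two relations together
determine the trace of E_ij E_ji. -/
theorem sub_mul_trace_wordUnit (g : Equiv.Perm A) (x : ι → R) (i j : ι) :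
    (x i - x j) * (wordUnit R A i j * (wordUnit R A j i * (wordPerm ι R g * wordDiag A x)) :
      Matrix (A → ι) (A → ι) R).trace =
    x i * ((wordUnit R A i i * (wordPerm ι R g * wordDiag A x) : Matrix (A → ι) (A → ι) R).trace -
      (wordUnit R A j j * (wordPerm ι R g * wordDiag A x) : Matrix (A → ι) (A → ι) R).trace) := by
  have h1 : x j * (wordUnit R A i j * (wordUnit R A j i * (wordPerm ι R g * wordDiag A x)) :
      Matrix (A → ι) (A → ι) R).trace =
      x i * (wordUnit R A j i * (wordUnit R A i j * (wordPerm ι R g * wordDiag A x)) :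
        Matrix (A → ι) (A → ι) R).trace := by
    rw [Matrix.trace_mul_comm, ← smul_eq_mul, ← Matrix.trace_smul, Matrix.mul_assoc,
      Matrix.mul_assoc, ← Matrix.mul_smul, ← Matrix.mul_smul, wordDiag_mul_wordUnit,
      Matrix.mul_smul, Matrix.mul_smul, ← Matrix.mul_assoc (wordPerm ι R g), ← wordUnit_mul_wordPerm,
      Matrix.trace_smul, smul_eq_mul, Matrix.mul_assoc]
  have h2 := congrArg Matrix.trace (wordUnit_commutator i j
    (wordPerm ι R g * wordDiag A x : Matrix (A → ι) (A → ι) R))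
  rw [Matrix.trace_sub, Matrix.trace_sub] at h2
  rw [← h2, sub_mul, h1]
  ring

/-- Summing over the letters i, j frees the positions: equal positions give the scalar term, and
each ordered pair a ≠ b gives one transposition. -/
theorem sum_trace_wordUnit (g : Equiv.Perm A) (x : ι → R) :
    ∑ i, ∑ j, (wordUnit R A i j * (wordUnit R A j i * (wordPerm ι R g * wordDiag A x)) :
      Matrix (A → ι) (A → ι) R).trace =
    (Fintype.card ι * Fintype.card A : R) * permTrace g (Matrix.diagonal x) +
      ∑ a, ∑ b, if a ≠ b then permTrace (Equiv.swap a b * g) (Matrix.diagonal x) else 0 := by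
  simp only [permTrace_diagonal_eq_trace, Matrix.trace, Matrix.diag_apply,
    wordUnit_mul_wordUnit_mul_apply, Finset.sum_add_distrib]
  congr 1
  · simp only [Finset.sum_const, Finset.card_univ, nsmul_eq_mul, mul_assoc]
    rw [← Finset.mul_sum, Finset.sum_comm]
    congr 1
    rw [Finset.mul_sum]
    refine Finset.sum_congr rfl fun w _ => ?_
    rw [Finset.sum_comm (s := (Finset.univ : Finset ι)) (t := (Finset.univ : Finset A))]
    simp
  · have h1 : ∀ (w : A → ι) (M : A → A → R), ∑ i, ∑ j, ∑ a, ∑ b,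
        (if a ≠ b ∧ w a = i ∧ w b = j then M a b else 0) =
        ∑ a, ∑ b, if a ≠ b then M a b else 0 := by
      intro w M
      calc _ = ∑ p : ι × ι, ∑ c : A × A,
            if c.1 ≠ c.2 ∧ w c.1 = p.1 ∧ w c.2 = p.2 then M c.1 c.2 else 0 := by
            simp only [Fintype.sum_prod_type]
        _ = ∑ a, ∑ b, ∑ i, ∑ j, if a ≠ b ∧ w a = i ∧ w b = j then M a b else 0 := by
            rw [Finset.sum_comm]
            simp only [Fintype.sum_prod_type]
        _ = _ := ?_
      refine Finset.sum_congr rfl fun a _ => Finset.sum_congr rfl fun b _ => ?_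
      by_cases hab : a ≠ b
      · simp [hab, ite_and]
      · simp [hab]
    have h2 : ∀ i j, ∑ w : A → ι, ∑ a, ∑ b, (if a ≠ b ∧ w a = i ∧ w b = j then
        (wordPerm ι R g * wordDiag A x : Matrix (A → ι) (A → ι) R) (w ∘ Equiv.swap a b) w else 0) =
        ∑ w : A → ι, ∑ a, ∑ b, (if a ≠ b ∧ w a = i ∧ w b = j then
        (wordPerm ι R (Equiv.swap a b * g) * wordDiag A x : Matrix (A → ι) (A → ι) R) w w else 0) := by
      intro i j
      refine Finset.sum_congr rfl fun w _ => Finset.sum_congr rfl fun a _ =>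
        Finset.sum_congr rfl fun b _ => ?_
      congr 1
    simp only [h2]
    rw [Finset.sum_congr rfl fun i _ => Finset.sum_comm, Finset.sum_comm,
      Finset.sum_congr rfl fun w _ => h1 w _, Finset.sum_comm]
    refine Finset.sum_congr rfl fun a _ => ?_
    rw [Finset.sum_comm]
    refine Finset.sum_congr rfl fun b _ => ?_
    split_ifs <;> simp

end Words

end MonotoneHurwitz
end

noncomputable section

namespace MonotoneHurwitz

/-! ### The Casimir element as a differential operator -/

section Casimir

variable {N : ℕ}

/-- The Euler operator `x_i ∂/∂x_i`. -/
def euler (i : Fin N) : Derivation ℂ (MvPolynomial (Fin N) ℂ) (MvPolynomial (Fin N) ℂ) :=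
  (MvPolynomial.X i : MvPolynomial (Fin N) ℂ) • MvPolynomial.pderiv i

theorem euler_X (i j : Fin N) :
    euler i (MvPolynomial.X j) = if j = i then MvPolynomial.X j else 0 := by
  rw [euler, Derivation.smul_apply, MvPolynomial.pderiv_X, smul_eq_mul]
  by_cases h : j = i
  · subst h; simp
  · rw [if_neg h, Pi.single_eq_of_ne h, mul_zero]

theorem derivation_prod {κ R : Type*} [DecidableEq κ] [CommRing R] [Algebra ℂ R]
    (D : Derivation ℂ R R)
    (s : Finset κ) (f : κ → R) : D (∏ k ∈ s, f k) = ∑ k ∈ s, (∏ j ∈ s.erase k, f j) * D (f k) := by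
  induction s using Finset.induction with
  | empty => simp
  | insert a s ha ih =>
    rw [Finset.prod_insert ha, Derivation.leibniz, ih, Finset.sum_insert ha,
      Finset.erase_insert ha, smul_eq_mul, smul_eq_mul, add_comm, Finset.mul_sum]
    congr 1
    refine Finset.sum_congr rfl fun k hk => ?_
    have hak : a ≠ k := fun h => ha (h ▸ hk)
    rw [Finset.erase_insert_of_ne hak, Finset.prod_insert
      fun h => ha (Finset.mem_of_mem_erase h), mul_assoc]

theorem euler_prod_X (i : Fin N) {κ : Type*} [Fintype κ] (w : κ → Fin N) :
    euler i (∏ a, MvPolynomial.X (w a)) =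
      (∑ a, if w a = i then 1 else 0) * ∏ a, (MvPolynomial.X (w a) : MvPolynomial (Fin N) ℂ) := by
  classical
  rw [derivation_prod, Finset.sum_mul]
  refine Finset.sum_congr rfl fun a _ => ?_
  rw [euler_X, mul_comm]
  by_cases h : w a = i
  · rw [if_pos h, if_pos h, one_mul, Finset.mul_prod_erase _ (fun a => MvPolynomial.X (w a))
      (Finset.mem_univ a)]
  · rw [if_neg h, if_neg h, zero_mul, zero_mul]

theorem euler_prod_X_pow (i : Fin N) (β : Fin N → ℕ) :
    euler i (∏ k, MvPolynomial.X k ^ β k) =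
      (β i : MvPolynomial (Fin N) ℂ) * ∏ k, MvPolynomial.X k ^ β k := by
  rw [derivation_prod, Finset.sum_eq_single i]
  · rw [Derivation.leibniz_pow, euler_X, if_pos rfl, ← Finset.mul_prod_erase _
      (fun k => (MvPolynomial.X k : MvPolynomial (Fin N) ℂ) ^ β k) (Finset.mem_univ i)]
    rcases h : β i with _ | m
    · simp
    · simp only [Nat.add_sub_cancel, nsmul_eq_mul, smul_eq_mul, pow_succ]
      ring
  · intro k _ hk
    rw [Derivation.leibniz_pow, euler_X, if_neg hk, smul_zero, smul_zero, mul_zero]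
  · simp

/-- The sum of the squares of the Euler operators. -/
def eulerSq (N : ℕ) : MvPolynomial (Fin N) ℂ →ₗ[ℂ] MvPolynomial (Fin N) ℂ :=
  ∑ i, (euler i).toLinearMap ∘ₗ (euler i).toLinearMap

theorem eulerSq_apply (f : MvPolynomial (Fin N) ℂ) : eulerSq N f = ∑ i, euler i (euler i f) := by
  simp [eulerSq]

theorem eulerSq_mul (f g : MvPolynomial (Fin N) ℂ) :
    eulerSq N (f * g) = eulerSq N f * g + 2 * ∑ i, euler i f * euler i g + f * eulerSq N g := by
  simp only [eulerSq_apply, Derivation.leibniz, map_add, smul_eq_mul, Finset.sum_mul,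
    Finset.mul_sum, ← Finset.sum_add_distrib]
  exact Finset.sum_congr rfl fun i _ => by ring

/-- Every monomial of the alternant has the exponents β in some order, so the sum of their squares
is the same for all. -/
theorem eulerSq_alternant (β : Fin N → ℕ) :
    eulerSq N (alternant MvPolynomial.X β) = (∑ i, (β i : ℂ) ^ 2) • alternant MvPolynomial.X β := by
  rw [alternant_eq_sum, map_sum, Finset.smul_sum]
  refine Finset.sum_congr rfl fun w _ => ?_
  have h1 : ∀ (z : ℤ) (f : MvPolynomial (Fin N) ℂ), (z : MvPolynomial (Fin N) ℂ) * f = (z : ℂ) • f :=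
    fun z f => by rw [MvPolynomial.smul_eq_C_mul, map_intCast]
  have h2 : ∀ (z : ℕ) (f : MvPolynomial (Fin N) ℂ), (z : MvPolynomial (Fin N) ℂ) * f = (z : ℂ) • f :=
    fun z f => by rw [MvPolynomial.smul_eq_C_mul, map_natCast]
  rw [h1, map_smul, eulerSq_apply, smul_comm]
  congr 1
  rw [← Equiv.sum_comp w fun i => (β i : ℂ) ^ 2, Finset.sum_smul]
  refine Finset.sum_congr rfl fun i _ => ?_
  rw [euler_prod_X_pow i fun k => β (w k), h2, Derivation.map_smul,
    euler_prod_X_pow i fun k => β (w k), h2, smul_smul, sq]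

/-- The Vandermonde product. -/
def vandermondeProd (N : ℕ) : MvPolynomial (Fin N) ℂ :=
  ∏ p : Fin N × Fin N with p.1 < p.2, (MvPolynomial.X p.1 - MvPolynomial.X p.2)

/-- The quotient of the Vandermonde product by `x_i - x_j`. -/
def vandermondeQuot (i j : Fin N) : MvPolynomial (Fin N) ℂ :=
  if i < j then
    ∏ p ∈ (Finset.univ.filter fun p : Fin N × Fin N => p.1 < p.2).erase (i, j),
      (MvPolynomial.X p.1 - MvPolynomial.X p.2)
  else if j < i then
    - ∏ p ∈ (Finset.univ.filter fun p : Fin N × Fin N => p.1 < p.2).erase (j, i),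
      (MvPolynomial.X p.1 - MvPolynomial.X p.2)
  else 0

theorem vandermondeQuot_comm (i j : Fin N) : vandermondeQuot j i = -vandermondeQuot i j := by
  rcases lt_trichotomy i j with h | h | h
  · rw [vandermondeQuot, vandermondeQuot, if_neg h.not_gt, if_pos h, if_pos h]
  · subst h; simp [vandermondeQuot]
  · rw [vandermondeQuot, vandermondeQuot, if_pos h, if_neg h.not_gt, if_pos h, neg_neg]

theorem sub_mul_vandermondeQuot {i j : Fin N} (h : i ≠ j) :
    (MvPolynomial.X i - MvPolynomial.X j) * vandermondeQuot i j = vandermondeProd N := by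
  have key : ∀ i j : Fin N, i < j →
      (MvPolynomial.X i - MvPolynomial.X j) * vandermondeQuot i j = vandermondeProd N := by
    intro i j h
    rw [vandermondeQuot, if_pos h, vandermondeProd]
    have hm : (i, j) ∈ Finset.univ.filter fun p : Fin N × Fin N => p.1 < p.2 :=
      Finset.mem_filter.2 ⟨Finset.mem_univ _, h⟩
    rw [← Finset.mul_prod_erase _ _ hm]
  rcases lt_or_gt_of_ne h with h | h
  · exact key i j h
  · rw [← key j i h, vandermondeQuot_comm i j]
    ring

theorem euler_vandermondeProd (i : Fin N) :
    euler i (vandermondeProd N) = ∑ j, MvPolynomial.X i * vandermondeQuot i j := by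
  rw [vandermondeProd, derivation_prod]
  have h1 : ∀ p ∈ Finset.univ.filter fun p : Fin N × Fin N => p.1 < p.2,
      (∏ p' ∈ (Finset.univ.filter fun p : Fin N × Fin N => p.1 < p.2).erase p,
        (MvPolynomial.X p'.1 - MvPolynomial.X p'.2)) *
          euler i (MvPolynomial.X p.1 - MvPolynomial.X p.2) =
      (if p.1 = i then MvPolynomial.X i * vandermondeQuot i p.2 else 0) +
        if p.2 = i then MvPolynomial.X i * vandermondeQuot i p.1 else 0 := by
    rintro ⟨a, b⟩ hp
    have hab : a < b := (Finset.mem_filter.1 hp).2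
    have h2 : vandermondeQuot a b =
      ∏ p' ∈ (Finset.univ.filter fun p : Fin N × Fin N => p.1 < p.2).erase (a, b),
        (MvPolynomial.X p'.1 - MvPolynomial.X p'.2) := if_pos hab
    rw [← h2, map_sub, euler_X, euler_X]
    by_cases ha : a = i
    · subst ha
      rw [if_pos rfl, if_neg hab.ne', if_pos rfl, if_neg hab.ne']
      ring
    · by_cases hb : b = i
      · subst hb
        rw [if_neg ha, if_pos rfl, if_neg ha, if_pos rfl, vandermondeQuot_comm a b]
        ring
      · rw [if_neg ha, if_neg hb, if_neg ha, if_neg hb]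
        ring
  rw [Finset.sum_congr rfl h1, Finset.sum_add_distrib, Finset.sum_filter, Finset.sum_filter,
    Fintype.sum_prod_type, Fintype.sum_prod_type_right, ← Finset.sum_add_distrib,
    Finset.sum_eq_single i]
  · rw [← Finset.sum_add_distrib]
    refine Finset.sum_congr rfl fun j _ => ?_
    simp only [if_true]
    rcases lt_trichotomy i j with h | h | h
    · rw [if_pos h, if_neg h.not_gt, add_zero]
    · subst h; simp [vandermondeQuot]
    · rw [if_pos h, if_neg h.not_gt, zero_add]
  · intro j _ hj
    simp [hj]
  · simp

theorem alternant_eq_smul_vandermondeProd (N : ℕ) : ∃ c : ℂ,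
    alternant (MvPolynomial.X : Fin N → MvPolynomial (Fin N) ℂ) (staircase N) =
      c • vandermondeProd N := by
  have h : (Matrix.vandermonde (MvPolynomial.X : Fin N → MvPolynomial (Fin N) ℂ)).det =
      ∏ p : Fin N × Fin N with p.1 < p.2, -1 * (MvPolynomial.X p.1 - MvPolynomial.X p.2) := by
    rw [Matrix.det_vandermonde, Finset.prod_filter, Fintype.prod_prod_type]
    refine Finset.prod_congr rfl fun i _ => ?_
    rw [← Finset.filter_lt_eq_Ioi, Finset.prod_filter]
    refine Finset.prod_congr rfl fun j _ => ?_
    split_ifs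
    · ring
    · rfl
  rw [Finset.prod_mul_distrib, Finset.prod_const] at h
  refine ⟨((Equiv.Perm.sign (Fin.revPerm (n := N)) : ℤ) : ℂ) *
    (-1) ^ (Finset.univ.filter fun p : Fin N × Fin N => p.1 < p.2).card, ?_⟩
  rw [alternant_staircase, h, MvPolynomial.smul_eq_C_mul, vandermondeProd]
  simp only [map_mul, map_pow, map_neg, map_one, map_intCast, mul_assoc]

/-- The transpositions act on the alternating polynomials through the Euler operators. -/
theorem eulerSq_vandermondeProd_mul {n : ℕ} (g : Equiv.Perm (Fin n)) :
    eulerSq N (vandermondeProd N * permTrace g (Matrix.diagonal MvPolynomial.X)) =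
      eulerSq N (vandermondeProd N) * permTrace g (Matrix.diagonal MvPolynomial.X) +
      vandermondeProd N * (((2 * N - 1) * n : MvPolynomial (Fin N) ℂ) *
          permTrace g (Matrix.diagonal MvPolynomial.X) +
        ∑ a, ∑ b, if a ≠ b then permTrace (Equiv.swap a b * g) (Matrix.diagonal MvPolynomial.X)
          else 0) := by
  set P := permTrace g (Matrix.diagonal (MvPolynomial.X : Fin N → MvPolynomial (Fin N) ℂ)) with hP
  set V := vandermondeProd N with hV
  set M : Matrix (Fin n → Fin N) (Fin n → Fin N) (MvPolynomial (Fin N) ℂ) :=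
    wordPerm (Fin N) (MvPolynomial (Fin N) ℂ) g * wordDiag (Fin n) MvPolynomial.X with hM
  have hdiag : ∀ w, M w w = if w = w ∘ g then ∏ a, (MvPolynomial.X (w a) : (MvPolynomial (Fin N) ℂ)) else 0 := fun w => by
    rw [hM, wordDiag, Matrix.mul_diagonal, wordPerm, Matrix.of_apply, ite_mul, one_mul, zero_mul]
  have hPsum : P = ∑ w, M w w := by rw [hP, permTrace_diagonal_eq_trace]; rfl
  have hM1 : ∀ i w, euler i (M w w) = (∑ a, if w a = i then 1 else 0) * M w w := fun i w => by
    rw [hdiag]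
    split_ifs
    · exact euler_prod_X i w
    · rw [map_zero, mul_zero]
  have hE1 : ∀ i, (wordUnit (MvPolynomial (Fin N) ℂ) (Fin n) i i * M).trace = euler i P := fun i => by
    rw [hPsum, map_sum, Matrix.trace]
    refine Finset.sum_congr rfl fun w _ => ?_
    rw [Matrix.diag_apply, wordUnit_self_mul_apply, hM1]
  have hE2 : ∀ i, (wordUnit (MvPolynomial (Fin N) ℂ) (Fin n) i i * (wordUnit (MvPolynomial (Fin N) ℂ) (Fin n) i i * M)).trace =
      euler i (euler i P) := fun i => by
    rw [hPsum, map_sum, map_sum, Matrix.trace]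
    refine Finset.sum_congr rfl fun w _ => ?_
    rw [Matrix.diag_apply, wordUnit_self_mul_apply, wordUnit_self_mul_apply, hM1,
      Derivation.leibniz, hM1, smul_eq_mul, smul_eq_mul]
    have : euler i (∑ a, if w a = i then (1 : (MvPolynomial (Fin N) ℂ)) else 0) = 0 := by
      rw [map_sum]
      refine Finset.sum_eq_zero fun a _ => ?_
      split_ifs
      · exact Derivation.map_one_eq_zero _
      · exact map_zero _
    rw [this, mul_zero, add_zero]
  have hsum : ∑ i, euler i P = (n : (MvPolynomial (Fin N) ℂ)) * P := by
    rw [hPsum, Finset.mul_sum]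
    simp only [map_sum]
    rw [Finset.sum_comm]
    refine Finset.sum_congr rfl fun w _ => ?_
    simp only [hM1]
    rw [← Finset.sum_mul, Finset.sum_comm]
    simp
  have hcas := sum_trace_wordUnit g (MvPolynomial.X : Fin N → (MvPolynomial (Fin N) ℂ))
  rw [← hM, ← hP, Fintype.card_fin, Fintype.card_fin] at hcas
  -- Multiplying by V clears the denominator x_i - x_j. In the term with `euler j P` the coefficient
  -- x_i is split as x_j + (x_i - x_j): the sum over i, j becomes twice the cross term of `eulerSq`,
  -- and the rest is (N - 1)n V P. With the N n of the Casimir sum this makes the constant (2N -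
  -- 1)n.
  have hQ : ∀ i j, V * (wordUnit (MvPolynomial (Fin N) ℂ) (Fin n) i j * (wordUnit (MvPolynomial (Fin N) ℂ) (Fin n) j i * M)).trace =
      (if i = j then V * euler i (euler i P) else 0) +
        MvPolynomial.X i * vandermondeQuot i j * euler i P +
        (MvPolynomial.X j * vandermondeQuot j i * euler j P -
          if i = j then 0 else V * euler j P) := fun i j => by
    by_cases hij : i = j
    · subst hij
      rw [hE2, if_pos rfl, if_pos rfl]
      simp [vandermondeQuot]
    · have h1 := sub_mul_trace_wordUnit g (MvPolynomial.X : Fin N → (MvPolynomial (Fin N) ℂ)) i j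
      rw [← hM, hE1, hE1] at h1
      rw [if_neg hij, if_neg hij, hV, ← sub_mul_vandermondeQuot hij, mul_right_comm, h1,
        vandermondeQuot_comm i j]
      ring
  have h1 : V * ∑ i, ∑ j, (wordUnit (MvPolynomial (Fin N) ℂ) (Fin n) i j * (wordUnit (MvPolynomial (Fin N) ℂ) (Fin n) j i * M)).trace =
      V * eulerSq N P + 2 * ∑ i, euler i V * euler i P - (N - 1 : (MvPolynomial (Fin N) ℂ)) * (V * (n * P)) := by
    have h2 : ∑ i, euler i V * euler i P =
        ∑ i, ∑ j, MvPolynomial.X i * vandermondeQuot i j * euler i P := by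
      refine Finset.sum_congr rfl fun i _ => ?_
      rw [hV, euler_vandermondeProd, Finset.sum_mul]
    have h3 : ∑ i, ∑ j, (if i = j then 0 else V * euler j P) = (N - 1 : (MvPolynomial (Fin N) ℂ)) * (V * (n * P)) := by
      have : ∀ i j : Fin N, (if i = j then 0 else V * euler j P) =
          V * euler j P - if i = j then V * euler j P else 0 := fun i j => by
        split_ifs <;> simp
      simp only [this, Finset.sum_sub_distrib, Finset.sum_ite_eq, Finset.mem_univ, if_true]
      rw [← hsum, ← Finset.mul_sum, Finset.sum_const, Finset.card_univ, Fintype.card_fin,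
        nsmul_eq_mul]
      ring
    rw [Finset.mul_sum, Finset.sum_congr rfl fun i _ => Finset.mul_sum _ _ _]
    simp only [hQ, Finset.sum_add_distrib, Finset.sum_sub_distrib, h3]
    rw [Finset.sum_comm (f := fun i j => MvPolynomial.X j * vandermondeQuot j i * euler j P), ← h2,
      eulerSq_apply, Finset.mul_sum]
    simp only [Finset.sum_ite_eq, Finset.mem_univ, if_true]
    ring
  rw [hcas] at h1
  rw [eulerSq_mul]
  linear_combination -h1

end Casimir

end MonotoneHurwitz
end

noncomputable section

namespace MonotoneHurwitz

/-! ### Schur functions are eigenvectors of the Jucys-Murphy elements -/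

section Eigenvalues

/-- The alternating polynomial in `N` variables attached to an element of the group algebra. -/
def altChar (N n : ℕ) : GroupAlg n →ₗ[ℂ] MvPolynomial (Fin N) ℂ :=
  LinearMap.mulRight ℂ (alternant MvPolynomial.X (staircase N)) ∘ₗ
    (specVars (MvPolynomial.X : Fin N → MvPolynomial (Fin N) ℂ)).toLinearMap ∘ₗ charMap n

theorem altChar_apply {N n : ℕ} (x : GroupAlg n) : altChar N n x =
    specVars MvPolynomial.X (charMap n x) * alternant MvPolynomial.X (staircase N) := rfl

theorem altChar_perm {N n : ℕ} (g : Equiv.Perm (Fin n)) : altChar N n (perm g) =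
    (n ! : ℂ)⁻¹ • (permTrace g (Matrix.diagonal MvPolynomial.X) *
      alternant MvPolynomial.X (staircase N)) := by
  rw [altChar_apply, charMap_perm, map_smul, ← specMatrix_diagonal, specMatrix_psumPart_cyc,
    smul_mul_assoc]

theorem altChar_eq_of_charMap {N n : ℕ} {x : GroupAlg n} {ν : n.Partition}
    (h : charMap n x = schur ν) (hN : Multiset.card ν.parts ≤ N) :
    altChar N n x = alternant MvPolynomial.X fun i => row ν i + staircase N i := by
  rw [altChar_apply, h, specVars_schur_mul ν hN]

/-- The alternant in indeterminates cancels, and with enough variables no symmetric function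
involved is lost. Identities in Λ can thus be checked on alternating polynomials. -/
theorem charMap_eq_of_altChar {N n : ℕ} {x : GroupAlg n} {ν : n.Partition} (hn : n ≤ N)
    (hν : DependsOn N (schur ν))
    (h : altChar N n x = alternant MvPolynomial.X fun i => row ν i + staircase N i) :
    charMap n x = schur ν := by
  refine eq_of_specVars (dependsOn_charMap hn x) hν fun a => ?_
  rw [altChar_apply, ← specVars_schur_mul ν ((card_parts_le ν).trans hn)] at h
  have h1 := congrArg (MvPolynomial.aeval a)
    (mul_right_cancel₀ (alternant_ne_zero MvPolynomial.X_injective) h)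
  simp only [map_spec, map_sum, map_pow, MvPolynomial.aeval_X] at h1
  exact h1

theorem charMap_eq_of_altChar_eq {N n : ℕ} {x y : GroupAlg n} (hn : n ≤ N)
    (h : altChar N n x = altChar N n y) : charMap n x = charMap n y := by
  refine eq_of_specVars (dependsOn_charMap hn x) (dependsOn_charMap hn y) fun a => ?_
  rw [altChar_apply, altChar_apply] at h
  have h1 := congrArg (MvPolynomial.aeval a)
    (mul_right_cancel₀ (alternant_ne_zero MvPolynomial.X_injective) h)
  simp only [map_spec, map_sum, map_pow, MvPolynomial.aeval_X] at h1
  exact h1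

/-- The sum of the Jucys-Murphy elements. -/
def jmSum (n : ℕ) : GroupAlg n := elem (jmSeq n) 1 n

theorem jmSum_eq (n : ℕ) : jmSum n = ∑ b : Fin n, ∑ a ∈ Finset.Iio b, perm (Equiv.swap a b) := by
  rw [jmSum, elem_succ_eq_sum, ← Fin.sum_univ_eq_sum_range fun i => jmSeq n i * elem (jmSeq n) 0 i]
  refine Finset.sum_congr rfl fun b _ => ?_
  rw [elem_zero_left, mul_one, jmSeq_val, jucysMurphy]

theorem sum_perm_swap (n : ℕ) :
    ∑ a : Fin n, ∑ b, (if a ≠ b then perm (Equiv.swap a b) else 0) = jmSum n + jmSum n := by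
  have h1 : ∀ a b : Fin n, (if a ≠ b then perm (Equiv.swap a b) else 0) =
      (if a < b then perm (Equiv.swap a b) else 0) +
        if b < a then perm (Equiv.swap b a) else 0 := by
    intro a b
    rcases lt_trichotomy a b with h | h | h
    · rw [if_pos h.ne, if_pos h, if_neg h.not_gt, add_zero]
    · subst h; simp
    · rw [if_pos h.ne', if_pos h, if_neg h.not_gt, zero_add, Equiv.swap_comm]
  simp only [h1, Finset.sum_add_distrib]
  have h2 : ∑ b : Fin n, ∑ a, (if a < b then perm (Equiv.swap a b) else 0) = jmSum n := by
    rw [jmSum_eq]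
    refine Finset.sum_congr rfl fun b _ => ?_
    rw [← Finset.sum_filter, Finset.filter_gt_eq_Iio]
  rw [h2, Finset.sum_comm, h2]

/-- The alternant is a scalar multiple of the Vandermonde product and has eigenvalue ∑ δ_i^2. The
factor 2 appears because the sum over ordered pairs meets each transposition twice. -/
theorem eulerSq_altChar {N n : ℕ} (x : GroupAlg n) : eulerSq N (altChar N n x) =
    (∑ i, (staircase N i : ℂ) ^ 2 + (2 * N - 1) * n) • altChar N n x +
      (2 : ℂ) • altChar N n (jmSum n * x) := by
  rw [eq_sum_perm x, Finset.mul_sum]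
  simp only [map_sum, mul_smul_comm, map_smul, Finset.smul_sum, ← Finset.sum_add_distrib]
  refine Finset.sum_congr rfl fun g _ => ?_
  rw [smul_comm _ (x.coeff g), smul_comm _ (x.coeff g), ← smul_add]
  congr 1
  obtain ⟨c, hc⟩ := alternant_eq_smul_vandermondeProd N
  set P := permTrace g (Matrix.diagonal (MvPolynomial.X : Fin N → MvPolynomial (Fin N) ℂ)) with hP
  have h1 := eulerSq_vandermondeProd_mul (N := N) g
  rw [← hP] at h1
  have h2 : eulerSq N (c • vandermondeProd N) =
      (∑ i, (staircase N i : ℂ) ^ 2) • (c • vandermondeProd N) := by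
    rw [← hc, eulerSq_alternant]
  rw [map_smul] at h2
  have h3 : (2 : ℂ) • altChar N n (jmSum n * perm g) = (n ! : ℂ)⁻¹ •
      ((∑ a, ∑ b, if a ≠ b then permTrace (Equiv.swap a b * g) (Matrix.diagonal MvPolynomial.X)
        else 0) * (c • vandermondeProd N)) := by
    rw [two_smul, ← map_add, ← add_mul, ← sum_perm_swap, Finset.sum_mul, map_sum, Finset.sum_mul,
      Finset.smul_sum]
    refine Finset.sum_congr rfl fun a _ => ?_
    rw [Finset.sum_mul, map_sum, Finset.sum_mul, Finset.smul_sum]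
    refine Finset.sum_congr rfl fun b _ => ?_
    split_ifs
    · rw [← perm_mul, altChar_perm, hc]
    · simp
  rw [h3, altChar_perm, ← hP, hc, map_smul, smul_comm _ (n ! : ℂ)⁻¹, ← smul_add]
  congr 1
  rw [mul_smul_comm, map_smul, mul_comm P, h1, smul_add, ← smul_mul_assoc, h2]
  simp only [MvPolynomial.smul_eq_C_mul, map_add, map_mul, map_sub, map_natCast, map_ofNat, map_one]
  ring

/-- The sum of the contents of a diagram with row lengths `f`. -/
def contentSum {N : ℕ} (f : Fin N → ℕ) : ℂ :=
  (∑ i, (((f i : ℂ) + staircase N i) ^ 2 - (staircase N i : ℂ) ^ 2 - (2 * N - 1) * f i)) / 2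

/-- The eigenvalue is half of ∑ ((f_i + δ_i)^2 - δ_i^2) - (2N - 1)n. The rows `f k` need not
decrease, so every term of a product by P_1 may be listed, even one whose alternant vanishes. -/
theorem altChar_jmSum_mul {N n : ℕ} {κ : Type*} [Fintype κ] {f : κ → Fin N → ℕ}
    (hf : ∀ k, ∑ i, f k i = n) {c : κ → ℂ} {x : GroupAlg n}
    (hx : altChar N n x = ∑ k, c k • alternant MvPolynomial.X fun i => f k i + staircase N i) :
    altChar N n (jmSum n * x) = ∑ k, (contentSum (f k) * c k) •
      alternant MvPolynomial.X fun i => f k i + staircase N i := by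
  have h := eulerSq_altChar (N := N) x
  rw [hx, map_sum, Finset.smul_sum] at h
  have h1 : altChar N n (jmSum n * x) = (2 : ℂ)⁻¹ • ((2 : ℂ) • altChar N n (jmSum n * x)) := by
    rw [smul_smul, inv_mul_cancel₀ two_ne_zero, one_smul]
  rw [h1, ← sub_eq_iff_eq_add'.2 h, ← Finset.sum_sub_distrib, Finset.smul_sum]
  refine Finset.sum_congr rfl fun k _ => ?_
  rw [map_smul, eulerSq_alternant, smul_smul, smul_smul, ← sub_smul, smul_smul]
  congr 1
  have h2 : (n : ℂ) = ∑ i, (f k i : ℂ) := by rw [← hf k]; push_cast; rfl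
  rw [contentSum, Finset.sum_sub_distrib, Finset.sum_sub_distrib, ← Finset.mul_sum, ← h2]
  push_cast
  ring

theorem altChar_aeval_jmSum_mul {N n : ℕ} {κ : Type*} [Fintype κ] {f : κ → Fin N → ℕ}
    (hf : ∀ k, ∑ i, f k i = n) {c : κ → ℂ} {x : GroupAlg n}
    (hx : altChar N n x = ∑ k, c k • alternant MvPolynomial.X fun i => f k i + staircase N i)
    (p : Polynomial ℂ) :
    altChar N n (Polynomial.aeval (jmSum n) p * x) = ∑ k, (p.eval (contentSum (f k)) * c k) •
      alternant MvPolynomial.X fun i => f k i + staircase N i := by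
  induction p using Polynomial.induction_on' with
  | add p q hp hq =>
    rw [map_add, add_mul, map_add, hp, hq, ← Finset.sum_add_distrib]
    refine Finset.sum_congr rfl fun k _ => ?_
    rw [Polynomial.eval_add, add_mul, add_smul]
  | monomial j a =>
    induction j with
    | zero =>
      simp only [Polynomial.monomial_zero_left, Polynomial.aeval_C, Polynomial.eval_C, mul_smul,
        ← Finset.smul_sum]
      rw [← hx, ← Algebra.smul_def, map_smul]
    | succ j ih =>
      have h1 : Polynomial.aeval (jmSum n) (Polynomial.monomial (j + 1) a) =
          jmSum n * Polynomial.aeval (jmSum n) (Polynomial.monomial j a) := by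
        rw [← Polynomial.X_mul_monomial, map_mul, Polynomial.aeval_X]
      rw [h1, mul_assoc, altChar_jmSum_mul hf ih]
      refine Finset.sum_congr rfl fun k _ => ?_
      congr 1
      simp only [Polynomial.eval_monomial, pow_succ]
      ring

theorem sum_X_mul_alternant {N : ℕ} (β : Fin N → ℕ) :
    (∑ i, MvPolynomial.X i) * alternant (MvPolynomial.X : Fin N → MvPolynomial (Fin N) ℂ) β =
      ∑ i, alternant MvPolynomial.X (Function.update β i (β i + 1)) := by
  simp only [alternant_eq_sum]
  rw [Finset.sum_comm, Finset.mul_sum]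
  refine Finset.sum_congr rfl fun w _ => ?_
  rw [← Finset.mul_sum, mul_left_comm]
  congr 1
  rw [Finset.sum_mul, ← Equiv.sum_comp w fun i => ∏ k, (MvPolynomial.X k : MvPolynomial (Fin N) ℂ) ^
    (Function.update β i (β i + 1) (w k))]
  refine Finset.sum_congr rfl fun i _ => ?_
  rw [← Finset.mul_prod_erase _ _ (Finset.mem_univ i), ← Finset.mul_prod_erase _
    (fun k => (MvPolynomial.X k : MvPolynomial (Fin N) ℂ) ^
      (Function.update β (w i) (β (w i) + 1) (w k))) (Finset.mem_univ i), Function.update_self,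
    pow_succ', mul_assoc]
  congr 2
  refine Finset.prod_congr rfl fun k hk => ?_
  rw [Function.update_of_ne]
  exact fun h => Finset.ne_of_mem_erase hk (w.injective h)

end Eigenvalues

end MonotoneHurwitz
end

noncomputable section

namespace MonotoneHurwitz

/-! ### Adding a box -/

section Embedding

variable {n : ℕ}

/-- The embedding of `S_n` into `S_{n+1}` as the stabilizer of the last point. -/
def permSucc (n : ℕ) : Equiv.Perm (Fin n) →* Equiv.Perm (Fin (n + 1)) :=
  (finSumFinEquiv.permCongrHom.toMonoidHom).comp
    ((Equiv.Perm.sumCongrHom (Fin n) (Fin 1)).comp (MonoidHom.inl _ _))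

theorem permSucc_eq (g : Equiv.Perm (Fin n)) :
    permSucc n g = finSumFinEquiv.permCongr (Equiv.Perm.sumCongr g (1 : Equiv.Perm (Fin 1))) := rfl

theorem permSucc_castSucc (g : Equiv.Perm (Fin n)) (a : Fin n) :
    permSucc n g a.castSucc = (g a).castSucc := by
  rw [permSucc_eq, Equiv.permCongr_apply]
  have : finSumFinEquiv.symm a.castSucc = (Sum.inl a : Fin n ⊕ Fin 1) := by
    rw [Equiv.symm_apply_eq]; rfl
  rw [this]; rfl

theorem permSucc_last (g : Equiv.Perm (Fin n)) : permSucc n g (Fin.last n) = Fin.last n := by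
  rw [permSucc_eq, Equiv.permCongr_apply]
  have : finSumFinEquiv.symm (Fin.last n) = (Sum.inr 0 : Fin n ⊕ Fin 1) := by
    rw [Equiv.symm_apply_eq]; rfl
  rw [this]; rfl

theorem permSucc_swap (a b : Fin n) :
    permSucc n (Equiv.swap a b) = Equiv.swap a.castSucc b.castSucc := by
  refine Equiv.ext fun k => ?_
  induction k using Fin.lastCases with
  | last =>
    rw [permSucc_last, Equiv.swap_apply_of_ne_of_ne (Fin.castSucc_lt_last a).ne'
      (Fin.castSucc_lt_last b).ne']
  | cast k =>
    rw [permSucc_castSucc]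
    exact ((Fin.castSucc_injective n).swap_apply a b k).symm

theorem permTrace_permSucc {N : ℕ} {R : Type*} [CommRing R] (g : Equiv.Perm (Fin n))
    (X : Matrix (Fin N) (Fin N) R) :
    permTrace (permSucc n g) X = permTrace g X * X.trace := by
  rw [permSucc_eq, permTrace_permCongr, permTrace_sumCongr]
  congr 1
  rw [permTrace, Matrix.trace, ← Equiv.sum_comp (Equiv.funUnique (Fin 1) (Fin N)).symm]
  simp

/-- The embedding of `ℂ[S_n]` into `ℂ[S_{n+1}]`. -/
def algSucc (n : ℕ) : GroupAlg n →ₐ[ℂ] GroupAlg (n + 1) :=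
  MonoidAlgebra.mapDomainAlgHom ℂ ℂ (permSucc n)

theorem algSucc_perm (g : Equiv.Perm (Fin n)) : algSucc n (perm g) = perm (permSucc n g) := by
  simp [algSucc]

theorem algSucc_jmSeq {b : ℕ} (hb : b < n) : algSucc n (jmSeq n b) = jmSeq (n + 1) b := by
  rw [jmSeq_of_lt hb, jmSeq_of_lt (hb.trans n.lt_succ_self), jucysMurphy, jucysMurphy, map_sum]
  have h : (Finset.Iio (⟨b, hb.trans n.lt_succ_self⟩ : Fin (n + 1))) =
      (Finset.Iio (⟨b, hb⟩ : Fin n)).map Fin.castSuccEmb := by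
    ext a
    simp only [Finset.mem_Iio, Finset.mem_map, Fin.lt_def, Fin.castSuccEmb_apply]
    exact ⟨fun h => ⟨⟨a, h.trans hb⟩, h, rfl⟩, by rintro ⟨c, hc, rfl⟩; exact hc⟩
  rw [h, Finset.sum_map]
  refine Finset.sum_congr rfl fun a _ => ?_
  rw [algSucc_perm, permSucc_swap]
  rfl

theorem algSucc_elem (l : ℕ) :
    algSucc n (elem (jmSeq n) l n) = elem (jmSeq (n + 1)) l n := by
  have h := map_elem (algSucc n : GroupAlg n →+* GroupAlg (n + 1)) (jmSeq n) l n
  exact h.trans (elem_congr (fun i hi => algSucc_jmSeq hi) l)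

/-- The extra fixed point contributes a factor P_1, and the change from n! to (n + 1)! the scalar.
Together with `sum_X_mul_alternant` this is Pieri's rule for one box. -/
theorem altChar_algSucc {N : ℕ} (x : GroupAlg n) : altChar N (n + 1) (algSucc n x) =
    ((n : ℂ) + 1)⁻¹ • ((∑ i, MvPolynomial.X i) * altChar N n x) := by
  rw [eq_sum_perm x]
  simp only [map_sum, map_smul, Finset.mul_sum, Finset.smul_sum, algSucc_perm, mul_smul_comm]
  refine Finset.sum_congr rfl fun g _ => ?_
  rw [smul_comm ((n : ℂ) + 1)⁻¹ (x.coeff g), altChar_perm, altChar_perm, permTrace_permSucc,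
    Matrix.trace_diagonal, mul_smul_comm, smul_smul ((n : ℂ) + 1)⁻¹, Nat.factorial_succ,
    Nat.cast_mul, mul_inv, Nat.cast_succ]
  congr 2
  ring

theorem charMap_algSucc_congr {x y : GroupAlg n} (h : charMap n x = charMap n y) :
    charMap (n + 1) (algSucc n x) = charMap (n + 1) (algSucc n y) := by
  refine charMap_eq_of_altChar_eq le_rfl ?_
  rw [altChar_algSucc, altChar_algSucc, altChar_apply, altChar_apply, h]

/-- Every nonempty diagram is obtained by adding a box at the end of a row of a smaller one. -/
theorem exists_removeBox (ν : (n + 1).Partition) : ∃ (u : n.Partition) (i₀ : ℕ), i₀ < n + 1 ∧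
    ∀ i, row ν i = row u i + if i = i₀ then 1 else 0 := by
  set L := Multiset.card ν.parts with hL
  have hLn : L ≤ n + 1 := card_parts_le ν
  have hpos : 0 < L := by
    rw [hL, Multiset.card_pos]
    intro h0
    have := ν.parts_sum
    rw [h0] at this
    simp at this
  have hlast : row ν (L - 1) ≠ 0 := by
    rw [Ne, row_eq_zero_iff]; omega
  have hzero : ∀ i, L ≤ i → row ν i = 0 := fun i hi => (row_eq_zero_iff ν i).2 hi
  -- The box is taken from the last nonempty row, below which nothing can break the decreasing
  -- order.
  set f : Fin (n + 1) → ℕ := fun i => row ν i - if (i : ℕ) = L - 1 then 1 else 0 with hf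
  have hanti : Antitone f := by
    intro i j hij
    have h1 : (i : ℕ) ≤ j := hij
    have h2 := row_antitone ν h1
    simp only [hf]
    by_cases hi : (i : ℕ) = L - 1
    · by_cases hj : (j : ℕ) = L - 1
      · rw [if_pos hi, if_pos hj]; omega
      · have := hzero j (by omega)
        omega
    · rw [if_neg hi]; omega
  have hrow : ∀ i : Fin (n + 1), row ν i = f i + if (i : ℕ) = L - 1 then 1 else 0 := by
    intro i
    simp only [hf]
    by_cases hi : (i : ℕ) = L - 1
    · rw [if_pos hi]; rw [hi]; omega
    · rw [if_neg hi]; omega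
  have hsum : ∑ i, f i = n := by
    have h1 := sum_row ν hLn
    rw [Finset.sum_congr rfl fun i _ => hrow i, Finset.sum_add_distrib,
      Finset.sum_eq_single (f := fun i : Fin (n + 1) => if (i : ℕ) = L - 1 then 1 else 0)
        ⟨L - 1, by omega⟩ (fun i _ hi => if_neg fun h => hi (Fin.ext h)) (by simp)] at h1
    simpa using h1
  obtain ⟨u, hu, hur⟩ := exists_row_eq hanti hsum
  refine ⟨u, L - 1, by omega, fun i => ?_⟩
  rcases lt_or_ge i (n + 1) with hi | hi
  · rw [hrow ⟨i, hi⟩, ← hur ⟨i, hi⟩]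
  · rw [hzero i (by omega), (row_eq_zero_iff u i).2 (by omega), if_neg (by omega)]

theorem mem_cells {ν : n.Partition} {c : ℕ × ℕ} : c ∈ cells ν ↔ c.2 < row ν c.1 := by
  rw [cells, Finset.mem_filter, Finset.mem_product, Finset.mem_range, Finset.mem_range]
  refine ⟨fun h => h.2, fun h => ⟨⟨?_, ?_⟩, h⟩⟩
  · by_contra h1
    have := (row_eq_zero_iff ν c.1).2 ((card_parts_le ν).trans (not_lt.1 h1))
    omega
  · refine h.trans_le ?_
    by_cases hc : c.1 < n
    · have h1 := sum_row ν (card_parts_le ν)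
      calc row ν c.1 ≤ ∑ i : Fin n, row ν i :=
            Finset.single_le_sum (f := fun i : Fin n => row ν i) (fun _ _ => Nat.zero_le _)
              (Finset.mem_univ ⟨c.1, hc⟩)
        _ = n := h1
    · rw [(row_eq_zero_iff ν c.1).2 ((card_parts_le ν).trans (not_lt.1 hc))]
      exact Nat.zero_le _

theorem cells_addBox {ν : (n + 1).Partition} {u : n.Partition} {i₀ : ℕ}
    (h : ∀ i, row ν i = row u i + if i = i₀ then 1 else 0) :
    cells ν = insert (i₀, row u i₀) (cells u) := by
  ext ⟨i, j⟩
  simp only [Finset.mem_insert, mem_cells, h, Prod.mk.injEq]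
  by_cases hi : i = i₀
  · subst hi; rw [if_pos rfl]; omega
  · rw [if_neg hi]; simp [hi]

theorem contentSum_update {N : ℕ} (f : Fin N → ℕ) (i : Fin N) :
    contentSum (Function.update f i (f i + 1)) = contentSum f + ((f i : ℂ) - i) := by
  have hN : (staircase N i : ℂ) = N - 1 - i := by
    have := i.isLt
    rw [staircase, Nat.cast_sub (by omega), Nat.cast_sub (by omega), Nat.cast_one]
  rw [contentSum, contentSum, ← Finset.add_sum_erase _ _ (Finset.mem_univ i),
    ← Finset.add_sum_erase _ (fun k => (((f k : ℂ) + staircase N k) ^ 2 - (staircase N k : ℂ) ^ 2 -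
      (2 * N - 1) * f k)) (Finset.mem_univ i), Function.update_self,
    Finset.sum_congr rfl fun k hk => by rw [Function.update_of_ne (Finset.ne_of_mem_erase hk)]]
  push_cast
  rw [hN]
  ring

end Embedding

end MonotoneHurwitz
end

noncomputable section

namespace MonotoneHurwitz

/-! ### Contents as eigenvalues of the Jucys-Murphy elements -/

section ContentEigenvalues

/-- An enumeration of the contents of a diagram. -/
def IsContentSeq {n : ℕ} (ν : n.Partition) (c : ℕ → ℂ) : Prop :=
  (cells ν).val.map (fun x => (content x : ℂ)) =
    (Finset.univ : Finset (Fin n)).val.map fun b : Fin n => c b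

theorem IsContentSeq.prod_eq {n : ℕ} {ν : n.Partition} {c : ℕ → ℂ} (h : IsContentSeq ν c)
    {M : Type*} [CommMonoid M] (F : ℂ → M) :
    ∏ x ∈ cells ν, F (content x) = ∏ b : Fin n, F (c b) := by
  have h1 := congrArg (fun s => (s.map F).prod) h
  simp only [Multiset.map_map, Function.comp_def] at h1
  exact h1

theorem jmSum_succ (n : ℕ) : jmSum (n + 1) = algSucc n (jmSum n) + jmSeq (n + 1) n := by
  rw [jmSum, jmSum, algSucc_elem, elem_succ_succ, elem_zero_left, mul_one]

/-- A preimage of a Schur function under the characteristic map is an eigenvector of the elementary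
symmetric expressions in the Jucys-Murphy elements. -/
theorem exists_eigenvector {n : ℕ} (ν : n.Partition) : ∃ c : ℕ → ℂ, IsContentSeq ν c ∧
    (∀ N, n ≤ N → contentSum (fun i : Fin N => row ν i) = elem c 1 n) ∧
    ∃ y : GroupAlg n, charMap n y = schur ν ∧
      ∀ l, charMap n (elem (jmSeq n) l n * y) = elem c l n • schur ν := by
  induction n with
  | zero =>
    have h1 : charMap 0 1 = schur ν := by
      rw [← perm_one, charMap_perm]
      have h2 : (cyc (1 : Equiv.Perm (Fin 0))).parts = 0 := Nat.Partition.partition_zero_parts _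
      have h3 : ν.parts = 0 := Nat.Partition.partition_zero_parts _
      have h4 : IsEmpty (Fin (Multiset.card ν.parts)) := by
        rw [h3]; exact inferInstanceAs (IsEmpty (Fin 0))
      rw [psumPart, h2, schur, Matrix.det_isEmpty]
      simp [psumMultiset]
    refine ⟨0, rfl, fun N _ => ?_, 1, h1, fun l => ?_⟩
    · have h0 : ∀ i, row ν i = 0 := fun i =>
        (row_eq_zero_iff ν i).2 ((card_parts_le ν).trans (Nat.zero_le _))
      simp [contentSum, h0]
    · cases l with
      | zero => simp [h1]
      | succ l => simp
  | succ n ih =>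
    obtain ⟨u, i₀, hi₀, hrow⟩ := exists_removeBox ν
    obtain ⟨c, hc, hcs, y, hy, hyl⟩ := ih u
    obtain ⟨N₀, hN₀⟩ := exists_dependsOn (schur ν)
    -- Enough variables for `schur ν` to be determined by its values and for all partitions of n + 1
    -- to fit.
    set N := max N₀ (n + 1) with hN
    have hnN : n + 1 ≤ N := le_max_right _ _
    have hdep : DependsOn N (schur ν) := hN₀.mono (le_max_left _ _)
    -- The diagram u with a box added to row k. If this is not a diagram, two exponents coincide and
    -- the alternant is zero, which does no harm.
    set f : Fin N → Fin N → ℕ := fun k => Function.update (fun i : Fin N => row u i) k (row u k + 1)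
      with hf
    set k₀ : Fin N := ⟨i₀, hi₀.trans_le hnN⟩ with hk₀
    have huN : ∑ i : Fin N, row u i = n := sum_row u ((card_parts_le u).trans (by omega))
    have hfsum : ∀ k, ∑ i, f k i = n + 1 := fun k => by
      rw [← Finset.add_sum_erase _ _ (Finset.mem_univ k)]
      rw [← Finset.add_sum_erase _ _ (Finset.mem_univ k)] at huN
      simp only [hf, Function.update_self]
      rw [Finset.sum_congr rfl fun i hi => Function.update_of_ne (Finset.ne_of_mem_erase hi) _ _]
      omega
    have hfk₀ : f k₀ = fun i : Fin N => row ν i := by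
      funext i
      simp only [hf, hrow, Function.update_apply, hk₀, Fin.ext_iff]
      by_cases hi : (i : ℕ) = i₀
      · rw [if_pos hi, if_pos hi, hi]
      · rw [if_neg hi, if_neg hi, add_zero]
    have hcsf : ∀ k, contentSum (f k) = elem c 1 n + ((row u k : ℂ) - k) := fun k => by
      rw [contentSum_update (fun i : Fin N => row u i) k, hcs N (by omega)]
    -- The numbers u_k - k strictly decrease, so the content sums separate the terms of P_1 S_u and
    -- the Lagrange polynomial in T selects ν.
    have hinj : Set.InjOn (fun k => contentSum (f k)) (Finset.univ : Finset (Fin N)) := by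
      intro k _ k' _ h
      simp only [hcsf, add_right_inj] at h
      have h1 : (row u k : ℤ) - (k : ℕ) = (row u k' : ℤ) - (k' : ℕ) := by exact_mod_cast h
      rcases lt_trichotomy (k : ℕ) k' with h2 | h2 | h2
      · have := row_antitone u h2.le; omega
      · exact Fin.ext h2
      · have := row_antitone u h2.le; omega
    set p := Lagrange.basis Finset.univ (fun k => contentSum (f k)) k₀ with hp
    have hpk : ∀ k, p.eval (contentSum (f k)) = if k = k₀ then 1 else 0 := fun k => by
      split_ifs with hk
      · subst hk; exact Lagrange.eval_basis_self hinj (Finset.mem_univ _)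
      · exact Lagrange.eval_basis_of_ne (v := fun k => contentSum (f k)) (Ne.symm hk) (Finset.mem_univ _)
    set T := jmSum (n + 1) with hT
    set Q := Polynomial.aeval T p with hQ
    have hTc : ∀ x, Commute T x := fun x => commute_elem_jmSeq 1 x
    have hQc : ∀ x, Commute Q x := fun x => by
      rw [hQ, Polynomial.aeval_eq_sum_range]
      exact Commute.sum_left _ _ _ fun i _ => ((hTc x).pow_left i).smul_left _
    set x₀ := ((n : ℂ) + 1) • algSucc n y with hx₀
    have hn1 : (n : ℂ) + 1 ≠ 0 := by exact_mod_cast Nat.succ_ne_zero n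
    have haltx₀ : altChar N (n + 1) x₀ = ∑ k, (1 : ℂ) • alternant MvPolynomial.X
        fun i => f k i + staircase N i := by
      rw [hx₀, map_smul, altChar_algSucc, smul_smul, mul_inv_cancel₀ hn1, one_smul,
        altChar_eq_of_charMap hy ((card_parts_le u).trans (by omega)), sum_X_mul_alternant]
      refine Finset.sum_congr rfl fun k _ => ?_
      rw [one_smul]
      congr 1
      funext i
      simp only [hf, Function.update_apply]
      split_ifs with hi
      · subst hi; ring
      · rfl
    have haltQ := altChar_aeval_jmSum_mul hfsum haltx₀ p
    have haltTQ := altChar_jmSum_mul hfsum haltQ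
    simp only [hpk, mul_one, mul_ite, mul_zero, ite_smul, one_smul, zero_smul, Finset.sum_ite_eq',
      Finset.mem_univ, if_true] at haltQ haltTQ
    rw [← hT, ← hQ] at haltQ haltTQ
    have hyv : charMap (n + 1) (Q * x₀) = schur ν := by
      refine charMap_eq_of_altChar hnN hdep ?_
      rw [haltQ, hfk₀]
    have hTyv : charMap (n + 1) (T * (Q * x₀)) = contentSum (f k₀) • schur ν := by
      rw [← hyv, ← map_smul]
      refine charMap_eq_of_altChar_eq hnN ?_
      rw [haltTQ, map_smul, haltQ]
    set c' : ℕ → ℂ := fun b => if b = n then (row u i₀ : ℂ) - i₀ else c b with hc'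
    have hc'c : ∀ l, elem c' l n = elem c l n := fun l =>
      elem_congr (fun i hi => if_neg hi.ne) l
    -- An eigenvalue in degree n survives the embedding into degree n + 1 and multiplication by a
    -- central element there.
    have hlift : ∀ (R w : GroupAlg (n + 1)) (w' : GroupAlg n) (a : ℂ),
        (∀ x, Commute R x) → charMap n w' = a • schur u → w = algSucc n w' →
        charMap (n + 1) (R * w) = a • charMap (n + 1) (R * algSucc n y) := by
      intro R w w' a hR hw' hw
      rw [hw, ← map_smul, ← mul_smul_comm, ← map_smul (algSucc n)]
      refine charMap_mul_eq_of_central hR (charMap_algSucc_congr ?_)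
      rw [map_smul, hy, hw']
    refine ⟨c', ?_, fun M hM => ?_, Q * x₀, hyv, fun l => ?_⟩
    · have hnot : (i₀, row u i₀) ∉ cells u := by simp [mem_cells]
      have hval : (cells ν).val = (i₀, row u i₀) ::ₘ (cells u).val := by
        rw [cells_addBox hrow, Finset.insert_val_of_notMem hnot]
      have huniv : (Finset.univ : Finset (Fin (n + 1))).val.map (fun b : Fin (n + 1) => c' b) =
          c' n ::ₘ (Finset.univ : Finset (Fin n)).val.map fun b : Fin n => c' b := by
        rw [Fin.univ_castSuccEmb, Finset.cons_val, Multiset.map_cons, Finset.map_val,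
          Multiset.map_map]
        rfl
      rw [IsContentSeq, hval, Multiset.map_cons, hc, huniv]
      congr 1
      · simp [content, hc']
      · refine Multiset.map_congr rfl fun b _ => ?_
        simp only [hc']
        rw [if_neg b.isLt.ne]
    · have h1 : (fun i : Fin M => row ν i) = Function.update (fun i : Fin M => row u i)
          ⟨i₀, hi₀.trans_le hM⟩ (row u i₀ + 1) := by
        funext i
        simp only [hrow, Function.update_apply, Fin.ext_iff]
        by_cases hi : (i : ℕ) = i₀
        · rw [if_pos hi, if_pos hi, hi]
        · rw [if_neg hi, if_neg hi, add_zero]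
      rw [h1]
      have h2 := contentSum_update (fun i : Fin M => row u i) ⟨i₀, hi₀.trans_le hM⟩
      simp only at h2
      rw [h2, hcs M (by omega), elem_succ_succ, hc'c, elem_zero_left, mul_one]
      simp [hc']
    · cases l with
      | zero => rw [elem_zero_left, elem_zero_left, one_mul, one_smul, hyv]
      | succ l =>
        -- Here e_{l+1} of n + 1 variables is split as e_{l+1} + 𝒥_{n+1} e_l, and 𝒥_{n+1} is written
        -- as T minus the embedded sum from degree n, leaving only central elements and embedded
        -- ones. The eigenvalues add up to e_{l+1}(c) + (e_1(c) + c_new) e_l(c) - e_l(c) e_1(c),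
        -- where c_new is the content of the added box.
        have h1 : elem (jmSeq (n + 1)) (l + 1) (n + 1) * (Q * x₀) = ((n : ℂ) + 1) •
            (Q * algSucc n (elem (jmSeq n) (l + 1) n * y) +
              (T * Q) * algSucc n (elem (jmSeq n) l n * y) -
              Q * algSucc n (jmSum n * (elem (jmSeq n) l n * y))) := by
          rw [← mul_assoc, ← (hQc _).eq, mul_assoc, hx₀, mul_smul_comm, mul_smul_comm,
            elem_succ_succ, ← algSucc_elem, ← algSucc_elem, (hTc Q).eq, mul_assoc, ← mul_add,
            ← mul_sub, eq_sub_of_add_eq' (jmSum_succ n).symm, ← hT]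
          simp only [map_mul]
          congr 2
          noncomm_ring
        have h2 : charMap n (jmSum n * (elem (jmSeq n) l n * y)) =
            (elem c l n * elem c 1 n) • schur u := by
          rw [jmSum, charMap_mul_eq_of_central (fun x => commute_elem_jmSeq 1 x)
            (y := elem c l n • y) (by rw [hyl, map_smul, hy]), mul_smul_comm, map_smul, hyl,
            smul_smul]
        rw [h1, map_smul, map_sub, map_add, hlift Q _ _ _ hQc (hyl (l + 1)) rfl,
          hlift (T * Q) _ _ _ (fun x => (hTc x).mul_left (hQc x)) (hyl l) rfl,
          hlift Q _ _ _ hQc h2 rfl]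
        have h3 : charMap (n + 1) (Q * algSucc n y) = ((n : ℂ) + 1)⁻¹ • schur ν := by
          rw [← hyv, hx₀, mul_smul_comm, map_smul, smul_smul, inv_mul_cancel₀ hn1, one_smul]
        have h4 : charMap (n + 1) (T * Q * algSucc n y) =
            ((n : ℂ) + 1)⁻¹ • contentSum (f k₀) • schur ν := by
          rw [← hTyv, hx₀, mul_smul_comm, mul_smul_comm, map_smul, smul_smul, inv_mul_cancel₀ hn1,
            one_smul, mul_assoc]
        rw [h3, h4, hcsf k₀, elem_succ_succ, hc'c, hc'c]
        simp only [smul_smul, ← add_smul, ← sub_smul]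
        congr 1
        have h5 : c' n = (row u k₀ : ℂ) - k₀ := by simp [hc', hk₀]
        rw [h5]
        field_simp
        ring

end ContentEigenvalues

end MonotoneHurwitz
end

noncomputable section

namespace MonotoneHurwitz

/-! ### Action of central elements on Schur functions and the expansion in Schur functions -/

section SchurExpansion

variable {n : ℕ}

/-- A chosen enumeration of the contents of a diagram. -/
def contentSeq (ν : n.Partition) : ℕ → ℂ := (exists_eigenvector ν).choose

theorem isContentSeq_contentSeq (ν : n.Partition) : IsContentSeq ν (contentSeq ν) :=
  (exists_eigenvector ν).choose_spec.1

/-- A chosen preimage of a Schur function under the characteristic map. -/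
def schurElem (ν : n.Partition) : GroupAlg n := (exists_eigenvector ν).choose_spec.2.2.choose

theorem charMap_schurElem (ν : n.Partition) : charMap n (schurElem ν) = schur ν :=
  (exists_eigenvector ν).choose_spec.2.2.choose_spec.1

theorem charMap_elem_mul {ν : n.Partition} {x : GroupAlg n} {a : ℂ}
    (hx : charMap n x = a • schur ν) (l : ℕ) :
    charMap n (elem (jmSeq n) l n * x) = (elem (contentSeq ν) l n * a) • schur ν := by
  rw [charMap_mul_eq_of_central (fun x => commute_elem_jmSeq l x) (y := a • schurElem ν)
    (by rw [hx, map_smul, charMap_schurElem]), mul_smul_comm, map_smul, schurElem,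
    (exists_eigenvector ν).choose_spec.2.2.choose_spec.2 l, smul_smul, mul_comm]
  rfl

theorem charMap_homog_mul {ν : n.Partition} {x : GroupAlg n} {a : ℂ}
    (hx : charMap n x = a • schur ν) (k : ℕ) :
    charMap n (homog (jmSeq n) k n * x) = (homog (contentSeq ν) k n * a) • schur ν := by
  induction k using Nat.strong_induction_on with
  | _ k ih =>
    cases k with
    | zero => simp [hx]
    | succ k =>
      rw [homog_succ_eq_elem (fun i _ j _ => commute_jmSeq i j),
        homog_succ_eq_elem (fun i _ j _ => Commute.all _ _), Finset.sum_mul, Finset.sum_mul,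
        map_sum, Finset.sum_smul]
      refine Finset.sum_congr rfl fun i _ => ?_
      have h1 : ((-1) ^ i * elem (jmSeq n) (i + 1) n * homog (jmSeq n) (k - i) n * x : GroupAlg n) =
          ((-1) ^ i : ℂ) • (elem (jmSeq n) (i + 1) n * (homog (jmSeq n) (k - i) n * x)) := by
        rw [Algebra.smul_def, map_pow, map_neg, map_one]
        simp only [mul_assoc]
      rw [h1, map_smul, charMap_elem_mul (ih (k - i) (by omega)), smul_smul]
      congr 1
      ring

theorem charMap_mixedElem_mul (ν : n.Partition) (k l : ℕ) :
    charMap n (mixedElem n k l * schurElem ν) =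
      (homog (contentSeq ν) k n * elem (contentSeq ν) l n) • schur ν := by
  have h1 : charMap n (schurElem ν) = (1 : ℂ) • schur ν := by rw [charMap_schurElem, one_smul]
  rw [mixedElem, mul_assoc, charMap_homog_mul (charMap_elem_mul h1 l), mul_one]

theorem coeff_contentSeries (ν : n.Partition) (k l : ℕ) :
    MvPowerSeries.coeff (expo k l) (contentSeries ν) =
      homog (contentSeq ν) k n * elem (contentSeq ν) l n := by
  rw [← coeff_prod_inv_mul_prod (fun i _ j _ => Commute.all _ _), List.prod_ofFn, List.prod_ofFn,
    contentSeries, (isContentSeq_contentSeq ν).prod_eq fun c =>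
      (1 + MvPowerSeries.C c * MvPowerSeries.X 1 : MvPowerSeries (Fin 2) ℂ) *
      (1 - MvPowerSeries.C c * MvPowerSeries.X 0)⁻¹, Finset.prod_mul_distrib, mul_comm]
  congr 2
  · refine Finset.prod_congr rfl fun b _ => ?_
    rw [mul_comm (MvPowerSeries.C _), ← MvPowerSeries.invOfUnit_eq' _ 1 (by simp)]
  · exact Finset.prod_congr rfl fun b _ => by rw [mul_comm]

/-- A linear section of ch, extended arbitrarily off its image, transports multiplication by z to Λ;
by centrality the choice of section does not matter on the image. -/
theorem exists_operator_of_central {z : GroupAlg n} (hz : ∀ y, Commute z y) :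
    ∃ D : SymFun →ₗ[ℂ] SymFun, ∀ x, D (charMap n x) = charMap n (z * x) := by
  obtain ⟨L, hL⟩ := (charMap n).rangeRestrict.exists_rightInverse_of_surjective
    (LinearMap.range_rangeRestrict _)
  obtain ⟨L', hL'⟩ := LinearMap.exists_extend L
  refine ⟨charMap n ∘ₗ LinearMap.mulLeft ℂ z ∘ₗ L', fun x => ?_⟩
  rw [LinearMap.comp_apply, LinearMap.comp_apply, LinearMap.mulLeft_apply]
  refine charMap_mul_eq_of_central hz ?_
  have h1 : L' (charMap n x) = L ((charMap n).rangeRestrict x) :=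
    LinearMap.congr_fun hL' ((charMap n).rangeRestrict x)
  have h2 := congrArg Subtype.val (LinearMap.congr_fun hL ((charMap n).rangeRestrict x))
  rw [h1]
  exact h2

/-- The operator of z is applied to the second factor of the Cauchy identity. Only the eigenvalues
on Schur functions are needed, not that these form a basis. -/
theorem charMap₂_sum_mul_eq_schur {z : GroupAlg n} (hz : ∀ y, Commute z y)
    {a : n.Partition → ℂ} (ha : ∀ ν, charMap n (z * schurElem ν) = a ν • schur ν) :
    charMap₂ n (∑ g : Equiv.Perm (Fin n), (n ! : ℂ) • (perm g ⊗ₜ[ℂ] (z * perm g))) =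
      ∑ ν : n.Partition, a ν • (schur ν ⊗ₜ[ℂ] schur ν) := by
  obtain ⟨D, hD⟩ := exists_operator_of_central hz
  have h1 := congrArg (TensorProduct.map (LinearMap.id : SymFun →ₗ[ℂ] SymFun) D)
    (charMap₂_sum_perm_eq_schur n)
  simp only [map_sum, map_smul, charMap₂, TensorProduct.map_tmul, LinearMap.id_apply, hD] at h1 ⊢
  rw [h1]
  refine Finset.sum_congr rfl fun ν _ => ?_
  rw [← charMap_schurElem ν, hD, ha, TensorProduct.tmul_smul, charMap_schurElem]

theorem charMap₂_twist_eq_schur (k l : ℕ) (q : ℂ) :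
    charMap₂ n (∑ g : Equiv.Perm (Fin n), (n ! : ℂ) •
        (perm g ⊗ₜ[ℂ] (MvPowerSeries.coeff (expo k l) (twist n q) * perm g))) =
      ∑ ν : n.Partition,
        (q ^ n * MvPowerSeries.coeff (expo k l) (contentSeries ν)) •
          (schur ν ⊗ₜ[ℂ] schur ν) := by
  refine charMap₂_sum_mul_eq_schur (fun y => ?_) fun ν => ?_
  · rw [coeff_twist]
    exact (commute_mixedElem k l y).smul_left _
  · rw [coeff_twist, smul_mul_assoc, map_smul, charMap_mixedElem_mul, smul_smul,
      coeff_contentSeries]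

end SchurExpansion

end MonotoneHurwitz
end

noncomputable section

namespace MonotoneHurwitz

/-! ### The hypergeometric coefficients -/

section Hypergeometric

variable {n N : ℕ} {α q : ℂ}

/-- The factors i + 1 - α of the rising factorial vanish only when α is a positive integer. -/
theorem rho_ne_zero (hα : ∀ m : ℕ, 0 < m → α ≠ (m : ℂ)) (hq : q ≠ 0) (j : ℤ) : rho α q j ≠ 0 := by
  unfold rho
  split_ifs
  · refine div_ne_zero (mul_ne_zero (pow_ne_zero _ hq) ?_)
      (by exact_mod_cast Nat.factorial_ne_zero _)
    induction j.toNat with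
    | zero => simp
    | succ i ih =>
      rw [ascPochhammer_succ_eval]
      refine mul_ne_zero ih fun h => hα (i + 1) i.succ_pos ?_
      push_cast
      linear_combination -h
  · exact one_ne_zero

theorem rZero_ne_zero (hα : ∀ m : ℕ, 0 < m → α ≠ (m : ℂ)) (hq : q ≠ 0) (N : ℕ) :
    rZero α q N ≠ 0 :=
  Finset.prod_ne_zero_iff.2 fun _ _ => rho_ne_zero hα hq _

theorem ratio_eq (hα : ∀ m : ℕ, 0 < m → α ≠ (m : ℂ)) (hq : q ≠ 0) {j : ℤ} (hj : 1 ≤ j) :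
    ratio α q j = q * ((j - α) / j) := by
  obtain ⟨m, rfl⟩ : ∃ m : ℕ, j = m + 1 := ⟨(j - 1).toNat, by omega⟩
  have h1 : rho α q m ≠ 0 := rho_ne_zero hα hq _
  have hm : rho α q (m : ℕ) = q ^ m * (ascPochhammer ℂ m).eval (1 - α) / (m ! : ℂ) := by
    unfold rho
    split_ifs with h
    · simp
    · obtain rfl : m = 0 := by omega
      simp
  have hm1 : rho α q ((m : ℤ) + 1) =
      q ^ (m + 1) * (ascPochhammer ℂ (m + 1)).eval (1 - α) / ((m + 1)! : ℂ) := by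
    unfold rho
    rw [if_pos hj]
    rfl
  rw [ratio, add_sub_cancel_right, div_eq_iff h1, hm, hm1, ascPochhammer_succ_eval,
    Nat.factorial_succ]
  have h2 : (m ! : ℂ) ≠ 0 := by exact_mod_cast Nat.factorial_ne_zero m
  have h3 : (m : ℂ) + 1 ≠ 0 := by exact_mod_cast Nat.succ_ne_zero m
  push_cast
  field_simp
  ring

/-- A cell of a diagram with at most N rows has row index at most N - 1. So only the ratios r_j with
j ≥ 1 occur, and no N + c vanishes. -/
theorem one_le_add_content {ν : n.Partition} (h : Multiset.card ν.parts ≤ N) {c : ℕ × ℕ}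
    (hc : c ∈ cells ν) : 1 ≤ (N : ℤ) + content c := by
  have h1 := mem_cells.1 hc
  have h2 : ¬ Multiset.card ν.parts ≤ c.1 := fun h => by
    rw [(row_eq_zero_iff ν _).2 h] at h1; omega
  unfold content
  omega

theorem card_cells (ν : n.Partition) : (cells ν).card = n := by
  have h := congrArg Multiset.card (isContentSeq_contentSeq ν)
  simpa using h

/-- The product of the `(N - α + c) / (N + c)` over the contents `c`. -/
def hookRatio (α : ℂ) (N : ℕ) (ν : n.Partition) : ℂ :=
  ∏ c ∈ cells ν, (N - α + content c) / (N + content c)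

theorem rPart_eq (hα : ∀ m : ℕ, 0 < m → α ≠ (m : ℂ)) (hq : q ≠ 0) {ν : n.Partition}
    (h : Multiset.card ν.parts ≤ N) : rPart α q N ν = rZero α q N * (q ^ n * hookRatio α N ν) := by
  rw [rPart, hookRatio]
  congr 1
  rw [Finset.prod_congr rfl fun c hc => ratio_eq hα hq (one_le_add_content h hc),
    Finset.prod_mul_distrib, Finset.prod_const, card_cells]
  congr 1
  refine Finset.prod_congr rfl fun c _ => ?_
  push_cast
  congr 1
  ring

/-- The power n spends one factor on each box, where (1 - α/N)(1 + c/(N - α))/(1 + c/N) = (N - α +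
c)/(N + c). -/
theorem pow_mul_contentProd (hα : ∀ m : ℕ, 0 < m → α ≠ (m : ℂ)) (hN : 0 < N) {ν : n.Partition}
    (h : Multiset.card ν.parts ≤ N) :
    (1 - α / N) ^ n * contentProd ν (-1 / (N : ℂ)) (1 / ((N : ℂ) - α)) = hookRatio α N ν := by
  have hN0 : (N : ℂ) ≠ 0 := by exact_mod_cast hN.ne'
  have hNα : (N : ℂ) - α ≠ 0 := fun h => hα N hN (sub_eq_zero.1 h).symm
  have hpow : (1 - α / N) ^ n = ∏ c ∈ cells ν, (1 - α / N) := by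
    rw [Finset.prod_const, card_cells]
  rw [hookRatio, contentProd, hpow, ← Finset.prod_mul_distrib]
  refine Finset.prod_congr rfl fun c hc => ?_
  have h1 : (N : ℂ) + content c ≠ 0 := by
    have := one_le_add_content h hc
    have h2 : (N : ℤ) + content c ≠ 0 := by omega
    exact_mod_cast h2
  have h3 : 1 - (content c : ℂ) * (-1 / (N : ℂ)) ≠ 0 := by
    have : 1 - (content c : ℂ) * (-1 / (N : ℂ)) = ((N : ℂ) + content c) / N := by
      field_simp
      ring
    rw [this]
    exact div_ne_zero h1 hN0
  rw [← mul_div_assoc, div_eq_div_iff h3 h1]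
  field_simp
  ring

theorem pow_mul_contentProd_eq_rPart (hα : ∀ m : ℕ, 0 < m → α ≠ (m : ℂ)) (hN : 0 < N) (hq : q ≠ 0)
    {ν : n.Partition} (h : Multiset.card ν.parts ≤ N) :
    (q * (1 - α / N)) ^ n * contentProd ν (-1 / (N : ℂ)) (1 / ((N : ℂ) - α)) =
      rPart α q N ν / rZero α q N := by
  rw [rPart_eq hα hq h, mul_div_cancel_left₀ _ (rZero_ne_zero hα hq N), mul_pow, mul_assoc,
    pow_mul_contentProd hα hN h]

end Hypergeometric

/-! ### The generating element of the cycle numbers -/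

section CycleSum

variable {n : ℕ}

/-- The number of cycles, fixed points included. -/
def numCycles (g : Equiv.Perm (Fin n)) : ℕ := Multiset.card (cyc g).parts

theorem numCycles_congr {g h : Equiv.Perm (Fin n)} (hgh : cyc g = cyc h) :
    numCycles g = numCycles h := by rw [numCycles, numCycles, hgh]

theorem permTrace_one_matrix (N : ℕ) (g : Equiv.Perm (Fin n)) :
    permTrace g (1 : Matrix (Fin N) (Fin N) ℂ) = (N : ℂ) ^ numCycles g := by
  rw [permTrace_eq_prod, numCycles]
  simp

/-- Inserting the new point into the cycle of `a` forces its letter to equal that of `a`, so no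
freedom is added. -/
theorem permTrace_swap_mul_permSucc {N : ℕ} (h : Equiv.Perm (Fin n)) (a : Fin n) :
    permTrace (Equiv.swap a.castSucc (Fin.last n) * permSucc n h)
      (1 : Matrix (Fin N) (Fin N) ℂ) = permTrace h (1 : Matrix (Fin N) (Fin N) ℂ) := by
  rw [← Matrix.diagonal_one, permTrace_diagonal, permTrace_diagonal]
  simp only [Finset.prod_const_one]
  rw [← Equiv.sum_comp (Fin.snocEquiv fun _ : Fin (n + 1) => Fin N), Fintype.sum_prod_type,
    Finset.sum_comm]
  refine Finset.sum_congr rfl fun w _ => ?_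
  have hsw : ∀ v : Fin (n + 1) → Fin N, v a.castSucc = v (Fin.last n) →
      v ∘ Equiv.swap a.castSucc (Fin.last n) = v := fun v hv => by
    rw [Equiv.comp_swap_eq_update, hv, Function.update_eq_self, ← hv, Function.update_eq_self]
  have key : ∀ x : Fin N, (Fin.snocEquiv (fun _ : Fin (n + 1) => Fin N) (x, w)) ∘
      (Equiv.swap a.castSucc (Fin.last n) * permSucc n h) =
        Fin.snocEquiv (fun _ : Fin (n + 1) => Fin N) (x, w) ↔ w a = x ∧ w ∘ h = w := by
    intro x
    set v : Fin (n + 1) → Fin N := Fin.snocEquiv (fun _ : Fin (n + 1) => Fin N) (x, w)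
    have hv1 : v (Fin.last n) = x := by simp [v]
    have hv2 : ∀ k : Fin n, v k.castSucc = w k := fun k => by simp [v]
    rw [Equiv.Perm.coe_mul, ← Function.comp_assoc]
    constructor
    · intro hv
      have hx : v a.castSucc = v (Fin.last n) := by
        have := congrFun hv (Fin.last n)
        simp only [Function.comp_apply, permSucc_last, Equiv.swap_apply_right] at this
        exact this
      rw [hsw v hx] at hv
      refine ⟨by rw [← hv2, hx, hv1], funext fun k => ?_⟩
      have := congrFun hv k.castSucc
      rwa [Function.comp_apply, permSucc_castSucc, hv2, hv2] at this
    · rintro ⟨hx, hw⟩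
      rw [hsw v (by rw [hv2, hx, hv1])]
      funext k
      induction k using Fin.lastCases with
      | last => rw [Function.comp_apply, permSucc_last]
      | cast k => rw [Function.comp_apply, permSucc_castSucc, hv2, hv2]; exact congrFun hw k
  simp only [key, ite_and]
  simp

/-- The trace of a permutation on tensors over ℂ^2 is 2^(number of cycles), from which the exponent
can be recovered. -/
theorem numCycles_permSucc (h : Equiv.Perm (Fin n)) :
    numCycles (permSucc n h) = numCycles h + 1 := by
  have h1 := permTrace_permSucc h (1 : Matrix (Fin 2) (Fin 2) ℂ)
  rw [permTrace_one_matrix, permTrace_one_matrix, Matrix.trace_one, Fintype.card_fin,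
    ← pow_succ] at h1
  exact Nat.pow_right_injective le_rfl (by exact_mod_cast h1)

theorem numCycles_swap_mul_permSucc (h : Equiv.Perm (Fin n)) (a : Fin n) :
    numCycles (Equiv.swap a.castSucc (Fin.last n) * permSucc n h) = numCycles h := by
  have h1 := permTrace_swap_mul_permSucc (N := 2) h a
  rw [permTrace_one_matrix, permTrace_one_matrix] at h1
  exact Nat.pow_right_injective le_rfl (by exact_mod_cast h1)

theorem permSucc_injective : Function.Injective (permSucc n) := fun g h hgh =>
  Equiv.ext fun k => Fin.castSucc_injective n (by
    rw [← permSucc_castSucc, ← permSucc_castSucc, hgh])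

theorem bijective_swap_mul_permSucc : Function.Bijective
    fun p : Fin (n + 1) × Equiv.Perm (Fin n) => Equiv.swap p.1 (Fin.last n) * permSucc n p.2 := by
  rw [Fintype.bijective_iff_injective_and_card]
  refine ⟨fun p p' h => ?_, ?_⟩
  · have h1 := congrFun (congrArg DFunLike.coe h) (Fin.last n)
    simp only [Equiv.Perm.mul_apply, permSucc_last, Equiv.swap_apply_right] at h1
    simp only [h1, mul_right_inj] at h
    exact Prod.ext h1 (permSucc_injective h)
  · rw [Fintype.card_prod, Fintype.card_perm, Fintype.card_perm, Fintype.card_fin, Fintype.card_fin,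
      Nat.factorial_succ]

/-- The sum of the `M ^ (number of cycles of g) g`. -/
def cycleSum (M : ℂ) (n : ℕ) : GroupAlg n := ∑ g, M ^ numCycles g • perm g

theorem commute_cycleSum (M : ℂ) (x : GroupAlg n) : Commute (cycleSum M n) x := by
  have h : cycleSum M n = ∑ μ : n.Partition, M ^ Multiset.card μ.parts • classSum μ := by
    rw [cycleSum, sum_perm_eq_sum_partition]
    refine Finset.sum_congr rfl fun μ _ => ?_
    rw [classSum, Finset.smul_sum]
    refine Finset.sum_congr rfl fun g hg => ?_
    rw [numCycles, mem_cycleClass.1 hg]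
  rw [h]
  exact Commute.sum_left _ _ _ fun μ _ => (commute_classSum μ x).smul_left _

/-- Every permutation is uniquely (a, last) times one fixing the last point: a = last adds a cycle
and gives M, any other a keeps the number of cycles and gives a term of 𝒥_{n+1}. Iterated, this is
Jucys's factorization of the sum into the M + 𝒥_b. -/
theorem cycleSum_succ (M : ℂ) : cycleSum M (n + 1) =
    (algebraMap ℂ _ M + jmSeq (n + 1) n) * algSucc n (cycleSum M n) := by
  rw [cycleSum, ← bijective_swap_mul_permSucc.sum_comp, Fintype.sum_prod_type,
    Fin.sum_univ_castSucc]
  simp only [Equiv.swap_self, numCycles_swap_mul_permSucc]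
  have h1 : ∀ h : Equiv.Perm (Fin n), (Equiv.refl (Fin (n + 1)) : Equiv.Perm (Fin (n + 1))) *
      permSucc n h = permSucc n h := fun h => one_mul _
  simp only [h1, numCycles_permSucc]
  have h2 : algSucc n (cycleSum M n) = ∑ h, M ^ numCycles h • perm (permSucc n h) := by
    rw [cycleSum, map_sum]
    simp only [map_smul, algSucc_perm]
  have h3 : jmSeq (n + 1) n = ∑ a : Fin n, perm (Equiv.swap a.castSucc (Fin.last n)) := by
    rw [jmSeq_of_lt n.lt_succ_self, jucysMurphy]
    have : Finset.Iio (⟨n, n.lt_succ_self⟩ : Fin (n + 1)) =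
        (Finset.univ : Finset (Fin n)).map Fin.castSuccEmb := by
      ext a
      simp only [Finset.mem_Iio, Finset.mem_map, Fin.lt_def, Fin.castSuccEmb_apply, Finset.mem_univ,
        true_and]
      exact ⟨fun h => ⟨⟨a, h⟩, rfl⟩, by rintro ⟨c, rfl⟩; exact c.isLt⟩
    rw [this, Finset.sum_map]
    rfl
  rw [add_mul, h2, add_comm (algebraMap ℂ (GroupAlg (n + 1)) M * _)]
  congr 1
  · rw [h3, Finset.sum_mul_sum]
    refine Finset.sum_congr rfl fun a _ => Finset.sum_congr rfl fun h _ => ?_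
    rw [mul_smul_comm, perm_mul]
  · rw [← Algebra.smul_def, Finset.smul_sum]
    refine Finset.sum_congr rfl fun h _ => ?_
    rw [smul_smul, pow_succ']

theorem elem_eq_zero {R : Type*} [Ring R] (c : ℕ → R) {l m : ℕ} (h : m < l) : elem c l m = 0 := by
  induction m generalizing l with
  | zero => obtain ⟨l, rfl⟩ := Nat.exists_eq_succ_of_ne_zero h.ne'; rfl
  | succ m ih =>
    obtain ⟨l, rfl⟩ := Nat.exists_eq_succ_of_ne_zero (Nat.ne_zero_of_lt h)
    rw [Nat.succ_eq_add_one, elem_succ_succ, ih (by omega), ih (by omega), mul_zero, add_zero]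

theorem add_mul_sum_elem {R : Type*} [Ring R] [Algebra ℂ R] (M : ℂ) (c : ℕ → R) (m : ℕ) :
    (algebraMap ℂ R M + c m) * ∑ l ∈ Finset.range (m + 1), M ^ (m - l) • elem c l m =
      ∑ l ∈ Finset.range (m + 2), M ^ (m + 1 - l) • elem c l (m + 1) := by
  have h1 : algebraMap ℂ R M * ∑ l ∈ Finset.range (m + 1), M ^ (m - l) • elem c l m =
      ∑ l ∈ Finset.range (m + 2), M ^ (m + 1 - l) • elem c l m := by
    rw [Finset.sum_range_succ _ (m + 1), elem_eq_zero c m.lt_succ_self, smul_zero, add_zero,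
      ← Algebra.smul_def, Finset.smul_sum]
    refine Finset.sum_congr rfl fun l hl => ?_
    rw [smul_smul, ← pow_succ']
    congr 2
    have := Finset.mem_range.1 hl
    omega
  rw [add_mul, h1, Finset.sum_range_succ', Finset.sum_range_succ' _ (m + 1), add_right_comm,
    Finset.mul_sum, ← Finset.sum_add_distrib]
  congr 1
  · refine Finset.sum_congr rfl fun l _ => ?_
    rw [elem_succ_succ, smul_add, mul_smul_comm]
    congr 3
    omega
  · simp

theorem cycleSum_eq (M : ℂ) (n : ℕ) :
    cycleSum M n = ∑ l ∈ Finset.range (n + 1), M ^ (n - l) • elem (jmSeq n) l n := by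
  induction n with
  | zero =>
    have h : numCycles (1 : Equiv.Perm (Fin 0)) = 0 := by
      rw [numCycles, show (cyc (1 : Equiv.Perm (Fin 0))).parts = 0 from
        Nat.Partition.partition_zero_parts _, Multiset.card_zero]
    rw [cycleSum, Fintype.sum_unique]
    simp [Subsingleton.elim (default : Equiv.Perm (Fin 0)) 1, h]
    exact MonoidAlgebra.one_def.symm
  | succ n ih =>
    rw [cycleSum_succ, ih, ← add_mul_sum_elem, map_sum]
    simp only [map_smul, algSucc_elem]

/-- The eigenvalue of `∑ M ^ (number of cycles of g) g` on a Schur function. -/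
theorem charMap_cycleSum_mul (M : ℂ) (ν : n.Partition) :
    charMap n (cycleSum M n * schurElem ν) = (∏ c ∈ cells ν, (M + content c)) • schur ν := by
  have h1 : charMap n (schurElem ν) = (1 : ℂ) • schur ν := by rw [charMap_schurElem, one_smul]
  have h2 : ∀ m, ∑ l ∈ Finset.range (m + 1), M ^ (m - l) • elem (contentSeq ν) l m =
      ∏ b : Fin m, (M + contentSeq ν b) := by
    intro m
    induction m with
    | zero => simp
    | succ m ih =>
      rw [← add_mul_sum_elem, ih, Fin.prod_univ_castSucc, mul_comm]
      rfl
  rw [cycleSum_eq, Finset.sum_mul, map_sum, (isContentSeq_contentSeq ν).prod_eq fun c => M + c,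
    ← h2, Finset.sum_smul]
  refine Finset.sum_congr rfl fun l _ => ?_
  rw [smul_mul_assoc, map_smul, charMap_elem_mul h1, mul_one, smul_smul, smul_eq_mul]

end CycleSum

end MonotoneHurwitz
end

noncomputable section

namespace MonotoneHurwitz

/-! ### Expansion of symmetric polynomials in Schur polynomials -/

section SchurBasis

variable {N : ℕ}

/-- The exponent `ν + δ`. -/
def shiftedRows (N : ℕ) {n : ℕ} (ν : n.Partition) : Fin N →₀ ℕ :=
  Finsupp.equivFunOnFinite.symm fun i => row ν i + staircase N i

theorem strictAnti_shiftedRows {n : ℕ} (ν : n.Partition) : StrictAnti (shiftedRows N ν) :=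
  strictAnti_add_staircase fun _ _ h => row_antitone ν h

theorem shiftedRows_injective {n : ℕ} {ν ν' : n.Partition} (h : Multiset.card ν.parts ≤ N)
    (h' : Multiset.card ν'.parts ≤ N) (hνν : shiftedRows N ν = shiftedRows N ν') : ν = ν' := by
  refine eq_of_row_eq fun i => ?_
  rcases lt_or_ge i N with hi | hi
  · have := DFunLike.congr_fun hνν ⟨i, hi⟩
    simpa [shiftedRows] using this
  · rw [(row_eq_zero_iff ν i).2 (h.trans hi), (row_eq_zero_iff ν' i).2 (h'.trans hi)]

theorem prod_X_pow_eq_monomial (β : Fin N → ℕ) :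
    ∏ i, (MvPolynomial.X i : MvPolynomial (Fin N) ℂ) ^ β i =
      MvPolynomial.monomial (Finsupp.equivFunOnFinite.symm β) 1 := by
  rw [MvPolynomial.monomial_eq, map_one, one_mul, Finsupp.prod_fintype _ _ (by simp)]
  rfl

/-- The exponents ν + δ and μ + δ strictly decrease, so a permutation matching them is monotone,
hence trivial. -/
theorem coeff_alternant {n : ℕ} (ν μ : n.Partition) (hν : Multiset.card ν.parts ≤ N)
    (hμ : Multiset.card μ.parts ≤ N) :
    MvPolynomial.coeff (shiftedRows N ν) (alternant MvPolynomial.X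
      fun i => row μ i + staircase N i : MvPolynomial (Fin N) ℂ) = if μ = ν then 1 else 0 := by
  rw [alternant_eq_sum, MvPolynomial.coeff_sum]
  have h1 : ∀ w : Equiv.Perm (Fin N), MvPolynomial.coeff (shiftedRows N ν)
      (((Equiv.Perm.sign w : ℤ) : MvPolynomial (Fin N) ℂ) *
        ∏ i, MvPolynomial.X i ^ (row μ (w i) + staircase N (w i))) =
      if w = 1 ∧ μ = ν then 1 else 0 := by
    intro w
    rw [prod_X_pow_eq_monomial fun i => row μ (w i) + staircase N (w i),
      ← map_intCast (MvPolynomial.C : ℂ →+* MvPolynomial (Fin N) ℂ), MvPolynomial.coeff_C_mul,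
      MvPolynomial.coeff_monomial]
    by_cases h : w = 1 ∧ μ = ν
    · obtain ⟨rfl, rfl⟩ := h
      rw [if_pos (show (Finsupp.equivFunOnFinite.symm fun i => row μ ((1 : Equiv.Perm (Fin N)) i) +
        staircase N ((1 : Equiv.Perm (Fin N)) i)) = shiftedRows N μ from rfl)]
      simp
    · rw [if_neg h, if_neg, mul_zero]
      intro heq
      have h2 : ∀ i, shiftedRows N μ (w i) = shiftedRows N ν i := fun i => DFunLike.congr_fun heq i
      have hw : w = 1 := by
        rw [← Equiv.Perm.monotone_iff]
        intro i j hij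
        by_contra hlt
        have h3 := strictAnti_shiftedRows μ (not_le.1 hlt)
        rw [h2, h2] at h3
        exact absurd ((strictAnti_shiftedRows ν).antitone hij) (not_le.2 h3)
      subst hw
      exact h ⟨rfl, shiftedRows_injective hμ hν (Finsupp.ext h2)⟩
  rw [Finset.sum_congr rfl fun w _ => h1 w]
  simp [ite_and]

/-- The Schur polynomials are linearly independent. -/
theorem eq_of_sum_specVars_schur_eq {n : ℕ} {a b : n.Partition → ℂ}
    (h : ∀ x : Fin N → ℂ, ∑ ν : n.Partition with Multiset.card ν.parts ≤ N,
        a ν * specVars x (schur ν) =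
      ∑ ν : n.Partition with Multiset.card ν.parts ≤ N, b ν * specVars x (schur ν))
    {ν : n.Partition} (hν : Multiset.card ν.parts ≤ N) : a ν = b ν := by
  have key : ∀ a : n.Partition → ℂ, ∀ ν : n.Partition, Multiset.card ν.parts ≤ N →
      a ν = MvPolynomial.coeff (shiftedRows N ν)
        ((∑ ν : n.Partition with Multiset.card ν.parts ≤ N,
          a ν • specVars (MvPolynomial.X : Fin N → MvPolynomial (Fin N) ℂ) (schur ν)) *
            alternant MvPolynomial.X (staircase N)) := by
    intro a ν hν
    rw [Finset.sum_mul, MvPolynomial.coeff_sum, Finset.sum_eq_single ν]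
    · rw [smul_mul_assoc, specVars_schur_mul ν hν, MvPolynomial.coeff_smul,
        coeff_alternant ν ν hν hν, if_pos rfl, smul_eq_mul, mul_one]
    · intro μ hμ hne
      have hμ' := (Finset.mem_filter.1 hμ).2
      rw [smul_mul_assoc, specVars_schur_mul μ hμ', MvPolynomial.coeff_smul,
        coeff_alternant ν μ hν hμ', if_neg hne, smul_zero]
    · intro h
      rw [Finset.mem_filter] at h
      exact absurd ⟨Finset.mem_univ _, hν⟩ h
  rw [key a ν hν, key b ν hν]
  congr 2
  refine MvPolynomial.funext fun x => ?_
  have h1 : ∀ f : SymFun, MvPolynomial.eval x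
      (specVars (MvPolynomial.X : Fin N → MvPolynomial (Fin N) ℂ) f) = specVars x f := by
    intro f
    have := map_spec (MvPolynomial.aeval x : MvPolynomial (Fin N) ℂ →ₐ[ℂ] ℂ)
      (fun k => ∑ i, MvPolynomial.X i ^ k) f
    simp only [map_sum, map_pow, MvPolynomial.aeval_X] at this
    exact this
  simp only [map_sum, MvPolynomial.smul_eval, h1]
  exact h x

theorem rename_alternant (w : Equiv.Perm (Fin N)) (β : Fin N → ℕ) :
    MvPolynomial.rename w (alternant MvPolynomial.X β : MvPolynomial (Fin N) ℂ) =
      ((Equiv.Perm.sign w : ℤ) : MvPolynomial (Fin N) ℂ) * alternant MvPolynomial.X β := by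
  rw [alternant, ← Matrix.det_permute', AlgHom.map_det]
  congr 1
  ext i j
  simp

theorem coeff_comp_of_alternating {h : MvPolynomial (Fin N) ℂ}
    (hh : ∀ w : Equiv.Perm (Fin N), MvPolynomial.rename w h =
      ((Equiv.Perm.sign w : ℤ) : MvPolynomial (Fin N) ℂ) * h)
    (w : Equiv.Perm (Fin N)) (β : Fin N → ℕ) :
    MvPolynomial.coeff (Finsupp.equivFunOnFinite.symm fun i => β (w i)) h =
      ((Equiv.Perm.sign w : ℤ) : ℂ) * MvPolynomial.coeff (Finsupp.equivFunOnFinite.symm β) h := by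
  have h1 := MvPolynomial.coeff_rename_mapDomain w w.injective h
    (Finsupp.equivFunOnFinite.symm fun i => β (w i))
  have h2 : Finsupp.mapDomain w (Finsupp.equivFunOnFinite.symm fun i => β (w i)) =
      Finsupp.equivFunOnFinite.symm β := by
    rw [← Finsupp.equivMapDomain_eq_mapDomain]
    ext i
    simp
  rw [h2, hh, ← map_intCast (MvPolynomial.C : ℂ →+* MvPolynomial (Fin N) ℂ),
    MvPolynomial.coeff_C_mul] at h1
  exact h1.symm

/-- Multiplied by the Vandermonde alternant, f becomes alternating: exponents with a repetition have
coefficient zero, and the others group into orbits, each an alternant a_{ν+δ}. Dividing the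
alternant out again gives Schur polynomials. -/
theorem exists_schur_expansion {n : ℕ} {f : MvPolynomial (Fin N) ℂ} (hf : f.IsHomogeneous n)
    (hsymm : f.IsSymmetric) : ∃ a : n.Partition → ℂ,
      f = ∑ ν : n.Partition with Multiset.card ν.parts ≤ N,
        a ν • specVars (MvPolynomial.X : Fin N → MvPolynomial (Fin N) ℂ) (schur ν) := by
  set h := f * alternant MvPolynomial.X (staircase N) with hh
  have halt : ∀ w : Equiv.Perm (Fin N), MvPolynomial.rename w h =
      ((Equiv.Perm.sign w : ℤ) : MvPolynomial (Fin N) ℂ) * h := fun w => by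
    rw [hh, map_mul, hsymm w, rename_alternant]; ring
  have hhom : h.IsHomogeneous (n + ∑ i, staircase N i) := by
    refine hf.mul ?_
    rw [alternant_eq_sum]
    refine MvPolynomial.IsHomogeneous.sum _ _ _ fun w _ => ?_
    rw [← map_intCast (MvPolynomial.C : ℂ →+* MvPolynomial (Fin N) ℂ)]
    refine MvPolynomial.IsHomogeneous.C_mul ?_ _
    rw [prod_X_pow_eq_monomial fun i => staircase N (w i)]
    refine MvPolynomial.isHomogeneous_monomial _ ?_
    rw [Finsupp.degree_eq_sum]
    exact Equiv.sum_comp w (staircase N)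
  have hexp : h = ∑ β ∈ Finset.piAntidiag Finset.univ (n + ∑ i, staircase N i),
      MvPolynomial.coeff (Finsupp.equivFunOnFinite.symm β) h • ∏ i, MvPolynomial.X i ^ β i := by
    ext d
    rw [MvPolynomial.coeff_sum]
    simp only [prod_X_pow_eq_monomial, MvPolynomial.coeff_smul, MvPolynomial.coeff_monomial]
    by_cases hd : MvPolynomial.coeff d h = 0
    · rw [hd, Finset.sum_eq_zero]
      intro β _
      split_ifs with hβ
      · rw [hβ, hd, zero_smul]
      · rw [smul_zero]
    · have hdeg := hhom hd
      rw [Finset.sum_eq_single (⇑d)]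
      · simp
      · intro β _ hβ
        rw [if_neg, smul_zero]
        intro h
        exact hβ (by rw [← h]; rfl)
      · intro hnot
        refine absurd ?_ hnot
        rw [Finset.mem_piAntidiag]
        refine ⟨?_, fun i _ => Finset.mem_univ i⟩
        rw [← hdeg, ← Finsupp.degree_eq_sum]
        exact DFunLike.congr_fun Finsupp.degree_eq_weight_one d
  refine ⟨fun ν => MvPolynomial.coeff (shiftedRows N ν) h, ?_⟩
  refine mul_right_cancel₀ (alternant_ne_zero MvPolynomial.X_injective) ?_
  rw [← hh, Finset.sum_mul]
  refine hexp.trans ((sum_tuples_eq_sum_partition n (fun β =>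
    MvPolynomial.coeff (Finsupp.equivFunOnFinite.symm β) h • ∏ i, MvPolynomial.X i ^ β i) ?_).trans
      (Finset.sum_congr rfl fun ν hν => ?_))
  · intro β hβ
    simp only [Function.Injective, not_forall] at hβ
    obtain ⟨i, j, hij, hne⟩ := hβ
    have h1 := coeff_comp_of_alternating halt (Equiv.swap i j) β
    have h2 : (fun k => β (Equiv.swap i j k)) = β := by
      funext k
      rcases eq_or_ne k i with rfl | hki
      · rw [Equiv.swap_apply_left, hij]
      · rcases eq_or_ne k j with rfl | hkj
        · rw [Equiv.swap_apply_right, hij]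
        · rw [Equiv.swap_apply_of_ne_of_ne hki hkj]
    rw [h2, Equiv.Perm.sign_swap hne] at h1
    simp only [Units.val_neg, Units.val_one, Int.cast_neg, Int.cast_one, neg_mul, one_mul] at h1
    rw [self_eq_neg.1 h1, zero_smul]
  · rw [smul_mul_assoc, specVars_schur_mul ν (Finset.mem_filter.1 hν).2, alternant_eq_sum,
      Finset.smul_sum]
    refine Finset.sum_congr rfl fun w _ => ?_
    rw [coeff_comp_of_alternating halt w fun i => row ν i + staircase N i, mul_comm (_ : ℂ), mul_smul]
    rw [← map_intCast (MvPolynomial.C : ℂ →+* MvPolynomial (Fin N) ℂ), ← MvPolynomial.smul_eq_C_mul]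
    rfl

end SchurBasis

end MonotoneHurwitz
end

noncomputable section

namespace MonotoneHurwitz

/-! ### Conjugation-invariant polynomial functions on matrices -/

section WordPolynomials

variable {n N : ℕ}

/-- The polynomial function `∑ D(p, q) ∏_k X_{p(k) q(k)}` on matrices. -/
def wordPoly (D : (Fin n → Fin N × Fin N) → ℂ) (X : Matrix (Fin N) (Fin N) ℂ) : ℂ :=
  ∑ w, D w * ∏ k, X (w k).1 (w k).2

theorem exists_perm_comp_eq {ι κ : Type*} [Fintype ι] [DecidableEq κ] {f g : ι → κ}
    (h : ∑ k, Finsupp.single (f k) 1 = ∑ k, Finsupp.single (g k) 1) :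
    ∃ σ : Equiv.Perm ι, g ∘ σ = f := by
  have key : ∀ (f : ι → κ) (c : κ), (∑ k, Finsupp.single (f k) 1 : κ →₀ ℕ) c =
      Fintype.card {k // f k = c} := by
    intro f c
    rw [Finsupp.finsetSum_apply, Fintype.card_subtype, Finset.card_filter]
    exact Finset.sum_congr rfl fun k _ => Finsupp.single_apply
  have h2 : ∀ c, Nonempty ({k // f k = c} ≃ {k // g k = c}) := fun c =>
    Fintype.card_eq.1 (by rw [← key, ← key, h])
  exact ⟨Equiv.ofFiberEquiv fun c => (h2 c).some, funext fun k => Equiv.ofFiberEquiv_map _ k⟩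

/-- A vanishing word polynomial is orthogonal to every weight invariant under permutations of the
letters. -/
theorem sum_mul_eq_zero_of_wordPoly {D : (Fin n → Fin N × Fin N) → ℂ} (hD : ∀ X, wordPoly D X = 0)
    {e : (Fin n → Fin N × Fin N) → ℂ} (he : ∀ w (σ : Equiv.Perm (Fin n)), e (w ∘ σ) = e w) :
    ∑ w, D w * e w = 0 := by
  -- The monomial of a word. Words with the same monomial are rearrangements of each other, so `e`
  -- is constant on the fibres, while the coefficients `D` sum to zero on each.
  set m : (Fin n → Fin N × Fin N) → (Fin N × Fin N →₀ ℕ) := fun w => ∑ k, Finsupp.single (w k) 1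
    with hm
  have h1 : (∑ w, MvPolynomial.monomial (m w) (D w) : MvPolynomial (Fin N × Fin N) ℂ) = 0 := by
    refine MvPolynomial.funext fun x => ?_
    have := hD (Matrix.of fun i j => x (i, j))
    rw [map_zero, map_sum, ← this]
    refine Finset.sum_congr rfl fun w _ => ?_
    rw [hm, ← mul_one (D w), ← MvPolynomial.C_mul_monomial, map_mul, MvPolynomial.eval_C,
      MvPolynomial.monomial_sum_one, map_prod, mul_one]
    congr 1
    exact Finset.prod_congr rfl fun k _ => MvPolynomial.eval_X _
  have h2 : ∀ d, ∑ w with m w = d, D w = 0 := by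
    intro d
    have := congrArg (MvPolynomial.coeff d) h1
    rw [MvPolynomial.coeff_sum, MvPolynomial.coeff_zero] at this
    refine (Finset.sum_filter _ _).trans (Eq.trans ?_ this)
    exact Finset.sum_congr rfl fun w _ => (MvPolynomial.coeff_monomial _ _ _).symm
  rw [← Finset.sum_fiberwise_of_maps_to (t := Finset.univ.image m) (g := m)
    fun w _ => Finset.mem_image_of_mem _ (Finset.mem_univ w)]
  refine Finset.sum_eq_zero fun d hd => ?_
  obtain ⟨w₀, _, rfl⟩ := Finset.mem_image.1 hd
  rw [← zero_mul (e w₀), ← h2 (m w₀), Finset.sum_mul]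
  refine Finset.sum_congr rfl fun w hw => ?_
  obtain ⟨σ, hσ⟩ := exists_perm_comp_eq (Finset.mem_filter.1 hw).2
  rw [← hσ, he]

/-- Along a complex line the function is a polynomial in one variable, and infinitely many real
zeros kill it. This continues vanishing from Hermitian matrices to all matrices. -/
theorem wordPoly_line (D : (Fin n → Fin N × Fin N) → ℂ) (H K : Matrix (Fin N) (Fin N) ℂ)
    (h : ∀ t : ℝ, wordPoly D (H + (t : ℂ) • K) = 0) (t : ℂ) : wordPoly D (H + t • K) = 0 := by
  set p : Polynomial ℂ := ∑ w, Polynomial.C (D w) *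
    ∏ k, (Polynomial.C (H (w k).1 (w k).2) + Polynomial.X * Polynomial.C (K (w k).1 (w k).2)) with hp
  have hev : ∀ s : ℂ, p.eval s = wordPoly D (H + s • K) := by
    intro s
    simp [hp, wordPoly, Polynomial.eval_finsetSum, Polynomial.eval_prod, mul_comm s]
  have h0 : p = 0 := by
    refine Polynomial.eq_zero_of_infinite_isRoot p (Set.Infinite.mono (s := Set.range
      ((↑) : ℝ → ℂ)) ?_ (Set.infinite_range_of_injective Complex.ofReal_injective))
    rintro _ ⟨t, rfl⟩
    exact (hev t).trans (h t)
  rw [← hev, h0, Polynomial.eval_zero]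

/-- A conjugation-invariant word polynomial that vanishes on diagonal matrices is zero. -/
theorem wordPoly_eq_zero {D : (Fin n → Fin N × Fin N) → ℂ}
    (hinv : ∀ (V : UGroup N) (X : Matrix (Fin N) (Fin N) ℂ),
      wordPoly D ((V : Matrix (Fin N) (Fin N) ℂ) * X * (V : Matrix (Fin N) (Fin N) ℂ)ᴴ) =
        wordPoly D X)
    (hdiag : ∀ x : Fin N → ℂ, wordPoly D (Matrix.diagonal x) = 0)
    (X : Matrix (Fin N) (Fin N) ℂ) : wordPoly D X = 0 := by
  have hherm : ∀ H : Matrix (Fin N) (Fin N) ℂ, H.IsHermitian → wordPoly D H = 0 := by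
    intro H hH
    rw [hH.spectral_theorem, Unitary.conjStarAlgAut_apply]
    exact (hinv _ _).trans (hdiag _)
  -- X = H + iK with H and K Hermitian. For real t the matrix H + tK is Hermitian, hence unitarily
  -- diagonalizable.
  have h1 : X = ((1 / 2 : ℂ) • (X + Xᴴ)) + Complex.I • ((-Complex.I / 2 : ℂ) • (X - Xᴴ)) := by
    rw [smul_smul, show Complex.I * (-Complex.I / 2) = 1 / 2 by
      rw [mul_div_assoc', mul_neg, Complex.I_mul_I, neg_neg], ← smul_add]
    ext i j
    simp
    ring
  rw [h1]
  refine wordPoly_line D _ _ (fun t => hherm _ ?_) _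
  have hc : (starRingEnd ℂ) (-Complex.I / 2) = Complex.I / 2 := by
    rw [map_div₀, map_neg, Complex.conj_I, neg_neg, Complex.conj_ofNat]
  ext i j
  simp [Matrix.conjTranspose_apply]
  ring

end WordPolynomials

end MonotoneHurwitz
end

noncomputable section

namespace MonotoneHurwitz

/-! ### The normalized Haar measure -/

section Haar

variable {N : ℕ}

instance isProbabilityMeasure_unitaryHaar (N : ℕ) : IsProbabilityMeasure (unitaryHaar N) :=
  ⟨Measure.haarMeasure_self (K₀ := (⊤ : TopologicalSpace.PositiveCompacts (UGroup N)))⟩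

theorem integral_unitaryHaar_mul_left (V : UGroup N) (f : UGroup N → ℂ) :
    ∫ U, f (V * U) ∂(unitaryHaar N) = ∫ U, f U ∂(unitaryHaar N) := by
  have : (unitaryHaar N).IsMulLeftInvariant := Measure.isMulLeftInvariant_haarMeasure _
  exact integral_mul_left_eq_self f V

theorem integrable_unitaryHaar {f : UGroup N → ℂ} (hf : Continuous f) :
    Integrable f (unitaryHaar N) :=
  hf.integrable_of_hasCompactSupport (HasCompactSupport.of_compactSpace f)

/-- The matrix `U A U†`. -/
def orbit (A : Matrix (Fin N) (Fin N) ℂ) (U : UGroup N) : Matrix (Fin N) (Fin N) ℂ :=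
  (U : Matrix (Fin N) (Fin N) ℂ) * A * (U : Matrix (Fin N) (Fin N) ℂ)ᴴ

theorem continuous_orbit (A : Matrix (Fin N) (Fin N) ℂ) : Continuous (orbit A) := by
  have h : Continuous fun U : UGroup N => (U : Matrix (Fin N) (Fin N) ℂ) := continuous_subtype_val
  exact (h.matrix_mul continuous_const).matrix_mul h.matrix_conjTranspose

theorem conjTranspose_mul_self_uGroup (V : UGroup N) :
    (V : Matrix (Fin N) (Fin N) ℂ)ᴴ * (V : Matrix (Fin N) (Fin N) ℂ) = 1 :=
  (Matrix.mem_unitaryGroup_iff').1 V.2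

theorem self_mul_conjTranspose_uGroup (V : UGroup N) :
    (V : Matrix (Fin N) (Fin N) ℂ) * (V : Matrix (Fin N) (Fin N) ℂ)ᴴ = 1 :=
  (Matrix.mem_unitaryGroup_iff).1 V.2

theorem conj_pow_uGroup (V : UGroup N) (X : Matrix (Fin N) (Fin N) ℂ) (k : ℕ) :
    orbit X V ^ k = orbit (X ^ k) V := by
  induction k with
  | zero => rw [pow_zero, pow_zero, orbit, mul_one, self_mul_conjTranspose_uGroup]
  | succ k ih =>
    rw [pow_succ, ih, orbit, orbit, orbit, pow_succ]
    simp only [mul_assoc]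
    rw [← mul_assoc _ _ (X * _), conjTranspose_mul_self_uGroup, one_mul]

theorem trace_orbit (V : UGroup N) (X : Matrix (Fin N) (Fin N) ℂ) :
    (orbit X V).trace = X.trace := by
  rw [orbit, Matrix.trace_mul_comm, ← mul_assoc, conjTranspose_mul_self_uGroup, one_mul]

variable {n : ℕ}

theorem permTrace_congr_trace {ι : Type*} [Fintype ι] [DecidableEq ι] (g : Equiv.Perm (Fin n))
    {X Y : Matrix ι ι ℂ} (h : ∀ k, 0 < k → (X ^ k).trace = (Y ^ k).trace) :
    permTrace g X = permTrace g Y := by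
  rw [permTrace_eq_prod, permTrace_eq_prod]
  congr 1
  exact Multiset.map_congr rfl fun k hk => h k ((cyc g).parts_pos hk)

theorem permTrace_orbit (g : Equiv.Perm (Fin n)) (V : UGroup N) (X : Matrix (Fin N) (Fin N) ℂ) :
    permTrace g (orbit X V) = permTrace g X :=
  permTrace_congr_trace g fun k _ => by rw [conj_pow_uGroup, trace_orbit]

theorem permTrace_mul_comm {ι : Type*} [Fintype ι] [DecidableEq ι] (g : Equiv.Perm (Fin n))
    (X Y : Matrix ι ι ℂ) : permTrace g (X * Y) = permTrace g (Y * X) := by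
  refine permTrace_congr_trace g fun k hk => ?_
  obtain ⟨k, rfl⟩ := Nat.exists_eq_succ_of_ne_zero hk.ne'
  rw [Nat.succ_eq_add_one, pow_succ, ← mul_assoc, mul_pow_mul, mul_assoc, Matrix.trace_mul_comm,
    mul_assoc, ← pow_succ]

theorem permTrace_congr_cyc {ι : Type*} [Fintype ι] [DecidableEq ι] {g h : Equiv.Perm (Fin n)}
    (hgh : cyc g = cyc h) (X : Matrix ι ι ℂ) : permTrace g X = permTrace h X := by
  rw [permTrace_eq_prod, permTrace_eq_prod, hgh]

/-- The entries of X are made the letters of a word and those of Y the links between consecutive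
letters, so that Y can be averaged inside the coefficients. -/
theorem permTrace_mul {ι : Type*} [Fintype ι] [DecidableEq ι] (g : Equiv.Perm (Fin n))
    (X Y : Matrix ι ι ℂ) : permTrace g (X * Y) =
      ∑ w : Fin n → ι × ι, (∏ k, Y (w k).2 (w (g k)).1) * ∏ k, X (w k).1 (w k).2 := by
  rw [← (Equiv.arrowProdEquivProdArrow (Fin n) (fun _ => ι) (fun _ => ι)).symm.sum_comp,
    Fintype.sum_prod_type, permTrace]
  refine Finset.sum_congr rfl fun p _ => ?_
  simp only [Matrix.mul_apply, Finset.prod_univ_sum, Fintype.piFinset_univ]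
  refine Finset.sum_congr rfl fun q _ => ?_
  rw [mul_comm, ← Finset.prod_mul_distrib]
  rfl

/-- The polynomial `∑_g M^{cycles(g)} P_g`, which is `n!` times the degree `n` part of
`det(1 - X)^{-M}`. -/
def powTrace (M : ℂ) (n : ℕ) {ι : Type*} [Fintype ι] (X : Matrix ι ι ℂ) : ℂ :=
  ∑ g : Equiv.Perm (Fin n), M ^ numCycles g * permTrace g X

/-- The coefficients of the average of `powTrace M n (X U A U†)`. -/
def avgCoeff (M : ℂ) (A : Matrix (Fin N) (Fin N) ℂ) (w : Fin n → Fin N × Fin N) : ℂ :=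
  ∑ g : Equiv.Perm (Fin n), M ^ numCycles g *
    ∫ U, ∏ k, orbit A U (w k).2 (w (g k)).1 ∂(unitaryHaar N)

theorem continuous_prod_orbit (A : Matrix (Fin N) (Fin N) ℂ) (p q : Fin n → Fin N) :
    Continuous fun U => ∏ k, orbit A U (p k) (q k) :=
  continuous_finsetProd _ fun _ _ => (continuous_orbit A).matrix_elem _ _

theorem integral_powTrace (M : ℂ) (A X : Matrix (Fin N) (Fin N) ℂ) :
    ∫ U, powTrace M n (X * orbit A U) ∂(unitaryHaar N) = wordPoly (avgCoeff (n := n) M A) X := by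
  simp only [powTrace, permTrace_mul, wordPoly, avgCoeff]
  rw [integral_finsetSum]
  · simp only [integral_const_mul]
    rw [Finset.sum_congr rfl fun w _ => Finset.sum_mul _ _ _, Finset.sum_comm]
    refine Finset.sum_congr rfl fun g _ => ?_
    rw [integral_finsetSum, Finset.mul_sum]
    · refine Finset.sum_congr rfl fun w _ => ?_
      rw [integral_mul_const, mul_assoc]
    · exact fun w _ => (integrable_unitaryHaar (continuous_prod_orbit A _ _)).mul_const _
  · exact fun g _ => (integrable_finsetSum _ fun w _ =>
      (integrable_unitaryHaar (continuous_prod_orbit A _ _)).mul_const _).const_mul _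

/-- Left translation by V conjugates both factors of X · U A U† at once, and traces do not see it.
-/
theorem wordPoly_avgCoeff_conj (M : ℂ) (A X : Matrix (Fin N) (Fin N) ℂ) (V : UGroup N) :
    wordPoly (avgCoeff (n := n) M A) (orbit X V) = wordPoly (avgCoeff (n := n) M A) X := by
  rw [← integral_powTrace, ← integral_powTrace,
    ← integral_unitaryHaar_mul_left V fun U => powTrace M n (orbit X V * orbit A U)]
  have h : ∀ U : UGroup N, orbit X V * orbit A (V * U) = orbit (X * orbit A U) V := by
    intro U
    simp only [orbit, Submonoid.coe_mul, Matrix.conjTranspose_mul, mul_assoc]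
    rw [← mul_assoc _ _ ((U : Matrix (Fin N) (Fin N) ℂ) * _), conjTranspose_mul_self_uGroup, one_mul]
  simp only [h, powTrace, permTrace_orbit]

end Haar

end MonotoneHurwitz
end

noncomputable section

namespace MonotoneHurwitz

/-! ### The Haar average of `powTrace` -/

section Average

variable {n N : ℕ}

theorem specMatrix_charMap (X : Matrix (Fin N) (Fin N) ℂ) (x : GroupAlg n) :
    (n ! : ℂ) * specMatrix X (charMap n x) = ∑ g, x.coeff g * permTrace g X := by
  have hn : (n ! : ℂ) ≠ 0 := by exact_mod_cast Nat.factorial_ne_zero n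
  conv_lhs => rw [eq_sum_perm x]
  rw [map_sum, map_sum, Finset.mul_sum]
  refine Finset.sum_congr rfl fun g _ => ?_
  rw [map_smul, map_smul, charMap_perm, map_smul, specMatrix_psumPart_cyc, smul_eq_mul, smul_eq_mul]
  field_simp

/-- The coefficients of `∑_g y_g P_g` as a word polynomial. -/
def permWord (y : Equiv.Perm (Fin n) → ℂ) (w : Fin n → Fin N × Fin N) : ℂ :=
  ∑ g, y g * ∏ k, (1 : Matrix (Fin N) (Fin N) ℂ) (w k).2 (w (g k)).1

theorem prod_one_apply (p q : Fin n → Fin N) :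
    ∏ k, (1 : Matrix (Fin N) (Fin N) ℂ) (q k) (p k) = if q = p then 1 else 0 := by
  split_ifs with h
  · subst h; simp
  · obtain ⟨k, hk⟩ := Function.ne_iff.1 h
    exact Finset.prod_eq_zero (Finset.mem_univ k) (Matrix.one_apply_ne hk)

theorem sum_pairs {ι : Type*} [Fintype ι] (F : (Fin n → ι × ι) → ℂ) :
    ∑ w, F w = ∑ p : Fin n → ι, ∑ q : Fin n → ι, F fun k => (p k, q k) := by
  rw [← (Equiv.arrowProdEquivProdArrow (Fin n) (fun _ => ι) (fun _ => ι)).symm.sum_comp,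
    Fintype.sum_prod_type]
  rfl

theorem sum_permWord_mul (y : Equiv.Perm (Fin n) → ℂ) (E : (Fin n → Fin N × Fin N) → ℂ) :
    ∑ w, permWord y w * E w = ∑ g, y g * ∑ p : Fin n → Fin N, E fun k => (p k, p (g k)) := by
  simp only [permWord, Finset.sum_mul, Finset.mul_sum]
  rw [Finset.sum_comm]
  refine Finset.sum_congr rfl fun g _ => ?_
  rw [sum_pairs]
  refine Finset.sum_congr rfl fun p _ => ?_
  rw [Finset.sum_eq_single fun k => p (g k)]
  · have := prod_one_apply (fun k => p (g k)) fun k => p (g k)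
    rw [if_pos rfl] at this
    rw [this, mul_one]
  · intro q _ hq
    have := prod_one_apply (fun k => p (g k)) q
    rw [if_neg hq] at this
    rw [this, mul_zero, zero_mul]
  · exact fun h => absurd (Finset.mem_univ _) h

theorem wordPoly_permWord (y : Equiv.Perm (Fin n) → ℂ) (X : Matrix (Fin N) (Fin N) ℂ) :
    wordPoly (permWord y) X = ∑ g, y g * permTrace g X :=
  sum_permWord_mul y fun w => ∏ k, X (w k).1 (w k).2

theorem permWord_comp {y : Equiv.Perm (Fin n) → ℂ} (hy : ∀ g h, y (h * g * h⁻¹) = y g)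
    (w : Fin n → Fin N × Fin N) (σ : Equiv.Perm (Fin n)) : permWord y (w ∘ σ) = permWord y w := by
  rw [permWord, permWord]
  conv_rhs => rw [← (MulAut.conj σ).toEquiv.sum_comp]
  refine Finset.sum_congr rfl fun g _ => ?_
  have h1 : (MulAut.conj σ).toEquiv g = σ * g * σ⁻¹ := rfl
  rw [h1, hy, ← Equiv.prod_comp σ fun k => (1 : Matrix (Fin N) (Fin N) ℂ) (w k).2
    (w ((σ * g * σ⁻¹) k)).1]
  congr 1
  refine Finset.prod_congr rfl fun k _ => ?_
  rw [show (σ * g * σ⁻¹) (σ k) = σ (g k) by simp]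
  rfl

theorem sum_prod_comp (g τ : Equiv.Perm (Fin n)) (Y : Matrix (Fin N) (Fin N) ℂ) :
    ∑ p : Fin n → Fin N, ∏ k, Y (p (τ k)) (p (g k)) = permTrace (g * τ⁻¹) Y := by
  refine Finset.sum_congr rfl fun p _ => ?_
  rw [← Equiv.prod_comp τ fun k => Y (p k) (p ((g * τ⁻¹) k))]
  refine Finset.prod_congr rfl fun k _ => ?_
  simp [Equiv.Perm.mul_apply]

theorem sum_permWord_mul_permWord (c y : Equiv.Perm (Fin n) → ℂ) :
    ∑ w : Fin n → Fin N × Fin N, permWord c w * permWord y w =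
      ∑ τ, c τ * ∑ g, y g * permTrace (g * τ⁻¹) (1 : Matrix (Fin N) (Fin N) ℂ) := by
  rw [sum_permWord_mul]
  refine Finset.sum_congr rfl fun τ _ => ?_
  simp only [permWord]
  rw [Finset.sum_comm]
  congr 1
  refine Finset.sum_congr rfl fun g _ => ?_
  rw [← Finset.mul_sum, sum_prod_comp]

/-- The deltas of `permWord` close the open indices of U A U† into traces, which do not depend on U.
The Haar integral of a constant is then trivial. -/
theorem sum_permWord_mul_avgCoeff (c : Equiv.Perm (Fin n) → ℂ) (M : ℂ)
    (A : Matrix (Fin N) (Fin N) ℂ) :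
    ∑ w, permWord c w * avgCoeff M A w =
      ∑ τ, c τ * ∑ g, M ^ numCycles g * permTrace (g * τ⁻¹) A := by
  rw [sum_permWord_mul]
  refine Finset.sum_congr rfl fun τ _ => ?_
  simp only [avgCoeff]
  rw [Finset.sum_comm]
  congr 1
  refine Finset.sum_congr rfl fun g _ => ?_
  rw [← Finset.mul_sum, ← integral_finsetSum]
  · simp only [sum_prod_comp, permTrace_orbit, integral_const, probReal_univ, one_smul]
  · exact fun p _ => integrable_unitaryHaar (continuous_prod_orbit A _ _)

/-- Up to replacing τ by its inverse, which has the same cycle type, this is the Schur expansion for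
the central element `cycleSum M n`, evaluated at C and A. -/
theorem sum_permTrace_mul_cycleSum (M : ℂ) (C A : Matrix (Fin N) (Fin N) ℂ) :
    ∑ τ : Equiv.Perm (Fin n), permTrace τ C *
        ∑ g, M ^ numCycles g * permTrace (g * τ⁻¹) A =
      n ! * ∑ ν : n.Partition, (∏ c ∈ cells ν, (M + content c)) *
        (specMatrix C (schur ν) * specMatrix A (schur ν)) := by
  have hn : (n ! : ℂ) ≠ 0 := by exact_mod_cast Nat.factorial_ne_zero n
  have h1 := congrArg (spec₂ (fun k => (C ^ k).trace) fun k => (A ^ k).trace)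
    (charMap₂_sum_mul_eq_schur (commute_cycleSum M) (charMap_cycleSum_mul (n := n) M))
  simp only [map_sum, map_smul, charMap₂, TensorProduct.map_tmul, spec₂_tmul, smul_eq_mul] at h1
  rw [← h1, Finset.mul_sum, ← Equiv.sum_comp (Equiv.inv (Equiv.Perm (Fin n)))]
  refine Finset.sum_congr rfl fun τ _ => ?_
  have h2 : (n ! : ℂ) * specMatrix C (charMap n (perm τ)) = permTrace τ C := by
    rw [charMap_perm, map_smul, specMatrix_psumPart_cyc, smul_eq_mul, mul_inv_cancel_left₀ hn]
  have h3 : (n ! : ℂ) * specMatrix A (charMap n (cycleSum M n * perm τ)) =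
      ∑ g, M ^ numCycles g * permTrace (g * τ) A := by
    rw [cycleSum, Finset.sum_mul, map_sum, map_sum, Finset.mul_sum]
    refine Finset.sum_congr rfl fun g _ => ?_
    rw [smul_mul_assoc, ← perm_mul, map_smul, charMap_perm, map_smul, map_smul,
      specMatrix_psumPart_cyc, smul_eq_mul, smul_eq_mul]
    field_simp
  rw [Equiv.inv_apply, inv_inv, permTrace_congr_cyc (cyc_inv τ), ← h2, ← h3]
  simp only [specMatrix]
  ring

/-- At the identity matrix a trace is N^(number of cycles), so the Gram matrix of the permutation
operators is multiplication by `cycleSum N n`. Its eigenvalues ∏ (N + c) will be the denominators.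
-/
theorem sum_permTrace_mul_one (C : Matrix (Fin N) (Fin N) ℂ) (y : GroupAlg n) :
    ∑ τ : Equiv.Perm (Fin n), permTrace τ C *
        ∑ g, y.coeff g * permTrace (g * τ⁻¹) (1 : Matrix (Fin N) (Fin N) ℂ) =
      n ! * specMatrix C (charMap n (cycleSum N n * y)) := by
  have hn : (n ! : ℂ) ≠ 0 := by exact_mod_cast Nat.factorial_ne_zero n
  have h1 : cycleSum (N : ℂ) n * y = ∑ g, ∑ h, (y.coeff g * (N : ℂ) ^ numCycles h) • perm (h * g) := by
    conv_lhs => rw [eq_sum_perm y]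
    rw [Finset.mul_sum]
    refine Finset.sum_congr rfl fun g _ => ?_
    rw [cycleSum, Finset.sum_mul]
    refine Finset.sum_congr rfl fun h _ => ?_
    rw [smul_mul_smul_comm, ← perm_mul, mul_comm]
  simp only [h1, Finset.mul_sum, map_sum]
  rw [Finset.sum_comm]
  refine Finset.sum_congr rfl fun g _ => ?_
  rw [← Equiv.sum_comp (Equiv.mulRight g)]
  refine Finset.sum_congr rfl fun h _ => ?_
  rw [Equiv.coe_mulRight, mul_inv_rev, mul_inv_cancel_left, permTrace_one_matrix,
    numCycles_congr (cyc_inv h), map_smul, map_smul, charMap_perm, map_smul,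
    specMatrix_psumPart_cyc, smul_eq_mul, smul_eq_mul]
  field_simp

theorem orbit_permMatrix (x : Fin N → ℂ) (σ : Equiv.Perm (Fin N)) :
    ∃ V : UGroup N, orbit (Matrix.diagonal x) V = Matrix.diagonal (x ∘ σ) := by
  have hV : σ.permMatrix ℂ ∈ Matrix.unitaryGroup (Fin N) ℂ := by
    rw [Matrix.mem_unitaryGroup_iff, Matrix.star_eq_conjTranspose, Matrix.conjTranspose_permMatrix,
      ← Matrix.permMatrix_mul, inv_mul_cancel, Matrix.permMatrix_one]
  refine ⟨⟨σ.permMatrix ℂ, hV⟩, ?_⟩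
  have h : σ.permMatrix ℂ * Matrix.diagonal x = Matrix.diagonal (x ∘ σ) * σ.permMatrix ℂ := by
    ext i j
    rw [Matrix.mul_diagonal, Matrix.diagonal_mul, Equiv.Perm.permMatrix, PEquiv.toMatrix_apply,
      Equiv.toPEquiv_apply]
    by_cases hij : σ i = j
    · subst hij; simp
    · simp [hij]
  have h2 := self_mul_conjTranspose_uGroup ⟨σ.permMatrix ℂ, hV⟩
  rw [orbit]
  dsimp only at h2 ⊢
  rw [h, mul_assoc, h2, mul_one]

/-- The degree `n` part of the average over `U(N)` of `det(1 - U A U† X)^{-M}`. -/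
theorem wordPoly_avgCoeff (M : ℂ) (A : Matrix (Fin N) (Fin N) ℂ) (x : Fin N → ℂ) :
    wordPoly (avgCoeff (n := n) M A) (Matrix.diagonal x) =
      n ! * ∑ ν : n.Partition with Multiset.card ν.parts ≤ N,
        (∏ c ∈ cells ν, (M + content c) / (N + content c)) *
          (specMatrix A (schur ν) * specVars x (schur ν)) := by
  classical
  have hn : (n ! : ℂ) ≠ 0 := by exact_mod_cast Nat.factorial_ne_zero n
  -- The restriction of the average to diagonal matrices. It is homogeneous, and symmetric because
  -- permutation matrices are unitary, so it has a Schur expansion with unknown coefficients `a ν`.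
  set f : MvPolynomial (Fin N) ℂ := ∑ p : Fin n → Fin N,
    MvPolynomial.C (avgCoeff M A fun k => (p k, p k)) * ∏ k, MvPolynomial.X (p k) with hf
  have hfx : ∀ x, MvPolynomial.eval x f = wordPoly (avgCoeff (n := n) M A) (Matrix.diagonal x) := by
    intro x
    rw [wordPoly, sum_pairs, hf, map_sum]
    refine Finset.sum_congr rfl fun p _ => ?_
    rw [Finset.sum_eq_single p]
    · simp
    · intro q _ hq
      obtain ⟨k, hk⟩ := Function.ne_iff.1 hq.symm
      refine mul_eq_zero_of_right _ (Finset.prod_eq_zero (Finset.mem_univ k) ?_)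
      exact Matrix.diagonal_apply_ne x hk
    · exact fun h => absurd (Finset.mem_univ _) h
  have hhom : f.IsHomogeneous n := by
    refine MvPolynomial.IsHomogeneous.sum _ _ _ fun p _ => MvPolynomial.IsHomogeneous.C_mul ?_ _
    have := MvPolynomial.IsHomogeneous.prod Finset.univ
      (fun k : Fin n => (MvPolynomial.X (p k) : MvPolynomial (Fin N) ℂ)) (fun _ => 1)
      fun k _ => MvPolynomial.isHomogeneous_X ℂ (p k)
    simpa using this
  have hsymm : f.IsSymmetric := by
    intro σ
    refine MvPolynomial.funext fun x => ?_
    obtain ⟨V, hV⟩ := orbit_permMatrix x σ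
    rw [MvPolynomial.eval_rename, hfx, hfx, ← hV, wordPoly_avgCoeff_conj]
  obtain ⟨a, ha⟩ := exists_schur_expansion hhom hsymm
  -- An element of the group algebra whose trace polynomial is the same combination of Schur
  -- functions. It agrees with the average on diagonal matrices, hence everywhere by conjugation
  -- invariance.
  set y : GroupAlg n := (n ! : ℂ)⁻¹ • ∑ ν : n.Partition with Multiset.card ν.parts ≤ N,
    a ν • schurElem ν with hy
  have hav : ∀ x, wordPoly (avgCoeff (n := n) M A) (Matrix.diagonal x) =
      ∑ ν : n.Partition with Multiset.card ν.parts ≤ N, a ν * specVars x (schur ν) := by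
    intro x
    rw [← hfx, ha, map_sum]
    refine Finset.sum_congr rfl fun ν _ => ?_
    rw [MvPolynomial.smul_eval]
    congr 1
    have := map_spec (MvPolynomial.aeval x : MvPolynomial (Fin N) ℂ →ₐ[ℂ] ℂ)
      (fun k => ∑ i, MvPolynomial.X i ^ k) (schur ν)
    simp only [map_sum, map_pow, MvPolynomial.aeval_X] at this
    exact this
  have hyx : ∀ X : Matrix (Fin N) (Fin N) ℂ, wordPoly (permWord y.coeff) X =
      ∑ ν : n.Partition with Multiset.card ν.parts ≤ N, a ν * specMatrix X (schur ν) := by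
    intro X
    rw [wordPoly_permWord, ← specMatrix_charMap, hy, map_smul, map_smul, smul_eq_mul,
      mul_inv_cancel_left₀ hn, map_sum, map_sum]
    refine Finset.sum_congr rfl fun ν _ => ?_
    rw [map_smul, map_smul, charMap_schurElem, smul_eq_mul]
  have hsub : ∀ X, wordPoly (fun w => avgCoeff M A w - permWord y.coeff w) X =
      wordPoly (avgCoeff (n := n) M A) X - wordPoly (permWord y.coeff) X := by
    intro X
    simp only [wordPoly, sub_mul, Finset.sum_sub_distrib]
  have hzero : ∀ X, wordPoly (fun w => avgCoeff M A w - permWord y.coeff w) X = 0 := by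
    refine wordPoly_eq_zero (fun V X => ?_) fun x => ?_
    · have h1 := wordPoly_avgCoeff_conj (n := n) M A X V
      have h2 : wordPoly (permWord y.coeff) (orbit X V) = wordPoly (permWord y.coeff) X := by
        simp only [wordPoly_permWord, permTrace_orbit]
      exact (hsub _).trans (show wordPoly (avgCoeff M A) (orbit X V) -
        wordPoly (permWord y.coeff) (orbit X V) = _ by rw [h1, h2, hsub])
    · rw [hsub, hav, hyx, specMatrix_diagonal, sub_self]
  -- Both polynomials are paired with the weight τ ↦ P_τ(C). That weight is invariant under
  -- rearranging letters, so the pairing depends only on the polynomial, not on its coefficients as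
  -- a function on words.
  have hpair : ∀ C : Matrix (Fin N) (Fin N) ℂ,
      n ! * ∑ ν : n.Partition, (∏ c ∈ cells ν, (M + content c)) *
        (specMatrix C (schur ν) * specMatrix A (schur ν)) =
      n ! * specMatrix C (charMap n (cycleSum N n * y)) := by
    intro C
    rw [← sum_permTrace_mul_cycleSum, ← sum_permTrace_mul_one,
      ← sum_permWord_mul_avgCoeff, ← sum_permWord_mul_permWord, ← sub_eq_zero,
      ← Finset.sum_sub_distrib, ← sum_mul_eq_zero_of_wordPoly hzero
        fun w σ => permWord_comp (y := fun τ => permTrace τ C) (fun g h => permTrace_conj g h C) w σ]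
    refine Finset.sum_congr rfl fun w _ => ?_
    ring
  -- With C diagonal, the coefficients of the linearly independent S_ν(C) are compared, which
  -- determines `a ν`.
  have hind : ∀ ν : n.Partition, Multiset.card ν.parts ≤ N →
      n ! * ((∏ c ∈ cells ν, (M + content c)) * specMatrix A (schur ν)) =
        a ν * ∏ c ∈ cells ν, ((N : ℂ) + content c) := by
    intro ν hν
    refine eq_of_sum_specVars_schur_eq
      (a := fun ν => n ! * ((∏ c ∈ cells ν, (M + content c)) * specMatrix A (schur ν)))
      (b := fun ν => a ν * ∏ c ∈ cells ν, ((N : ℂ) + content c)) (fun x => ?_) hν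
    have h1 := hpair (Matrix.diagonal x)
    have h2 : charMap n (cycleSum N n * y) = (n ! : ℂ)⁻¹ •
        ∑ ν : n.Partition with Multiset.card ν.parts ≤ N,
          (a ν * ∏ c ∈ cells ν, ((N : ℂ) + content c)) • schur ν := by
      rw [hy, mul_smul_comm, map_smul, Finset.mul_sum, map_sum]
      congr 1
      refine Finset.sum_congr rfl fun ν _ => ?_
      rw [mul_smul_comm, map_smul, charMap_cycleSum_mul, smul_smul]
    rw [h2, map_smul, smul_eq_mul, mul_inv_cancel_left₀ hn, map_sum, specMatrix_diagonal] at h1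
    simp only [map_smul, smul_eq_mul] at h1
    rw [← h1, Finset.mul_sum, Finset.sum_filter_of_ne]
    · refine Finset.sum_congr rfl fun ν _ => ?_
      ring
    · intro ν _ hne
      by_contra hlt
      exact hne (by rw [specVars_schur_eq_zero ν (not_le.1 hlt), mul_zero])
  rw [hav, Finset.mul_sum]
  refine Finset.sum_congr rfl fun ν hν => ?_
  have hνN := (Finset.mem_filter.1 hν).2
  have hne : ∏ c ∈ cells ν, ((N : ℂ) + content c) ≠ 0 := by
    refine Finset.prod_ne_zero_iff.2 fun c hc => ?_
    have := one_le_add_content hνN hc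
    have h2 : (N : ℤ) + content c ≠ 0 := by omega
    exact_mod_cast h2
  have h3 := hind ν hνN
  rw [Finset.prod_div_distrib, eq_div_of_mul_eq hne h3.symm]
  ring

end Average

end MonotoneHurwitz
end

noncomputable section

namespace MonotoneHurwitz

/-! ### Eigenvalues -/

section Eigenvalues

variable {N : ℕ}

theorem exists_charpoly_eq_prod (X : Matrix (Fin N) (Fin N) ℂ) :
    ∃ x : Fin N → ℂ, X.charpoly = ∏ i, (Polynomial.X - Polynomial.C (x i)) := by
  have hs := IsAlgClosed.splits X.charpoly
  have hcard : X.charpoly.roots.toList.length = N := by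
    rw [Multiset.length_toList, Polynomial.splits_iff_card_roots.1 hs,
      Matrix.charpoly_natDegree_eq_dim, Fintype.card_fin]
  refine ⟨fun i => X.charpoly.roots.toList.get (i.cast hcard.symm), ?_⟩
  have hroots : Finset.univ.val.map (fun i : Fin N => X.charpoly.roots.toList.get (i.cast hcard.symm)) =
      X.charpoly.roots := by
    have h1 : List.ofFn (fun i : Fin N => X.charpoly.roots.toList.get (i.cast hcard.symm)) =
        X.charpoly.roots.toList := by
      refine List.ext_get (by simp [hcard]) fun i h1 h2 => ?_
      simp
    rw [Fin.univ_val_map, h1, Multiset.coe_toList]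
  conv_lhs => rw [hs.eq_prod_roots_of_monic X.charpoly_monic, ← hroots, Multiset.map_map]
  rfl

variable {X : Matrix (Fin N) (Fin N) ℂ} {x : Fin N → ℂ}

theorem roots_charpoly (hx : X.charpoly = ∏ i, (Polynomial.X - Polynomial.C (x i))) :
    X.charpoly.roots = Finset.univ.val.map x := by
  rw [hx, show ∏ i, (Polynomial.X - Polynomial.C (x i)) = ((Finset.univ.val.map x).map fun r =>
    Polynomial.X - Polynomial.C r).prod by rw [Multiset.map_map]; rfl]
  exact Polynomial.roots_multiset_prod_X_sub_C _

/-- The polynomial f splits into linear factors, and det(X - r) = ∏ (x_i - r) is the characteristic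
polynomial up to sign. Applied to f - r it gives the eigenvalues of f(X) with multiplicity, as
`detPow` requires. -/
theorem det_aeval (hx : X.charpoly = ∏ i, (Polynomial.X - Polynomial.C (x i)))
    (f : Polynomial ℂ) : (Polynomial.aeval X f).det = ∏ i, f.eval (x i) := by
  have h1 : ∀ r : ℂ, (Polynomial.aeval X (Polynomial.X - Polynomial.C r)).det = ∏ i, (x i - r) := by
    intro r
    have h2 := Matrix.eval_charpoly X r
    rw [hx, Polynomial.eval_prod] at h2
    have h3 : Polynomial.aeval X (Polynomial.X - Polynomial.C r) = -(Matrix.scalar (Fin N) r - X) := by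
      rw [map_sub, Polynomial.aeval_X, Polynomial.aeval_C, neg_sub]
      rfl
    rw [h3, Matrix.det_neg, ← h2, Fintype.card_fin]
    simp only [Polynomial.eval_sub, Polynomial.eval_X, Polynomial.eval_C]
    have h5 : (-1 : ℂ) ^ N = ∏ _i : Fin N, (-1 : ℂ) := by simp
    rw [h5, ← Finset.prod_mul_distrib]
    exact Finset.prod_congr rfl fun i _ => by ring
  have h4 : ∀ s : Multiset ℂ,
      (Polynomial.aeval X (s.map fun r => Polynomial.X - Polynomial.C r).prod).det =
        ∏ i, (s.map fun r => Polynomial.X - Polynomial.C r).prod.eval (x i) := by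
    intro s
    induction s using Multiset.induction with
    | empty => simp
    | cons r s ih =>
      rw [Multiset.map_cons, Multiset.prod_cons, map_mul, Matrix.det_mul, ih, h1,
        ← Finset.prod_mul_distrib]
      refine Finset.prod_congr rfl fun i _ => ?_
      rw [Polynomial.eval_mul, Polynomial.eval_sub, Polynomial.eval_X, Polynomial.eval_C]
  rw [(IsAlgClosed.splits f).eq_prod_roots, map_mul, Polynomial.aeval_C, Matrix.det_mul, h4,
    Matrix.algebraMap_eq_diagonal, Matrix.det_diagonal, ← Finset.prod_mul_distrib]
  refine Finset.prod_congr rfl fun i _ => ?_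
  rw [Polynomial.eval_mul, Polynomial.eval_C]
  rfl

theorem charpoly_aeval (hx : X.charpoly = ∏ i, (Polynomial.X - Polynomial.C (x i)))
    (f : Polynomial ℂ) : (Polynomial.aeval X f).charpoly =
      ∏ i, (Polynomial.X - Polynomial.C (f.eval (x i))) := by
  refine Polynomial.funext fun r => ?_
  have h1 : Matrix.scalar (Fin N) r - Polynomial.aeval X f =
      Polynomial.aeval X (Polynomial.C r - f) := by
    rw [map_sub, Polynomial.aeval_C]
    rfl
  rw [Matrix.eval_charpoly, h1, det_aeval hx, Polynomial.eval_prod]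
  simp

theorem trace_pow (hx : X.charpoly = ∏ i, (Polynomial.X - Polynomial.C (x i))) (k : ℕ) :
    (X ^ k).trace = ∑ i, x i ^ k := by
  have h1 := charpoly_aeval hx (Polynomial.X ^ k)
  have h2 := roots_charpoly h1
  rw [map_pow, Polynomial.aeval_X] at h2
  rw [Matrix.trace_eq_sum_roots_charpoly, h2]
  simp [List.sum_ofFn]

theorem detPow_one_sub_smul (hx : X.charpoly = ∏ i, (Polynomial.X - Polynomial.C (x i)))
    (q s : ℂ) : detPow (1 - q • X) s = ∏ i, (1 - q * x i) ^ s := by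
  have h1 := charpoly_aeval hx (1 - Polynomial.C q * Polynomial.X)
  have h2 := roots_charpoly h1
  rw [map_sub, map_one, map_mul, Polynomial.aeval_C, Polynomial.aeval_X, ← Algebra.smul_def] at h2
  rw [detPow, h2, Multiset.map_map]
  simp [List.prod_ofFn]

open scoped Matrix.Norms.L2Operator in
theorem norm_le_of_charpoly (hx : X.charpoly = ∏ i, (Polynomial.X - Polynomial.C (x i)))
    (i : Fin N) : ‖x i‖ ≤ ‖X‖ := by
  have : Nonempty (Fin N) := ⟨i⟩
  refine spectrum.norm_le_norm_of_mem (Matrix.mem_spectrum_of_isRoot_charpoly ?_)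
  rw [hx, Polynomial.IsRoot, Polynomial.eval_prod]
  exact Finset.prod_eq_zero (Finset.mem_univ i) (by simp)

-- Unitary factors do not change the operator norm, and the operator norm of a diagonal matrix is
-- the supremum of its entries. The bound is uniform in U.
open scoped Matrix.Norms.L2Operator in
theorem norm_orbit_mul_le (a b : Fin N → ℂ) (U : UGroup N) :
    ‖orbit (Matrix.diagonal a) U * Matrix.diagonal b‖ ≤ ‖a‖ * ‖b‖ := by
  refine (norm_mul_le _ _).trans ?_
  have h : ‖orbit (Matrix.diagonal a) U‖ = ‖a‖ := by
    rw [orbit, ← Matrix.star_eq_conjTranspose, ← Unitary.coe_star, CStarRing.norm_mul_coe_unitary,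
      CStarRing.norm_coe_unitary_mul, Matrix.l2_opNorm_diagonal]
  rw [h, Matrix.l2_opNorm_diagonal]

theorem exists_eigenvalues_orbit (a b : Fin N → ℂ) (U : UGroup N) : ∃ x : Fin N → ℂ,
    (orbit (Matrix.diagonal a) U * Matrix.diagonal b).charpoly =
      ∏ i, (Polynomial.X - Polynomial.C (x i)) ∧ ∀ i, ‖x i‖ ≤ ‖a‖ * ‖b‖ := by
  obtain ⟨x, hx⟩ := exists_charpoly_eq_prod (orbit (Matrix.diagonal a) U * Matrix.diagonal b)
  exact ⟨x, hx, fun i => (norm_le_of_charpoly hx i).trans (norm_orbit_mul_le a b U)⟩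

end Eigenvalues

/-! ### Binomial series -/

section Binomial

/-- The coefficient `(M)_n / n!` of the binomial series. -/
def risingCoeff (M : ℂ) (n : ℕ) : ℂ := (ascPochhammer ℂ n).eval M / n !

theorem hasSum_risingCoeff (M : ℂ) {x : ℂ} (hx : ‖x‖ < 1) :
    HasSum (fun n => risingCoeff M n * x ^ n) ((1 - x) ^ (-M)) := by
  have h1 := (Complex.one_div_one_sub_cpow_hasFPowerSeriesOnBall_zero M).hasSum (y := x)
    (by simpa [enorm_eq_nnnorm, ← NNReal.coe_lt_one] using hx)
  simp only [FormalMultilinearSeries.ofScalars_apply_eq, zero_add, smul_eq_mul] at h1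
  rw [Complex.cpow_neg, ← one_div]
  refine h1.congr_fun fun n => ?_
  have h2 := Ring.factorial_nsmul_multichoose_eq_ascPochhammer M n
  rw [nsmul_eq_mul, Polynomial.ascPochhammer_smeval_eq_eval] at h2
  rw [← Ring.multichoose_eq, risingCoeff, ← h2,
    mul_div_cancel_left₀ _ (by exact_mod_cast Nat.factorial_ne_zero n)]

theorem summable_norm_risingCoeff (M : ℂ) {x : ℂ} (hx : ‖x‖ < 1) :
    Summable fun n => ‖risingCoeff M n * x ^ n‖ :=
  (hasSum_risingCoeff M hx).summable.norm

theorem spec_const_mul_pow_complete (M x : ℂ) (n : ℕ) :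
    spec (fun k => M * x ^ k) (complete n) = risingCoeff M n * x ^ n := by
  have := congrArg (PowerSeries.coeff n) (completeSeries_const_mul_pow M x)
  rwa [coeff_completeSeries, PowerSeries.coeff_mk] at this

theorem spec_complete_eq (t : ℕ → ℂ) (n : ℕ) :
    spec t (complete n) = ∑ μ : n.Partition, (zee μ : ℂ)⁻¹ * (μ.parts.map t).prod := by
  rw [complete, map_sum]
  refine Finset.sum_congr rfl fun μ _ => ?_
  rw [map_smul, spec_psumPart, smul_eq_mul]

/-- The coefficients 1/Z_μ of h_n are positive, so h_n at t is majorized by its value at K r^k, a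
binomial coefficient times r^n. -/
theorem norm_spec_complete_le {t : ℕ → ℂ} {K r : ℝ} (hK : 0 ≤ K) (hr : 0 ≤ r)
    (ht : ∀ k, 0 < k → ‖t k‖ ≤ K * r ^ k) (n : ℕ) :
    ‖spec t (complete n)‖ ≤ ‖risingCoeff K n * (r : ℂ) ^ n‖ := by
  have h1 : risingCoeff K n * (r : ℂ) ^ n =
      ((∑ μ : n.Partition, (zee μ : ℝ)⁻¹ * (μ.parts.map fun k => K * r ^ k).prod : ℝ) : ℂ) := by
    rw [← spec_const_mul_pow_complete, spec_complete_eq, Complex.ofReal_sum]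
    refine Finset.sum_congr rfl fun μ _ => ?_
    rw [Complex.ofReal_mul, Complex.ofReal_inv, Complex.ofReal_natCast]
    congr 1
    refine Eq.trans ?_ (map_multiset_prod Complex.ofRealHom _).symm
    rw [Multiset.map_map]
    simp
  rw [h1, Complex.norm_real, spec_complete_eq]
  refine (norm_sum_le _ _).trans ((Finset.sum_le_sum fun μ _ => ?_).trans (le_abs_self _))
  rw [norm_mul, norm_inv, Complex.norm_natCast]
  refine mul_le_mul_of_nonneg_left ?_ (by positivity)
  have : ∀ s : Multiset ℕ, (∀ k ∈ s, 0 < k) →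
      ‖(s.map t).prod‖ ≤ (s.map fun k => K * r ^ k).prod := by
    intro s hs
    induction s using Multiset.induction with
    | empty => simp
    | cons k s ih =>
      rw [Multiset.map_cons, Multiset.map_cons, Multiset.prod_cons, Multiset.prod_cons, norm_mul]
      exact mul_le_mul (ht k (hs k (Multiset.mem_cons_self k s)))
        (ih fun j hj => hs j (Multiset.mem_cons_of_mem hj)) (norm_nonneg _) (by positivity)
  exact this _ fun _ hk => μ.parts_pos hk

variable {N : ℕ}

/-- A factor M for each cycle rescales every power sum by M, and h_n is the average of P_{cyc(g)}
over S_n. -/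
theorem powTrace_eq (M : ℂ) (n : ℕ) (X : Matrix (Fin N) (Fin N) ℂ) :
    powTrace M n X = n ! * spec (fun k => M * (X ^ k).trace) (complete n) := by
  have hn : (n ! : ℂ) ≠ 0 := by exact_mod_cast Nat.factorial_ne_zero n
  rw [← charMap_sum_perm, map_sum, map_sum, Finset.mul_sum]
  refine Finset.sum_congr rfl fun g _ => ?_
  rw [charMap_perm, map_smul, smul_eq_mul, mul_inv_cancel_left₀ hn, spec_psumPart,
    Multiset.prod_map_mul, permTrace_eq_prod, numCycles, Multiset.map_const', Multiset.prod_replicate]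

/-- The expansion of `∏ (1 - q x_i)^{-M}`. -/
theorem hasSum_prod_cpow (M q : ℂ) (s : Finset (Fin N)) {x : Fin N → ℂ} (hx : ∀ i, ‖q * x i‖ < 1) :
    HasSum (fun n => q ^ n * spec (fun k => ∑ i ∈ s, M * x i ^ k) (complete n))
        (∏ i ∈ s, (1 - q * x i) ^ (-M)) ∧
      Summable fun n => ‖q ^ n * spec (fun k => ∑ i ∈ s, M * x i ^ k) (complete n)‖ := by
  suffices h : HasSum (fun n => q ^ n * spec (fun k => ∑ i ∈ s, M * x i ^ k) (complete n))
      (∏ i ∈ s, (1 - q * x i) ^ (-M)) from ⟨h, h.summable.norm⟩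
  classical
  induction s using Finset.induction with
  | empty =>
    have h1 : ∀ n, spec (fun _ : ℕ => (0 : ℂ)) (complete n) = if n = 0 then 1 else 0 := by
      intro n
      have := congrArg (PowerSeries.coeff n) (completeSeries_zero (S := ℂ))
      rwa [coeff_completeSeries, PowerSeries.coeff_one] at this
    simp only [Finset.sum_empty, Finset.prod_empty, h1]
    refine (hasSum_ite_eq (0 : ℕ) (1 : ℂ)).congr_fun fun n => ?_
    split_ifs with h <;> simp [h]
  | insert i s hi ih =>
    have h1 := hasSum_risingCoeff M (hx i)
    have h2 := (summable_norm_sum_mul_antidiagonal_of_summable_norm h1.summable.norm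
      ih.summable.norm).of_norm.hasSum
    rw [← tsum_mul_tsum_eq_tsum_sum_antidiagonal_of_summable_norm h1.summable.norm
      ih.summable.norm, h1.tsum_eq, ih.tsum_eq] at h2
    rw [Finset.prod_insert hi]
    refine h2.congr_fun fun n => ?_
    have h3 := congrArg (PowerSeries.coeff n)
      (completeSeries_add (fun k => M * x i ^ k) fun k => ∑ j ∈ s, M * x j ^ k)
    simp only [Finset.sum_insert hi]
    rw [coeff_completeSeries, PowerSeries.coeff_mul] at h3
    rw [h3, Finset.mul_sum]
    refine Finset.sum_congr rfl fun p hp => ?_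
    rw [coeff_completeSeries, coeff_completeSeries, spec_const_mul_pow_complete,
      ← Finset.HasAntidiagonal.mem_antidiagonal.1 hp]
    ring

end Binomial

end MonotoneHurwitz
end

noncomputable section

namespace MonotoneHurwitz

/-! ### The expansion of the matrix integral -/

section MatrixIntegral

variable {N : ℕ}

/-- The coefficient of `q ^ n` in the matrix integral. -/
def integralCoeff (α : ℂ) (a b : Fin N → ℂ) (n : ℕ) : ℂ :=
  ∑ ν : n.Partition with Multiset.card ν.parts ≤ N,
    hookRatio α N ν * (specVars a (schur ν) * specVars b (schur ν))

/-- The degree `n` part of the integrand at `q = 1`. -/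
def integrandTerm (α : ℂ) (a b : Fin N → ℂ) (n : ℕ) (U : UGroup N) : ℂ :=
  (n ! : ℂ)⁻¹ * powTrace (N - α) n (orbit (Matrix.diagonal a) U * Matrix.diagonal b)

variable (α : ℂ) (a b : Fin N → ℂ)

theorem continuous_integrandTerm (n : ℕ) : Continuous (integrandTerm α a b n) := by
  have h : Continuous fun U => orbit (Matrix.diagonal a) U * Matrix.diagonal b :=
    (continuous_orbit _).matrix_mul continuous_const
  unfold integrandTerm powTrace permTrace
  exact continuous_const.mul (continuous_finsetSum _ fun g _ => continuous_const.mul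
    (continuous_finsetSum _ fun w _ => continuous_finsetProd _ fun k _ => h.matrix_elem _ _))

theorem integral_integrandTerm (n : ℕ) :
    ∫ U, integrandTerm α a b n U ∂(unitaryHaar N) = integralCoeff α a b n := by
  have hn : (n ! : ℂ) ≠ 0 := by exact_mod_cast Nat.factorial_ne_zero n
  have h1 : ∀ U, integrandTerm α a b n U =
      (n ! : ℂ)⁻¹ * powTrace (N - α) n (Matrix.diagonal b * orbit (Matrix.diagonal a) U) := by
    intro U
    simp only [integrandTerm, powTrace]
    congr 1
    exact Finset.sum_congr rfl fun g _ => by rw [permTrace_mul_comm]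
  simp only [h1]
  rw [integral_const_mul, integral_powTrace, wordPoly_avgCoeff, inv_mul_cancel_left₀ hn,
    specMatrix_diagonal]
  rfl

/-- All eigenvalues of q U A U† B lie in the open unit disc, where the binomial series apply. The
majorant does not depend on U. -/
theorem hasSum_integrandTerm {q : ℂ} (hq : ‖q‖ * (‖a‖ * ‖b‖) < 1) (U : UGroup N) :
    HasSum (fun n => q ^ n * integrandTerm α a b n U) (integrand N α q a b U) ∧
      ∀ n, ‖q ^ n * integrandTerm α a b n U‖ ≤
        ‖risingCoeff ((‖(N : ℂ) - α‖ * N : ℝ) : ℂ) n * ((‖q‖ * (‖a‖ * ‖b‖) : ℝ) : ℂ) ^ n‖ := by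
  obtain ⟨x, hx, hxr⟩ := exists_eigenvalues_orbit a b U
  have hx1 : ∀ i, ‖q * x i‖ < 1 := fun i => by
    rw [norm_mul]
    exact (mul_le_mul_of_nonneg_left (hxr i) (norm_nonneg q)).trans_lt hq
  have h1 : ∀ n, integrandTerm α a b n U =
      spec (fun k => ∑ i, ((N : ℂ) - α) * x i ^ k) (complete n) := by
    intro n
    rw [integrandTerm, powTrace_eq, inv_mul_cancel_left₀ (by exact_mod_cast Nat.factorial_ne_zero n)]
    congr 2
    funext k
    rw [trace_pow hx, Finset.mul_sum]
  refine ⟨?_, fun n => ?_⟩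
  · have h2 := (hasSum_prod_cpow ((N : ℂ) - α) q Finset.univ hx1).1
    have h3 : integrand N α q a b U = ∏ i, (1 - q * x i) ^ (-((N : ℂ) - α)) := by
      rw [neg_sub]
      exact detPow_one_sub_smul hx q (α - N)
    rw [h3]
    exact h2.congr_fun fun n => by rw [h1]
  · have h2 := norm_spec_complete_le (t := fun k => ∑ i, ((N : ℂ) - α) * x i ^ k)
      (K := ‖(N : ℂ) - α‖ * N) (r := ‖a‖ * ‖b‖) (by positivity) (by positivity) (fun k _ => by
        rw [← Finset.mul_sum, norm_mul, mul_assoc]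
        refine mul_le_mul_of_nonneg_left ?_ (norm_nonneg _)
        refine (norm_sum_le _ _).trans ((Finset.sum_le_card_nsmul _ _ ((‖a‖ * ‖b‖) ^ k)
          fun i _ => ?_).trans_eq (by simp))
        rw [norm_pow]
        exact pow_le_pow_left₀ (norm_nonneg _) (hxr i) k) n
    rw [h1, norm_mul, Complex.ofReal_mul ‖q‖, mul_pow, mul_left_comm, norm_mul (_ ^ n), norm_pow,
      norm_pow, Complex.norm_real, norm_norm]
    exact mul_le_mul_of_nonneg_left h2 (by positivity)

/-- Uniform convergence on the compact group gives continuity of the integrand and permits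
integration term by term. -/
theorem integrable_integrand {q : ℂ} (hq : ‖q‖ * (‖a‖ * ‖b‖) < 1) :
    Integrable (integrand N α q a b) (unitaryHaar N) ∧
      HasSum (fun n => integralCoeff α a b n * q ^ n) (matrixIntegral N α q a b) := by
  have hs : Summable fun n => ‖risingCoeff ((‖(N : ℂ) - α‖ * N : ℝ) : ℂ) n *
      ((‖q‖ * (‖a‖ * ‖b‖) : ℝ) : ℂ) ^ n‖ := by
    refine summable_norm_risingCoeff _ ?_
    rw [Complex.norm_real, Real.norm_of_nonneg (by positivity)]
    exact hq
  have hcont : ∀ n, Continuous fun U => q ^ n * integrandTerm α a b n U := fun n =>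
    continuous_const.mul (continuous_integrandTerm α a b n)
  have h1 : integrand N α q a b = fun U => ∑' n, q ^ n * integrandTerm α a b n U :=
    funext fun U => (hasSum_integrandTerm α a b hq U).1.tsum_eq.symm
  have hint : Continuous (integrand N α q a b) := by
    rw [h1]
    exact continuous_tsum hcont hs fun n U => (hasSum_integrandTerm α a b hq U).2 n
  refine ⟨integrable_unitaryHaar hint, ?_⟩
  have h2 := hasSum_integral_of_summable_integral_norm (μ := unitaryHaar N)
    (F := fun n U => q ^ n * integrandTerm α a b n U) (fun n => integrable_unitaryHaar (hcont n)) (by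
      refine Summable.of_nonneg_of_le (fun n => integral_nonneg fun U => norm_nonneg _)
        (fun n => ?_) hs
      refine (integral_mono (integrable_unitaryHaar (hcont n)).norm (integrable_const _)
        fun U => (hasSum_integrandTerm α a b hq U).2 n).trans_eq ?_
      simp)
  rw [matrixIntegral, h1]
  refine h2.congr_fun fun n => ?_
  rw [integral_const_mul, integral_integrandTerm, mul_comm]

theorem norm_mul_norm_lt_one (hN : 0 < N) {q : ℂ} (h : ∀ i j, ‖q * a i * b j‖ < 1) :
    ‖q‖ * (‖a‖ * ‖b‖) < 1 := by
  have : Nonempty (Fin N) := ⟨⟨0, hN⟩⟩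
  have key : ∀ c : Fin N → ℂ, ∃ i, ‖c‖ = ‖c i‖ := by
    intro c
    obtain ⟨i, hi⟩ := Finite.exists_max fun i => ‖c i‖
    exact ⟨i, le_antisymm ((pi_norm_le_iff_of_nonneg (norm_nonneg _)).2 hi) (norm_le_pi_norm c i)⟩
  obtain ⟨i, hi⟩ := key a
  obtain ⟨j, hj⟩ := key b
  rw [hi, hj, ← norm_mul, ← norm_mul, ← mul_assoc]
  exact h i j

end MatrixIntegral

/-! ### Absolute convergence -/

section Convergence

variable {N n : ℕ}

theorem specVars_conj_complete (a : Fin N → ℂ) (n : ℕ) :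
    specVars (fun i => starRingEnd ℂ (a i)) (complete n) =
      starRingEnd ℂ (specVars a (complete n)) := by
  rw [specVars, specVars, spec_complete_eq, spec_complete_eq, map_sum]
  refine Finset.sum_congr rfl fun μ _ => ?_
  rw [map_mul, map_inv₀, map_natCast, map_multiset_prod, Multiset.map_map]
  congr 2
  refine Multiset.map_congr rfl fun k _ => ?_
  simp

theorem specVars_conj_schur (a : Fin N → ℂ) (ν : n.Partition) :
    specVars (fun i => starRingEnd ℂ (a i)) (schur ν) = starRingEnd ℂ (specVars a (schur ν)) := by
  rw [schur, AlgHom.map_det, AlgHom.map_det, RingHom.map_det]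
  congr 1
  ext i j
  simp only [AlgHom.mapMatrix_apply, RingHom.mapMatrix_apply, Matrix.map_apply, Matrix.of_apply,
    completeInt]
  split_ifs
  · simp
  · exact specVars_conj_complete a _

/-- The Cauchy identity at the conjugate alphabet turns the sum of squares into one value of h_n.
Cauchy-Schwarz then handles two alphabets. -/
theorem sum_norm_schur_sq_le (a : Fin N → ℂ) (n : ℕ) :
    ∑ ν : n.Partition with Multiset.card ν.parts ≤ N, ‖specVars a (schur ν)‖ ^ 2 ≤
      ‖risingCoeff (((N : ℝ) * N : ℝ) : ℂ) n * ((‖a‖ * ‖a‖ : ℝ) : ℂ) ^ n‖ := by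
  have h1 := spec_mul_complete (fun k => ∑ i, a i ^ k) (fun i => starRingEnd ℂ (a i)) n
  have h2 : ((∑ ν : n.Partition with Multiset.card ν.parts ≤ N,
      ‖specVars a (schur ν)‖ ^ 2 : ℝ) : ℂ) =
      spec (fun k => (∑ i, a i ^ k) * ∑ i, (starRingEnd ℂ (a i)) ^ k) (complete n) := by
    rw [h1, Complex.ofReal_sum]
    refine Finset.sum_congr rfl fun ν _ => ?_
    rw [specVars_conj_schur, Complex.mul_conj, Complex.normSq_eq_norm_sq]
  have hpow : ∀ c : Fin N → ℂ, (∀ i, ‖c i‖ ≤ ‖a‖) → ∀ k, ‖∑ i, c i ^ k‖ ≤ N * ‖a‖ ^ k := by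
    intro c hc k
    refine (norm_sum_le _ _).trans ((Finset.sum_le_card_nsmul _ _ (‖a‖ ^ k)
      fun i _ => ?_).trans_eq (by simp))
    rw [norm_pow]
    exact pow_le_pow_left₀ (norm_nonneg _) (hc i) k
  have h3 := norm_spec_complete_le
    (t := fun k => (∑ i, a i ^ k) * ∑ i, (starRingEnd ℂ (a i)) ^ k)
    (K := (N : ℝ) * N) (r := ‖a‖ * ‖a‖) (by positivity) (by positivity) (fun k _ => by
      rw [norm_mul, mul_pow, mul_mul_mul_comm]
      exact mul_le_mul (hpow a (norm_le_pi_norm a) k)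
        (hpow _ (fun i => by rw [Complex.norm_conj]; exact norm_le_pi_norm a i) k)
        (norm_nonneg _) (by positivity)) n
  rw [← h2, Complex.norm_real] at h3
  exact (le_abs_self _).trans h3

theorem sum_norm_schur_mul_le (a b : Fin N → ℂ) (n : ℕ) :
    ∑ ν : n.Partition with Multiset.card ν.parts ≤ N,
        ‖specVars a (schur ν)‖ * ‖specVars b (schur ν)‖ ≤
      ‖risingCoeff (((N : ℝ) * N : ℝ) : ℂ) n‖ * (‖a‖ * ‖b‖) ^ n := by
  refine le_of_sq_le_sq ((Finset.sum_mul_sq_le_sq_mul_sq _ _ _).trans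
    ((mul_le_mul (sum_norm_schur_sq_le a n) (sum_norm_schur_sq_le b n)
      (Finset.sum_nonneg fun _ _ => by positivity) (norm_nonneg _)).trans_eq ?_)) (by positivity)
  rw [norm_mul, norm_mul, norm_pow, norm_pow, Complex.norm_real, Complex.norm_real,
    Real.norm_of_nonneg (by positivity), Real.norm_of_nonneg (by positivity)]
  ring

/-- A bound for the rows of the content products. -/
def rowBound (α : ℂ) (n : ℕ) : ℝ := ∏ j ∈ Finset.range n, (1 + ‖α‖ / (j + 1))

/-- In row i < N the denominator N + j - i is at least j + 1, which bounds each factor independently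
of the row. The product is then extended from the diagram to the N × n rectangle, the added factors
being at least 1. -/
theorem norm_hookRatio_le (α : ℂ) {ν : n.Partition} (h : Multiset.card ν.parts ≤ N) :
    ‖hookRatio α N ν‖ ≤ rowBound α n ^ N := by
  have hsub : cells ν ⊆ Finset.range N ×ˢ Finset.range n := by
    intro c hc
    have h1 := Finset.mem_filter.1 hc
    have h2 := Finset.mem_product.1 h1.1
    refine Finset.mem_product.2 ⟨Finset.mem_range.2 ?_, h2.2⟩
    by_contra hlt
    have h3 := (row_eq_zero_iff ν c.1).2 (h.trans (not_lt.1 hlt))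
    omega
  have h1 : ‖hookRatio α N ν‖ ≤ ∏ c ∈ cells ν, (1 + ‖α‖ / ((c.2 : ℝ) + 1)) := by
    rw [hookRatio, norm_prod]
    refine Finset.prod_le_prod (fun _ _ => norm_nonneg _) fun c hc => ?_
    have h2 : c.1 < N := Finset.mem_range.1 (Finset.mem_product.1 (hsub hc)).1
    have h3 : (c.2 : ℝ) + 1 ≤ (N : ℝ) + c.2 - c.1 := by
      have : (c.1 : ℝ) + 1 ≤ N := by exact_mod_cast h2
      linarith
    have h4 : (N : ℂ) + content c = ((N + c.2 - c.1 : ℝ) : ℂ) := by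
      simp only [content]; push_cast; ring
    have h5 : (0 : ℝ) < N + c.2 - c.1 := lt_of_lt_of_le (by positivity) h3
    have h6 : ((N + c.2 - c.1 : ℝ) : ℂ) ≠ 0 := by exact_mod_cast h5.ne'
    rw [sub_add_eq_add_sub, h4, sub_div, div_self h6]
    refine (norm_sub_le _ _).trans ?_
    rw [norm_one, norm_div, Complex.norm_real, Real.norm_of_nonneg h5.le]
    gcongr
  refine h1.trans ?_
  have h7 : rowBound α n ^ N =
      ∏ c ∈ Finset.range N ×ˢ Finset.range n, (1 + ‖α‖ / ((c.2 : ℝ) + 1)) := by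
    simp [Finset.prod_product, rowBound]
  have h8 : ∀ c : ℕ × ℕ, 1 ≤ 1 + ‖α‖ / ((c.2 : ℝ) + 1) := fun c => by
    have : 0 ≤ ‖α‖ / ((c.2 : ℝ) + 1) := by positivity
    linarith
  rw [h7, ← Finset.prod_sdiff hsub]
  refine le_mul_of_one_le_left (Finset.prod_nonneg fun c _ => zero_le_one.trans (h8 c)) ?_
  exact Finset.one_le_prod fun c _ => h8 c

theorem summable_rowBound_mul (α : ℂ) (hN : 0 < N) {x : ℝ} (hx0 : 0 ≤ x) (hx : x < 1) :
    Summable fun n => rowBound α n ^ N * (‖risingCoeff (((N : ℝ) * N : ℝ) : ℂ) n‖ * x ^ n) := by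
  -- The ratio test needs nonzero terms, whereas x may be 0, so it is applied to a larger y < 1.
  obtain ⟨y, hxy, hy⟩ := exists_between hx
  have hy0 : 0 < y := hx0.trans_lt hxy
  have hrow : ∀ n, 0 < rowBound α n := fun n => Finset.prod_pos fun j _ => by positivity
  have hK : (0 : ℝ) < (N : ℝ) * N := by positivity
  have hrc : ∀ n, ‖risingCoeff (((N : ℝ) * N : ℝ) : ℂ) (n + 1)‖ =
      ‖risingCoeff (((N : ℝ) * N : ℝ) : ℂ) n‖ * (((N : ℝ) * N + n) / (n + 1)) := by
    intro n
    have h : risingCoeff (((N : ℝ) * N : ℝ) : ℂ) (n + 1) =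
        risingCoeff (((N : ℝ) * N : ℝ) : ℂ) n * ((((N : ℝ) * N + n) / (n + 1) : ℝ) : ℂ) := by
      rw [risingCoeff, risingCoeff, ascPochhammer_succ_eval, Nat.factorial_succ, div_mul_eq_mul_div,
        div_eq_div_iff (by exact_mod_cast (Nat.factorial_ne_zero (n + 1)))
          (by exact_mod_cast Nat.factorial_ne_zero n)]
      have : (n : ℂ) + 1 ≠ 0 := by exact_mod_cast n.succ_ne_zero
      push_cast
      field_simp
    rw [h, norm_mul, Complex.norm_real, Real.norm_of_nonneg (by positivity)]
  have hpos : ∀ n, 0 < ‖risingCoeff (((N : ℝ) * N : ℝ) : ℂ) n‖ := by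
    intro n
    induction n with
    | zero => simp [risingCoeff]
    | succ n ih => rw [hrc]; positivity
  have hs : Summable fun n => rowBound α n ^ N *
      (‖risingCoeff (((N : ℝ) * N : ℝ) : ℂ) n‖ * y ^ n) := by
    refine summable_of_ratio_test_tendsto_lt_one hy (Filter.Eventually.of_forall fun n => ?_)
      (?_ : Filter.Tendsto _ _ (nhds y))
    · have := hrow n; have := hpos n; positivity
    · have h1 : ∀ n : ℕ, ‖rowBound α (n + 1) ^ N *
          (‖risingCoeff (((N : ℝ) * N : ℝ) : ℂ) (n + 1)‖ * y ^ (n + 1))‖ /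
          ‖rowBound α n ^ N * (‖risingCoeff (((N : ℝ) * N : ℝ) : ℂ) n‖ * y ^ n)‖ =
          (1 + ‖α‖ / ((n : ℝ) + 1)) ^ N * ((1 + ((N : ℝ) * N - 1) / (n + 1)) * y) := by
        intro n
        have h3 : rowBound α (n + 1) = rowBound α n * (1 + ‖α‖ / ((n : ℝ) + 1)) :=
          Finset.prod_range_succ _ _
        have h4 := hrow n
        have h5 := hpos n
        rw [Real.norm_of_nonneg (by have := hrow (n + 1); positivity),
          Real.norm_of_nonneg (by positivity), h3, hrc]
        have h6 : 1 + ((N : ℝ) * N - 1) / (n + 1) = ((N : ℝ) * N + n) / (n + 1) := by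
          field_simp
          ring
        rw [h6, mul_pow, pow_succ y]
        clear hrc hpos
        generalize ‖risingCoeff (((N : ℝ) * N : ℝ) : ℂ) n‖ = R at h5 ⊢
        field_simp
      simp only [h1]
      have h2 : ∀ c : ℝ, Filter.Tendsto (fun n : ℕ => 1 + c / ((n : ℝ) + 1)) Filter.atTop
          (nhds 1) := by
        intro c
        have := (tendsto_const_div_atTop_nhds_zero_nat c).comp (Filter.tendsto_add_atTop_nat 1)
        simpa using this.const_add 1
      simpa using ((h2 ‖α‖).pow N).mul ((h2 ((N : ℝ) * N - 1)).mul_const y)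
  refine Summable.of_nonneg_of_le (fun n => ?_) (fun n => ?_) hs
  · have := hrow n; positivity
  · have := hrow n
    gcongr

end Convergence

end MonotoneHurwitz
end

noncomputable section

namespace MonotoneHurwitz

/-! ### Summation of the generating functions -/

section GeneratingFunctions

theorem homog_succ_right {R : Type*} [CommRing R] (c : ℕ → R) (k m : ℕ) : homog c k (m + 1) =
    ∑ p ∈ Finset.HasAntidiagonal.antidiagonal k, c m ^ p.1 * homog c p.2 m := by
  induction k with
  | zero => simp
  | succ k ih =>
    rw [homog_succ_succ, ih, Finset.Nat.antidiagonal_succ, Finset.sum_cons, Finset.sum_map,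
      Finset.mul_sum]
    congr 1
    · simp
    · refine Finset.sum_congr rfl fun p _ => ?_
      simp only [Function.Embedding.prodMap, Function.Embedding.coeFn_mk, Prod.map_fst, Prod.map_snd,
        Nat.succ_eq_add_one, Function.Embedding.refl_apply]
      ring

theorem hasSum_homog {z : ℂ} {c : ℕ → ℂ} {m : ℕ} (hc : ∀ b < m, ‖c b * z‖ < 1) :
    HasSum (fun k => z ^ k * homog c k m) (∏ b ∈ Finset.range m, (1 - c b * z)⁻¹) := by
  induction m with
  | zero =>
    have h : ∀ k, z ^ k * homog c k 0 = if k = 0 then 1 else 0 := by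
      intro k
      cases k <;> simp
    simp only [h, Finset.range_zero, Finset.prod_empty]
    exact hasSum_ite_eq 0 1
  | succ m ih =>
    have h1 := hasSum_geometric_of_norm_lt_one (hc m m.lt_succ_self)
    have h2 := ih fun b hb => hc b (hb.trans m.lt_succ_self)
    have h3 := (summable_norm_sum_mul_antidiagonal_of_summable_norm h1.summable.norm
      h2.summable.norm).of_norm.hasSum
    rw [← tsum_mul_tsum_eq_tsum_sum_antidiagonal_of_summable_norm h1.summable.norm
      h2.summable.norm, h1.tsum_eq, h2.tsum_eq] at h3
    rw [Finset.prod_range_succ, mul_comm]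
    refine h3.congr_fun fun k => ?_
    rw [homog_succ_right, Finset.mul_sum]
    refine Finset.sum_congr rfl fun p hp => ?_
    rw [← Finset.HasAntidiagonal.mem_antidiagonal.1 hp]
    ring

theorem sum_elem (w : ℂ) (c : ℕ → ℂ) (m : ℕ) :
    ∑ l ∈ Finset.range (m + 1), w ^ l * elem c l m = ∏ b ∈ Finset.range m, (1 + c b * w) := by
  induction m with
  | zero => simp
  | succ m ih =>
    have h1 : ∑ l ∈ Finset.range (m + 1), w ^ l * elem c l m =
        ∑ l ∈ Finset.range (m + 1), w ^ (l + 1) * elem c (l + 1) m + 1 := by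
      rw [← add_zero (∑ l ∈ Finset.range (m + 1), w ^ l * elem c l m),
        ← mul_zero (w ^ (m + 1)), ← elem_eq_zero c m.lt_succ_self, ← Finset.sum_range_succ,
        Finset.sum_range_succ']
      simp
    rw [Finset.prod_range_succ, ← ih, mul_add, mul_one, Finset.sum_range_succ']
    conv_rhs => rw [h1]
    simp only [elem_succ_succ, mul_add, Finset.sum_add_distrib, elem_zero_left, pow_zero, mul_one]
    rw [add_right_comm]
    congr 1
    rw [← h1, Finset.sum_mul]
    exact Finset.sum_congr rfl fun l _ => by ring

theorem hasSum_elem (w : ℂ) (c : ℕ → ℂ) (m : ℕ) :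
    HasSum (fun l => w ^ l * elem c l m) (∏ b ∈ Finset.range m, (1 + c b * w)) := by
  rw [← sum_elem]
  refine hasSum_sum_of_ne_finset_zero fun l hl => ?_
  rw [elem_eq_zero c (by simpa [Nat.lt_succ_iff] using hl), mul_zero]

theorem abs_content_lt {n : ℕ} {ν : n.Partition} {c : ℕ × ℕ} (hc : c ∈ cells ν) :
    |content c| < n := by
  have h := Finset.mem_product.1 (Finset.mem_filter.1 hc).1
  have h1 := Finset.mem_range.1 h.1
  have h2 := Finset.mem_range.1 h.2
  rw [content, abs_lt]
  omega

theorem norm_contentSeq_lt {n : ℕ} (ν : n.Partition) {b : ℕ} (hb : b < n) :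
    ‖contentSeq ν b‖ < n := by
  have h1 : contentSeq ν b ∈ (cells ν).val.map (fun x => (content x : ℂ)) := by
    rw [isContentSeq_contentSeq ν]
    exact Multiset.mem_map_of_mem (fun b : Fin n => contentSeq ν b)
      (Finset.mem_univ_val (⟨b, hb⟩ : Fin n))
  obtain ⟨x, hx, hxb⟩ := Multiset.mem_map.1 h1
  have h2 : |content x| < n := abs_content_lt hx
  rw [← hxb, Complex.norm_intCast]
  exact_mod_cast h2

theorem hasSum_mul_prod {f g : ℕ → ℂ} {s t : ℂ} (hf : HasSum f s) (hg : HasSum g t) :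
    HasSum (fun x : ℕ × ℕ => f x.1 * g x.2) (s * t) :=
  hf.mul hg (summable_mul_of_summable_norm hf.summable.norm hg.summable.norm)

/-- The power series `r_λ(z, w)` sums to `r_λ(z, w)` near the origin. -/
theorem hasSum_contentSeries {n : ℕ} (ν : n.Partition) {z : ℂ} (w : ℂ) (hz : n * ‖z‖ ≤ 1) :
    HasSum (fun kl : ℕ × ℕ => z ^ kl.1 * w ^ kl.2 *
      MvPowerSeries.coeff (expo kl.1 kl.2) (contentSeries ν)) (contentProd ν z w) := by
  -- Contents are strictly smaller than n in absolute value, so the boundary case n‖z‖ = 1, which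
  -- occurs for z = -1/N and n = N, is still admissible.
  have hc : ∀ b < n, ‖contentSeq ν b * z‖ < 1 := by
    intro b hb
    rw [norm_mul]
    rcases (norm_nonneg z).eq_or_lt with h0 | h0
    · rw [← h0, mul_zero]; exact one_pos
    · exact (mul_lt_mul_of_pos_right (norm_contentSeq_lt ν hb) h0).trans_le hz
  have h1 := hasSum_homog hc
  have h2 := hasSum_elem w (contentSeq ν) n
  have h3 := hasSum_mul_prod h1 h2
  have h4 : contentProd ν z w = (∏ b ∈ Finset.range n, (1 - contentSeq ν b * z)⁻¹) *
      ∏ b ∈ Finset.range n, (1 + contentSeq ν b * w) := by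
    rw [contentProd, (isContentSeq_contentSeq ν).prod_eq fun c => (1 + c * w) / (1 - c * z),
      ← Finset.prod_mul_distrib,
      ← Fin.prod_univ_eq_prod_range (fun b =>
        (1 - contentSeq ν b * z)⁻¹ * (1 + contentSeq ν b * w)) n]
    exact Finset.prod_congr rfl fun b _ => by rw [div_eq_inv_mul]
  have h5 : ∀ kl : ℕ × ℕ, z ^ kl.1 * w ^ kl.2 *
      MvPowerSeries.coeff (expo kl.1 kl.2) (contentSeries ν) =
      z ^ kl.1 * homog (contentSeq ν) kl.1 n * (w ^ kl.2 * elem (contentSeq ν) kl.2 n) := by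
    intro kl
    rw [coeff_contentSeries]
    ring
  simp only [h5]
  rw [h4]
  exact h3

/-- The two expansions in Λ ⊗ Λ are compared at q = 1 and evaluated at the two alphabets. -/
theorem sum_mixedHurwitz_mul_eq {n N : ℕ} (a b : Fin N → ℂ) (k l : ℕ) :
    ∑ ν : n.Partition, ∑ μ : n.Partition, mixedHurwitz k l ν μ / (zee μ : ℂ) *
        evalAt a (psumPart ν) * evalAt b (psumPart μ) =
      ∑ ν : n.Partition, MvPowerSeries.coeff (expo k l) (contentSeries ν) *
        (specVars a (schur ν) * specVars b (schur ν)) := by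
  have h := congrArg (spec₂ (fun k => ∑ i, a i ^ k) fun k => ∑ i, b i ^ k)
    ((charMap₂_twist_eq_psum (n := n) k l 1).symm.trans (charMap₂_twist_eq_schur k l 1))
  simp only [map_sum, map_smul, spec₂_tmul, one_pow, one_mul, smul_eq_mul] at h
  rw [← h]
  refine Finset.sum_congr rfl fun ν _ => Finset.sum_congr rfl fun μ _ => ?_
  rw [evalAt_eq, evalAt_eq, mul_assoc]

/-- The condition n ≤ N serves twice: the restriction to at most N rows in the integral becomes
void, and the series in z converges at -1/N. -/
theorem hasSum_mixedHurwitz {α : ℂ} {N n : ℕ} (hα : ∀ m : ℕ, 0 < m → α ≠ (m : ℂ)) (hN : 0 < N)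
    (hn : n ≤ N) (a b : Fin N → ℂ) :
    HasSum (fun kl : ℕ × ℕ =>
      (1 - α / N) ^ n * (-1 / (N : ℂ)) ^ kl.1 * (1 / ((N : ℂ) - α)) ^ kl.2 *
        ∑ ν : n.Partition, ∑ μ : n.Partition, mixedHurwitz kl.1 kl.2 ν μ / (zee μ : ℂ) *
          evalAt a (psumPart ν) * evalAt b (psumPart μ)) (integralCoeff α a b n) := by
  have hcard : ∀ ν : n.Partition, Multiset.card ν.parts ≤ N := fun ν =>
    (card_parts_le ν).trans hn
  rw [integralCoeff, Finset.filter_true_of_mem fun ν _ => hcard ν]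
  have hz : n * ‖-1 / (N : ℂ)‖ ≤ 1 := by
    rw [norm_div, norm_neg, norm_one, Complex.norm_natCast, mul_one_div]
    exact div_le_one_of_le₀ (by exact_mod_cast hn) (by positivity)
  have h1 : HasSum _ _ := hasSum_sum (s := Finset.univ) fun (ν : n.Partition) _ =>
    ((hasSum_contentSeries ν (1 / ((N : ℂ) - α)) hz).mul_left ((1 - α / N) ^ n)).mul_right
      (specVars a (schur ν) * specVars b (schur ν))
  simp only [pow_mul_contentProd hα hN (hcard _)] at h1
  refine h1.congr_fun fun kl => ?_
  rw [sum_mixedHurwitz_mul_eq, Finset.mul_sum]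
  exact Finset.sum_congr rfl fun ν _ => by ring

/-- The absolutely convergent Schur expansion of the hypergeometric tau function. -/
theorem hasSum_tau {α : ℂ} {N : ℕ} (hα : ∀ m : ℕ, 0 < m → α ≠ (m : ℂ)) (hN : 0 < N) {q : ℂ}
    (hq : q ≠ 0) (a b : Fin N → ℂ) (hab : ‖q‖ * (‖a‖ * ‖b‖) < 1) :
    HasSum (fun ν : Σ n : ℕ, n.Partition =>
        rPart α q N ν.2 * evalAt a (schur ν.2) * evalAt b (schur ν.2))
      (rZero α q N * matrixIntegral N α q a b) := by
  have hzero : ∀ (n : ℕ) (ν : n.Partition), ¬ Multiset.card ν.parts ≤ N →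
      rPart α q N ν * evalAt a (schur ν) * evalAt b (schur ν) = 0 := by
    intro n ν hν
    rw [evalAt_eq, specVars_schur_eq_zero ν (not_le.1 hν), mul_zero, zero_mul]
  have hterm : ∀ (n : ℕ) (ν : n.Partition), Multiset.card ν.parts ≤ N →
      rPart α q N ν * evalAt a (schur ν) * evalAt b (schur ν) = rZero α q N *
        (hookRatio α N ν * (specVars a (schur ν) * specVars b (schur ν)) * q ^ n) := by
    intro n ν hν
    rw [rPart_eq hα hq hν, evalAt_eq, evalAt_eq]
    ring
  have h1 : HasSum (fun n : ℕ => ∑ ν : n.Partition,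
      rPart α q N ν * evalAt a (schur ν) * evalAt b (schur ν))
      (rZero α q N * matrixIntegral N α q a b) := by
    refine ((integrable_integrand α a b hab).2.mul_left (rZero α q N)).congr_fun fun n => ?_
    rw [integralCoeff, Finset.sum_mul, Finset.mul_sum, ← Finset.sum_filter_of_ne
      fun ν _ hne => not_not.1 fun hν => hne (hzero n ν hν)]
    exact Finset.sum_congr rfl fun ν hν => hterm n ν (Finset.mem_filter.1 hν).2
  -- The integral only provides the sum with partitions grouped by size; ungrouping them requires
  -- absolute convergence, bounded degree by degree.
  refine h1.sigma_of_hasSum (fun n => hasSum_fintype _) (Summable.of_norm ?_)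
  rw [summable_sigma_of_nonneg fun _ => norm_nonneg _]
  refine ⟨fun n => Summable.of_finite, ?_⟩
  refine Summable.of_nonneg_of_le (fun n => tsum_nonneg fun _ => norm_nonneg _) (fun n => ?_)
    ((summable_rowBound_mul α hN (x := ‖q‖ * (‖a‖ * ‖b‖)) (by positivity) hab).mul_left
      ‖rZero α q N‖)
  rw [tsum_fintype, ← Finset.sum_filter_of_ne (p := fun ν => Multiset.card ν.parts ≤ N)
    fun ν _ hne => not_not.1 fun hν => hne (by rw [hzero n ν hν, norm_zero])]
  calc _ ≤ ∑ ν : n.Partition with Multiset.card ν.parts ≤ N, ‖rZero α q N‖ *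
        (rowBound α n ^ N * (‖specVars a (schur ν)‖ * ‖specVars b (schur ν)‖) * ‖q‖ ^ n) := by
        refine Finset.sum_le_sum fun ν hν => ?_
        rw [hterm n ν (Finset.mem_filter.1 hν).2, norm_mul, norm_mul, norm_mul, norm_mul, norm_pow]
        gcongr
        exact norm_hookRatio_le α (Finset.mem_filter.1 hν).2
    _ = ‖rZero α q N‖ * (rowBound α n ^ N * (∑ ν : n.Partition with Multiset.card ν.parts ≤ N,
          ‖specVars a (schur ν)‖ * ‖specVars b (schur ν)‖) * ‖q‖ ^ n) := by
        rw [Finset.mul_sum, Finset.sum_mul, Finset.mul_sum]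
    _ ≤ ‖rZero α q N‖ * (rowBound α n ^ N * (‖risingCoeff (((N : ℝ) * N : ℝ) : ℂ) n‖ *
          (‖a‖ * ‖b‖) ^ n) * ‖q‖ ^ n) := by
        have := Finset.prod_nonneg (s := Finset.range n) (f := fun j : ℕ => 1 + ‖α‖ / ((j : ℝ) + 1))
          fun j _ => by positivity
        have h2 : 0 ≤ rowBound α n ^ N := pow_nonneg this N
        gcongr
        exact sum_norm_schur_mul_le a b n
    _ = _ := by rw [mul_pow ‖q‖]; ring

end GeneratingFunctions

end MonotoneHurwitz

end

/-! ### Assembly of the theorem -/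

open MonotoneHurwitz in
theorem mainTheorem3 :
    -- the class-sum expansion, and the coefficients as walk counts
    (∀ (n k l : ℕ) (q : ℂ) (ν : n.Partition),
      (∀ (μ : n.Partition) (h : Equiv.Perm (Fin n)), HasCycleType h μ →
        mixedHurwitz k l ν μ = (walkCountTo k l ν h : ℂ)) ∧
      MvPowerSeries.coeff (expo k l) (twist n q * MvPowerSeries.C (classSum ν)) =
        ∑ μ : n.Partition, (q ^ n * mixedHurwitz k l ν μ) • classSum μ) ∧
    -- the image under the characteristic map, in power sums and in Schur functions
    (∀ (n k l : ℕ) (q : ℂ),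
      charMap₂ n (∑ g : Equiv.Perm (Fin n), (n ! : ℂ) •
          (perm g ⊗ₜ[ℂ] (MvPowerSeries.coeff (expo k l) (twist n q) * perm g))) =
        ∑ ν : n.Partition, ∑ μ : n.Partition,
          (q ^ n * mixedHurwitz k l ν μ / (zee μ : ℂ)) • (psumPart ν ⊗ₜ[ℂ] psumPart μ) ∧
      charMap₂ n (∑ g : Equiv.Perm (Fin n), (n ! : ℂ) •
          (perm g ⊗ₜ[ℂ] (MvPowerSeries.coeff (expo k l) (twist n q) * perm g))) =
        ∑ ν : n.Partition,
          (q ^ n * MvPowerSeries.coeff (expo k l) (contentSeries ν)) •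
            (schur ν ⊗ₜ[ℂ] schur ν)) ∧
    -- the matrix integral
    (∀ (α : ℂ) (N : ℕ), (∀ m : ℕ, 0 < m → α ≠ (m : ℂ)) → 0 < N →
      (∀ (q : ℂ) (n : ℕ) (ν : n.Partition), q ≠ 0 → Multiset.card ν.parts ≤ N →
        (q * (1 - α / N)) ^ n * contentProd ν (-1 / (N : ℂ)) (1 / ((N : ℂ) - α)) =
          rPart α q N ν / rZero α q N) ∧
      (∀ (q : ℂ) (a b : Fin N → ℂ), q ≠ 0 → (∀ i j, ‖q * a i * b j‖ < 1) →
        Integrable (integrand N α q a b) (unitaryHaar N) ∧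
        HasSum (fun ν : Σ n : ℕ, n.Partition =>
            rPart α q N ν.2 * evalAt a (schur ν.2) * evalAt b (schur ν.2))
          (rZero α q N * matrixIntegral N α q a b)) ∧
      (∀ a b : Fin N → ℂ, ∃ c : ℕ → ℂ,
        (∀ q : ℂ, (∀ i j, ‖q * a i * b j‖ < 1) →
          HasSum (fun n => c n * q ^ n) (matrixIntegral N α q a b)) ∧
        ∀ n ≤ N, HasSum (fun kl : ℕ × ℕ =>
            (1 - α / N) ^ n * (-1 / (N : ℂ)) ^ kl.1 * (1 / ((N : ℂ) - α)) ^ kl.2 *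
              ∑ ν : n.Partition, ∑ μ : n.Partition,
                mixedHurwitz kl.1 kl.2 ν μ / (zee μ : ℂ) *
                  evalAt a (psumPart ν) * evalAt b (psumPart μ))
          (c n))) := by
  refine ⟨fun n k l q ν => ⟨fun μ h hh => mixedHurwitz_eq_walkCountTo k l ν μ hh,
      coeff_twist_mul_classSum k l q ν⟩,
    fun n k l q => ⟨charMap₂_twist_eq_psum k l q, charMap₂_twist_eq_schur k l q⟩,
    fun α N hα hN => ⟨fun q n ν hq hν => pow_mul_contentProd_eq_rPart hα hN hq hν, ?_, ?_⟩⟩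
  · intro q a b hq hab
    have h := norm_mul_norm_lt_one a b hN hab
    exact ⟨(integrable_integrand α a b h).1, hasSum_tau hα hN hq a b h⟩
  · intro a b
    exact ⟨integralCoeff α a b, fun q hab =>
      (integrable_integrand α a b (norm_mul_norm_lt_one a b hN hab)).2,
      fun n hn => hasSum_mixedHurwitz hα hN hn a b⟩
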